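/- Consider all data $(F,\rho^+,\rho^-)$ of the following kind (the Poincaré return map of a geometric Lorenz model). The points are $\rho^+=(r^-,t^-)$ and $\rho^-=(r^+,t^+)$ in $\mathbb{R}^2$, with $r^+>0$ and $r^-=-r^+$. Put $V=[r^-,r^+]\times[-27,27]$ and $D=\{(x,y)\in V: x=0\}$. The map $F:V\setminus D\to V$ is continuous and satisfies $F(-x,-y)=-F(x,y)$. It has the form $F(x,y)=(f(x),g(x,y))$, and there is a constant $c<1/\sqrt2$ (not given as an input) such that, with one-sided derivatives at the boundary of $V$: - $f'(x)>\sqrt2$ for $x\ne0$, $f'(x)\to\infty$ as $x\to0$, $0<f(r^+)<r^+$, and $r^-<f(r^-)<0$; - $0<\partial g/\partial x\le c$ and $0<\partial g/\partial y\le c$ for $x\neq0$, and $\partial g/\partial y\to0$ as $x\to0$; - $\lim_{x\to0^-}F(x,y)=\rho^-$ and $\lim_{x\to0^+}F(x,y)=\rho^+$ for every $y\in[-27,27]$. Define $F^0(V\setminus D)=V\setminus D$ and $F^{n+1}(V\setminus D)=F(F^n(V\setminus D)\setminus D)$, and let $$A=\bigcap_{n\ge0}\overline{F^n(V\setminus D)}.$$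 **Theorem 1.** The operation $(F,\rho^{+},\rho^{-})\mapsto A$ is computable: there is a single oracle machine which, given any name of any such $(F,\rho^+,\rho^-)$ as an oracle, computes a name of the closed set $A$. Names are as follows. - A name of a point $x\in\mathbb{R}^2$ is a sequence of rational points $r_k$ with $|x-r_k|<2^{-k}$. - A name of a continuous function $h$ on a product $I\times J$ of bounded intervals is a double sequence of polynomials $P_{k,l}$ with rational coefficients such that $|P_{k,l}-h|<2^{-l}$ on $I_k\times J_k$. Here $I_k$ arises from $I$ by cutting off length $2^{-k}$ at each endpoint that does not belong to $I$, and $J_k$ likewise from $J$. - A name of $F$ consists of names of both of its coordinates on $(0,r^+]\times[-27,27]$ and on $[r^-,0)\times[-27,27]$. A name of $(F,\rho^+,\rho^-)$ consists of a name of $F$ and names of $\rho^\pm$. - A name of a closed set $A\subseteq\mathbb{R}^2$ consists of an inner name and an outer name. An inner name is a name of a sequence of points of $A$ that is dense in $A$ (a double sequence of rational points $r_{j,k}$ with $|x_j-r_{j,k}|<2^{-k}$). An outer name is a sequence of open balls with rational centres and rational radii whose union is $\mathbb{R}^2\setminus A$. -/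

import Mathlib

open Set Filter Topology

/-! ### Oracle machines and computable maps between represented spaces -/

/-- Programs for partial recursive functions with an oracle. -/
inductive OracleCode : Type
  | zero : OracleCode
  | succ : OracleCode
  | left : OracleCode
  | right : OracleCode
  | oracle : OracleCode
  | pair : OracleCode → OracleCode → OracleCode
  | comp : OracleCode → OracleCode → OracleCode
  | prec : OracleCode → OracleCode → OracleCode
  | rfind : OracleCode → OracleCode

/-- The partial function computed by a program when its oracle is the sequence `p`.
Apart from the instruction `oracle` this is `Nat.Partrec.Code.eval`. -/
def OracleCode.eval (p : ℕ → ℕ) : OracleCode → ℕ →. ℕ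
  | zero => fun _ => Part.some 0
  | succ => fun n => Part.some (n + 1)
  | left => fun n => Part.some n.unpair.1
  | right => fun n => Part.some n.unpair.2
  | oracle => fun n => Part.some (p n)
  | pair cf cg => fun n => Nat.pair <$> eval p cf n <*> eval p cg n
  | comp cf cg => fun n => eval p cg n >>= eval p cf
  | prec cf cg =>
    Nat.unpaired fun a n =>
      n.rec (eval p cf a) fun y ih => do
        let i ← ih
        eval p cg (Nat.pair a (Nat.pair y i))
  | rfind cf => fun a =>
      Nat.rfind fun n => (fun m => decide (m = 0)) <$> eval p cf (Nat.pair a n)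

/-- `Φ : X → Y` is computable with respect to the naming relations `δX p x` (the sequence `p` is
a name of `x`) and `δY`: a single oracle program turns every name of every `x` into a name of
`Φ x`. -/
def ComputableMap {X Y : Type*} (δX : (ℕ → ℕ) → X → Prop) (δY : (ℕ → ℕ) → Y → Prop)
    (Φ : X → Y) : Prop :=
  ∃ c : OracleCode, ∀ (p : ℕ → ℕ) (x : X), δX p x →
    ∃ q : ℕ → ℕ, (∀ n, c.eval p n = Part.some (q n)) ∧ δY q (Φ x)

/-- The `i`-th of the countably many sequences that are merged into the sequence `p`. -/
def slice (p : ℕ → ℕ) (i : ℕ) : ℕ → ℕ := fun n => p (Nat.pair i n)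

/-! ### Names of points, of closed sets and of continuous functions -/

/-- The Euclidean plane. -/
abbrev Plane := EuclideanSpace ℝ (Fin 2)

/-- A numbering of the rational numbers: `⟨⟨a, b⟩, d⟩ ↦ (a - b) / (d + 1)`. -/
def ratOfCode (n : ℕ) : ℚ :=
  ((n.unpair.1.unpair.1 : ℚ) - (n.unpair.1.unpair.2 : ℚ)) / ((n.unpair.2 : ℚ) + 1)

/-- A numbering of the points of the plane with rational coordinates. -/
noncomputable def ratPointOfCode (n : ℕ) : Plane :=
  !₂[(ratOfCode n.unpair.1 : ℝ), (ratOfCode n.unpair.2 : ℝ)]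

/-- A numbering of the polynomials in two variables with rational coefficients: `n` codes a list
of triples `(a, i, j)`, each of which stands for the term `ratOfCode a * X₀ ^ i * X₁ ^ j`. -/
noncomputable def polyOfCode (n : ℕ) : MvPolynomial (Fin 2) ℚ :=
  ((Denumerable.ofNat (List (ℕ × ℕ × ℕ)) n).map fun t =>
    MvPolynomial.C (ratOfCode t.1) * MvPolynomial.X 0 ^ t.2.1 * MvPolynomial.X 1 ^ t.2.2).sum

/-- A name of a point: a sequence of rational points, the `k`-th at distance less than `2⁻ᵏ`. -/
def IsPointName (q : ℕ → ℕ) (x : Plane) : Prop :=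
  ∀ k : ℕ, dist x (ratPointOfCode (q k)) < (1 / 2 : ℝ) ^ k

/-- An inner name of `A`: a name of a sequence of points of `A` that is dense in `A`. -/
def IsInnerName (q : ℕ → ℕ) (A : Set Plane) : Prop :=
  ∃ x : ℕ → Plane, (∀ j, x j ∈ A) ∧ A ⊆ closure (range x) ∧ ∀ j, IsPointName (slice q j) (x j)

/-- An outer name of `A`: a sequence of open balls with rational centres and rational radii whose
union is the complement of `A`. -/
def IsOuterName (q : ℕ → ℕ) (A : Set Plane) : Prop :=
  Aᶜ = ⋃ n, Metric.ball (ratPointOfCode (q n).unpair.1) (ratOfCode (q n).unpair.2 : ℝ)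

/-- A name of a closed set: an inner name together with an outer name. -/
def IsClosedSetName (q : ℕ → ℕ) (A : TopologicalSpace.Closeds Plane) : Prop :=
  IsInnerName (slice q 0) (A : Set Plane) ∧ IsOuterName (slice q 1) (A : Set Plane)

/-- The `k`-th member of the exhaustion of a bounded interval `I` by compact intervals: `I` is
shortened by `2⁻ᵏ` at each endpoint that does not belong to it. -/
def shrink (I : Set ℝ) (k : ℕ) : Set ℝ :=
  {x ∈ I | (sInf I ∉ I → sInf I + (1 / 2 : ℝ) ^ k ≤ x) ∧
    (sSup I ∉ I → x ≤ sSup I - (1 / 2 : ℝ) ^ k)}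

/-- A name of a continuous function `h` on the product `I × J` of two bounded intervals: a double
sequence `P k l` of rational polynomials with `|P k l - h| < 2⁻ˡ` on the `k`-th member of the
exhaustion of `I × J`. -/
def IsFunName (q : ℕ → ℕ) (I J : Set ℝ) (h : Plane → ℝ) : Prop :=
  ∀ k l : ℕ, ∀ x ∈ shrink I k, ∀ y ∈ shrink J k,
    |MvPolynomial.aeval ![x, y] (polyOfCode (q (Nat.pair k l))) - h !₂[x, y]| < (1 / 2 : ℝ) ^ l

/-! ### Return maps of geometric Lorenz models -/

/-- The rectangle `V = [r⁻, r⁺] × [-27, 27]`. -/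
def lorenzV (rm rp : ℝ) : Set Plane := {z | z 0 ∈ Icc rm rp ∧ z 1 ∈ Icc (-27) 27}

/-- The segment `D` of `V` on the line `x = 0`. -/
def lorenzD (rm rp : ℝ) : Set Plane := {z ∈ lorenzV rm rp | z 0 = 0}

/-- `F` has the form `F (x, y) = (f x, g (x, y))` on `V ∖ D`, where `f'`, `gx = ∂g/∂x` and
`gy = ∂g/∂y` (one-sided on the boundary of `V`) satisfy the expansion and contraction
conditions of a geometric Lorenz model. -/
structure IsLorenzSkewProduct (F : Plane → Plane) (rm rp : ℝ) (f f' : ℝ → ℝ)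
    (g gx gy : ℝ → ℝ → ℝ) (c : ℝ) : Prop where
  eq : ∀ x ∈ Icc rm rp, x ≠ 0 → ∀ y ∈ Icc (-27 : ℝ) 27, F !₂[x, y] = !₂[f x, g x y]
  hasDeriv : ∀ x ∈ Icc rm rp, x ≠ 0 → HasDerivWithinAt f (f' x) (Icc rm rp) x
  sqrt_two_lt : ∀ x ∈ Icc rm rp, x ≠ 0 → √2 < f' x
  tendsto_deriv : Tendsto f' (𝓝[≠] 0) atTop
  f_right : 0 < f rp ∧ f rp < rp
  f_left : rm < f rm ∧ f rm < 0
  hasDeriv_x : ∀ x ∈ Icc rm rp, x ≠ 0 → ∀ y ∈ Icc (-27 : ℝ) 27,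
    HasDerivWithinAt (fun s => g s y) (gx x y) (Icc rm rp) x
  hasDeriv_y : ∀ x ∈ Icc rm rp, x ≠ 0 → ∀ y ∈ Icc (-27 : ℝ) 27,
    HasDerivWithinAt (fun s => g x s) (gy x y) (Icc (-27) 27) y
  c_lt : c < 1 / √2
  gx_bound : ∀ x ∈ Icc rm rp, x ≠ 0 → ∀ y ∈ Icc (-27 : ℝ) 27, 0 < gx x y ∧ gx x y ≤ c
  gy_bound : ∀ x ∈ Icc rm rp, x ≠ 0 → ∀ y ∈ Icc (-27 : ℝ) 27, 0 < gy x y ∧ gy x y ≤ c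
  tendsto_gy : ∀ y ∈ Icc (-27 : ℝ) 27, Tendsto (fun x => gy x y) (𝓝[≠] 0) (𝓝 0)

/-- The data of the return map of a geometric Lorenz model: the map `F` and the points
`ρ⁺ = (r⁻, t⁻)` and `ρ⁻ = (r⁺, t⁺)`. Only the values of `F` on `V ∖ D` carry information. -/
structure LorenzReturnMap where
  F : Plane → Plane
  ρplus : Plane
  ρminus : Plane
  r_pos : 0 < ρminus 0
  r_symm : ρplus 0 = -ρminus 0
  continuousOn : ContinuousOn F (lorenzV (ρplus 0) (ρminus 0) \ lorenzD (ρplus 0) (ρminus 0))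
  mapsTo : MapsTo F (lorenzV (ρplus 0) (ρminus 0) \ lorenzD (ρplus 0) (ρminus 0))
    (lorenzV (ρplus 0) (ρminus 0))
  odd : ∀ z ∈ lorenzV (ρplus 0) (ρminus 0) \ lorenzD (ρplus 0) (ρminus 0), F (-z) = -F z
  skew : ∃ f f' g gx gy c, IsLorenzSkewProduct F (ρplus 0) (ρminus 0) f f' g gx gy c
  tendsto_left : ∀ y ∈ Icc (-27 : ℝ) 27, Tendsto (fun x : ℝ => F !₂[x, y]) (𝓝[<] 0) (𝓝 ρminus)
  tendsto_right : ∀ y ∈ Icc (-27 : ℝ) 27, Tendsto (fun x : ℝ => F !₂[x, y]) (𝓝[>] 0) (𝓝 ρplus)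

namespace LorenzReturnMap

/-- The rectangle `V` of a return map. -/
def V (L : LorenzReturnMap) : Set Plane := lorenzV (L.ρplus 0) (L.ρminus 0)

/-- The singular segment `D` of a return map. -/
def D (L : LorenzReturnMap) : Set Plane := lorenzD (L.ρplus 0) (L.ρminus 0)

/-- The sets `Fⁿ(V ∖ D)`, where `Fⁿ⁺¹(V ∖ D) = F(Fⁿ(V ∖ D) ∖ D)`. -/
def iter (L : LorenzReturnMap) : ℕ → Set Plane
  | 0 => L.V \ L.D
  | n + 1 => L.F '' (L.iter n \ L.D)

/-- The set `A = ⋂ₙ closure (Fⁿ(V ∖ D))`. -/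
def attractor (L : LorenzReturnMap) : TopologicalSpace.Closeds Plane :=
  ⟨⋂ n, closure (L.iter n), isClosed_iInter fun _ => isClosed_closure⟩

/-- A name of `F` on `V ∖ D`: names of both coordinates of `F` on `(0, r⁺] × [-27, 27]` and on
`[r⁻, 0) × [-27, 27]`. -/
def IsMapName (q : ℕ → ℕ) (L : LorenzReturnMap) : Prop :=
  IsFunName (slice q 0) (Ioc 0 (L.ρminus 0)) (Icc (-27) 27) (fun z => L.F z 0) ∧
  IsFunName (slice q 1) (Ioc 0 (L.ρminus 0)) (Icc (-27) 27) (fun z => L.F z 1) ∧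
  IsFunName (slice q 2) (Ico (L.ρplus 0) 0) (Icc (-27) 27) (fun z => L.F z 0) ∧
  IsFunName (slice q 3) (Ico (L.ρplus 0) 0) (Icc (-27) 27) (fun z => L.F z 1)

/-- A name of `(F, ρ⁺, ρ⁻)`. -/
def IsName (p : ℕ → ℕ) (L : LorenzReturnMap) : Prop :=
  IsMapName (slice p 0) L ∧ IsPointName (slice p 1) L.ρplus ∧ IsPointName (slice p 2) L.ρminus

end LorenzReturnMap

/-!
The attractor `A` is computed from inside and from outside by searching for finite certificates.

On the half `x > 0` of `V` the map `F` is increasing in both coordinates and in both variables, so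
the image of a rational box is enclosed by the images of two corners (`IsName.inBox_of_stepRight`),
and such enclosures become arbitrarily sharp because `F` is continuous (`IsName.exists_stepRight`)
and tends to `ρ⁺` at `x = 0` (`IsName.exists_stepRight_zero`). The half `x < 0` follows since `F` is
odd. The corner values can be bounded from a name of `F`; only at the corner `x = r⁺`, which need
not be rational, a Lipschitz bound of the given polynomials is needed (`IsName.endImageLt_iff`).

*From inside.* Two points on one fibre `x = const` stay on common fibres, and each step contracts
their distance by a factor below `1 / √2`. Since every image `Fᵐ(V ∖ D)` meets all fibres with
`0 < |x| < r⁺`, each point of `F²ᵐ(V ∖ D)` that starts there is within `54 · 2⁻ᵐ` of `A`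
(`exists_mem_attractor_near`), with a rate that does not depend on the unknown constant `c`. Hence
"the open square with rational centre and half side `2⁻ᵏ` meets `A`" is certified by a chain of
`2m` box steps (`IsName.near_iff`), and points of `A` arise as limits of squares that shrink.

*From outside.* Let `Kₙ` be the closure of `Fⁿ(V ∖ D)`. Then `F` maps `Kₙ ∖ D` into `Kₙ₊₁`, and
both `ρ⁺` and `ρ⁻ = -ρ⁺` belong to every `Kₙ₊₁`, because `Fⁿ(V ∖ D)` has points on all fibres near `D`.
So if a point is not in `A = ⋂ Kₙ`, then for some `N` a closed square around it is avoided by all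
`N`-step images of points of `V`, even if points of `D` are given the two images `ρ⁺` and `ρ⁻`. By
backward induction along the orbits and compactness of `V` this has a certificate made of finitely
many boxes (`IsName.excluded_of_forall`).

Relations that have such certificates are called `Semi` here. They are closed under conjunction,
disjunction, existential and bounded universal quantification and under queries to the oracle, so
their semidecidability is read off from their definitions. `Semi.exists_select` and
`Semi.exists_enum` turn them into oracle programs.
-/

/-! ### Primitive recursive arithmetic of rational numbers -/

attribute [fun_prop] Primrec Primrec.id Primrec.const

section PrimrecTools

variable {α β γ σ : Type*} [Primcodable α] [Primcodable β] [Primcodable γ] [Primcodable σ]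

@[fun_prop] theorem Primrec.comp_fun {f : β → σ} {g : α → β} (hf : Primrec f) (hg : Primrec g) :
    Primrec fun a => f (g a) := hf.comp hg

@[fun_prop] theorem Primrec.fst_fun {f : α → β × σ} (hf : Primrec f) :
    Primrec fun a => (f a).1 := Primrec.fst.comp hf

@[fun_prop] theorem Primrec.snd_fun {f : α → β × σ} (hf : Primrec f) :
    Primrec fun a => (f a).2 := Primrec.snd.comp hf

@[fun_prop] theorem Primrec.mk_fun {f : α → β} {g : α → σ} (hf : Primrec f) (hg : Primrec g) :
    Primrec fun a => (f a, g a) := hf.pair hg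

@[fun_prop] theorem Primrec.add_fun {f g : α → ℕ} (hf : Primrec f) (hg : Primrec g) :
    Primrec fun a => f a + g a := Primrec.nat_add.comp hf hg

@[fun_prop] theorem Primrec.mul_fun {f g : α → ℕ} (hf : Primrec f) (hg : Primrec g) :
    Primrec fun a => f a * g a := Primrec.nat_mul.comp hf hg

@[fun_prop] theorem Primrec.sub_fun {f g : α → ℕ} (hf : Primrec f) (hg : Primrec g) :
    Primrec fun a => f a - g a := Primrec.nat_sub.comp hf hg

@[fun_prop] theorem Primrec.natPair_fun {f g : α → ℕ} (hf : Primrec f) (hg : Primrec g) :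
    Primrec fun a => Nat.pair (f a) (g a) := Primrec₂.natPair.comp hf hg

@[fun_prop] theorem Primrec.unpair_fun {f : α → ℕ} (hf : Primrec f) :
    Primrec fun a => Nat.unpair (f a) := Primrec.unpair.comp hf

@[fun_prop] theorem Primrec.pow_fun {f g : α → ℕ} (hf : Primrec f) (hg : Primrec g) :
    Primrec fun a => f a ^ g a :=
  (Primrec₂.unpaired'.1 Nat.Primrec.pow : Primrec₂ ((· ^ ·) : ℕ → ℕ → ℕ)).comp hf hg

/-- A rational-valued function is primitive recursive if codes of its values are. -/
def PrimrecRat (φ : α → ℚ) : Prop := ∃ f : α → ℕ, Primrec f ∧ ∀ a, ratOfCode (f a) = φ a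

theorem ratOfCode_pair (a b d : ℕ) :
    ratOfCode (Nat.pair (Nat.pair a b) d) = ((a : ℚ) - b) / (d + 1) := by
  simp [ratOfCode]

theorem ratOfCode_surjective : Function.Surjective ratOfCode := by
  intro q
  refine ⟨Nat.pair (Nat.pair q.num.toNat (-q.num).toNat) (q.den - 1), ?_⟩
  rw [ratOfCode_pair]
  have h1 : ((q.num.toNat : ℤ) - ((-q.num).toNat : ℤ)) = q.num := by omega
  have h2 : ((q.num.toNat : ℚ) - ((-q.num).toNat : ℚ)) = q.num := by exact_mod_cast h1
  have h3 : ((q.den - 1 : ℕ) : ℚ) + 1 = q.den := by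
    exact_mod_cast Nat.sub_add_cancel q.den_pos
  rw [h2, h3, Rat.num_div_den]

theorem Primrec.primrecRat {f : α → ℕ} (hf : Primrec f) : PrimrecRat fun a => ratOfCode (f a) :=
  ⟨f, hf, fun _ => rfl⟩

theorem PrimrecRat.const (q : ℚ) : PrimrecRat fun _ : α => q := by
  obtain ⟨n, hn⟩ := ratOfCode_surjective q
  exact ⟨fun _ => n, by fun_prop, fun _ => hn⟩

theorem PrimrecRat.comp {φ : β → ℚ} {g : α → β} (hφ : PrimrecRat φ) (hg : Primrec g) :
    PrimrecRat fun a => φ (g a) := by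
  obtain ⟨f, hf, h⟩ := hφ
  exact ⟨fun a => f (g a), by fun_prop, fun a => h (g a)⟩

theorem Primrec.natCast_rat {f : α → ℕ} (hf : Primrec f) : PrimrecRat fun a => (f a : ℚ) :=
  ⟨fun a => Nat.pair (Nat.pair (f a) 0) 0, by fun_prop, fun a => by simp [ratOfCode_pair]⟩

theorem PrimrecRat.add {φ ψ : α → ℚ} (hφ : PrimrecRat φ) (hψ : PrimrecRat ψ) :
    PrimrecRat fun a => φ a + ψ a := by
  obtain ⟨f, hf, h⟩ := hφ
  obtain ⟨g, hg, h'⟩ := hψ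
  refine ⟨fun a => Nat.pair
    (Nat.pair ((f a).unpair.1.unpair.1 * ((g a).unpair.2 + 1) +
        (g a).unpair.1.unpair.1 * ((f a).unpair.2 + 1))
      ((f a).unpair.1.unpair.2 * ((g a).unpair.2 + 1) +
        (g a).unpair.1.unpair.2 * ((f a).unpair.2 + 1)))
    (((f a).unpair.2 + 1) * ((g a).unpair.2 + 1) - 1), by fun_prop, fun a => ?_⟩
  beta_reduce
  rw [ratOfCode_pair, ← h, ← h', ratOfCode, ratOfCode]
  push_cast [Nat.cast_sub (Nat.succ_le_of_lt (Nat.mul_pos (Nat.succ_pos (f a).unpair.2)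
    (Nat.succ_pos (g a).unpair.2)))]
  have h1 : ((f a).unpair.2 : ℚ) + 1 ≠ 0 := by positivity
  have h2 : ((g a).unpair.2 : ℚ) + 1 ≠ 0 := by positivity
  rw [sub_add_cancel]
  field_simp
  ring

theorem PrimrecRat.mul {φ ψ : α → ℚ} (hφ : PrimrecRat φ) (hψ : PrimrecRat ψ) :
    PrimrecRat fun a => φ a * ψ a := by
  obtain ⟨f, hf, h⟩ := hφ
  obtain ⟨g, hg, h'⟩ := hψ
  refine ⟨fun a => Nat.pair
    (Nat.pair ((f a).unpair.1.unpair.1 * (g a).unpair.1.unpair.1 +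
        (f a).unpair.1.unpair.2 * (g a).unpair.1.unpair.2)
      ((f a).unpair.1.unpair.1 * (g a).unpair.1.unpair.2 +
        (f a).unpair.1.unpair.2 * (g a).unpair.1.unpair.1))
    (((f a).unpair.2 + 1) * ((g a).unpair.2 + 1) - 1), by fun_prop, fun a => ?_⟩
  beta_reduce
  rw [ratOfCode_pair, ← h, ← h', ratOfCode, ratOfCode]
  push_cast [Nat.cast_sub (Nat.succ_le_of_lt (Nat.mul_pos (Nat.succ_pos (f a).unpair.2)
    (Nat.succ_pos (g a).unpair.2)))]
  have h1 : ((f a).unpair.2 : ℚ) + 1 ≠ 0 := by positivity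
  have h2 : ((g a).unpair.2 : ℚ) + 1 ≠ 0 := by positivity
  rw [sub_add_cancel]
  field_simp
  ring

theorem PrimrecRat.neg {φ : α → ℚ} (hφ : PrimrecRat φ) : PrimrecRat fun a => -φ a := by
  obtain ⟨f, hf, h⟩ := (PrimrecRat.const (α := α) (-1)).mul hφ
  exact ⟨f, hf, fun a => by rw [h]; ring⟩

theorem PrimrecRat.sub {φ ψ : α → ℚ} (hφ : PrimrecRat φ) (hψ : PrimrecRat ψ) :
    PrimrecRat fun a => φ a - ψ a := by
  obtain ⟨f, hf, h⟩ := hφ.add hψ.neg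
  exact ⟨f, hf, fun a => by rw [h]; ring⟩

theorem PrimrecRat.half_pow {f : α → ℕ} (hf : Primrec f) :
    PrimrecRat fun a => (1 / 2 : ℚ) ^ f a := by
  refine ⟨fun a => Nat.pair (Nat.pair 1 0) (2 ^ f a - 1), by fun_prop, fun a => ?_⟩
  rw [ratOfCode_pair]
  push_cast [Nat.cast_sub (Nat.one_le_two_pow (n := f a))]
  simp

theorem PrimrecRat.pow {φ : α → ℚ} {f : α → ℕ} (hφ : PrimrecRat φ) (hf : Primrec f) :
    PrimrecRat fun a => φ a ^ f a := by
  obtain ⟨m, hm, h⟩ := PrimrecRat.mul (α := ℕ × ℕ) (Primrec.fst.primrecRat) Primrec.snd.primrecRat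
  obtain ⟨e, he⟩ := ratOfCode_surjective 1
  obtain ⟨g, hg, h'⟩ := hφ
  have hrec : Primrec fun a => (Nat.rec e (fun _ v => m (v, g a)) (f a) : ℕ) :=
    Primrec.nat_rec' hf (Primrec.const e)
      (Primrec.to₂ (f := fun x : α × ℕ × ℕ => m (x.2.2, g x.1)) (by fun_prop))
  refine ⟨_, hrec, fun a => ?_⟩
  beta_reduce
  induction f a with
  | zero => simpa using he
  | succ n ih =>
    rw [pow_succ, ← ih, ← h']
    exact h _

theorem PrimrecRat.list_sum {l : α → List β} {φ : α × β → ℚ} (hl : Primrec l)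
    (hφ : PrimrecRat φ) : PrimrecRat fun a => ((l a).map fun b => φ (a, b)).sum := by
  obtain ⟨m, hm, h⟩ := PrimrecRat.add (α := ℕ × ℕ) (Primrec.fst.primrecRat) Primrec.snd.primrecRat
  obtain ⟨e, he⟩ := ratOfCode_surjective 0
  obtain ⟨g, hg, h'⟩ := hφ
  have hrec := Primrec.list_foldr (h := fun a (x : β × ℕ) => m (g (a, x.1), x.2)) hl
    (Primrec.const e)
    (Primrec.to₂ (f := fun x : α × β × ℕ => m (g (x.1, x.2.1), x.2.2)) (by fun_prop))
  refine ⟨_, hrec, fun a => ?_⟩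
  beta_reduce
  induction l a with
  | nil => simpa using he
  | cons b l ih =>
    rw [List.map_cons, List.sum_cons, ← ih, ← h']
    exact h _

theorem PrimrecRat.lt {φ ψ : α → ℚ} (hφ : PrimrecRat φ) (hψ : PrimrecRat ψ) :
    PrimrecPred fun a => φ a < ψ a := by
  obtain ⟨f, hf, h⟩ := hφ
  obtain ⟨g, hg, h'⟩ := hψ
  refine PrimrecPred.of_eq (p := fun a =>
    (f a).unpair.1.unpair.1 * ((g a).unpair.2 + 1) +
        (g a).unpair.1.unpair.2 * ((f a).unpair.2 + 1) <
      (g a).unpair.1.unpair.1 * ((f a).unpair.2 + 1) +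
        (f a).unpair.1.unpair.2 * ((g a).unpair.2 + 1))
    (Primrec.nat_lt.comp (by fun_prop) (by fun_prop)) fun a => ?_
  rw [← h, ← h', ratOfCode, ratOfCode, div_lt_div_iff₀ (by positivity) (by positivity)]
  rw [← @Nat.cast_lt ℚ]
  push_cast
  constructor <;> intro h <;> linarith

theorem PrimrecRat.le {φ ψ : α → ℚ} (hφ : PrimrecRat φ) (hψ : PrimrecRat ψ) :
    PrimrecPred fun a => φ a ≤ ψ a :=
  (hψ.lt hφ).not.of_eq fun _ => not_lt

end PrimrecTools

attribute [fun_prop] PrimrecRat Primrec.primrecRat PrimrecRat.const PrimrecRat.comp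
  Primrec.natCast_rat PrimrecRat.add PrimrecRat.mul PrimrecRat.neg PrimrecRat.sub
  PrimrecRat.half_pow PrimrecRat.pow

/-! ### Oracle programs -/

namespace OracleCode

theorem eval_pair {p : ℕ → ℕ} {cf cg : OracleCode} {n a b : ℕ} (hf : cf.eval p n = Part.some a)
    (hg : cg.eval p n = Part.some b) : (pair cf cg).eval p n = Part.some (Nat.pair a b) := by
  simp [eval, hf, hg, Seq.seq]

theorem eval_comp {p : ℕ → ℕ} {cf cg : OracleCode} {n a b : ℕ} (hg : cg.eval p n = Part.some a)
    (hf : cf.eval p a = Part.some b) : (comp cf cg).eval p n = Part.some b := by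
  change (cg.eval p n).bind (cf.eval p) = _
  rw [hg]
  exact (Part.bind_some _ _).trans hf

theorem eval_prec_eq_some {p : ℕ → ℕ} {cf cg : OracleCode} {a : ℕ} {h : ℕ → ℕ}
    (hf : cf.eval p a = Part.some (h 0))
    (hg : ∀ y, cg.eval p (Nat.pair a (Nat.pair y (h y))) = Part.some (h (y + 1))) (n : ℕ) :
    (OracleCode.prec cf cg).eval p (Nat.pair a n) = Part.some (h n) := by
  induction n with
  | zero => simpa [eval] using hf
  | succ n ih =>
    simp only [eval, Nat.unpaired, Nat.unpair_pair] at ih ⊢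
    rw [ih]
    simpa using hg n

theorem eval_rfind {p : ℕ → ℕ} {cf : OracleCode} {a : ℕ} {h : ℕ → ℕ}
    (hf : ∀ n, cf.eval p (Nat.pair a n) = Part.some (h n)) (hex : ∃ n, h n = 0) :
    ∃ n, (rfind cf).eval p a = Part.some n ∧ h n = 0 := by
  refine ⟨Nat.find hex, ?_, Nat.find_spec hex⟩
  refine Part.eq_some_iff.2 (Nat.mem_rfind.2 ⟨?_, fun {m} hm => ?_⟩)
  · rw [hf]
    simp [Nat.find_spec hex]
  · rw [hf]
    simp [Nat.find_min hex hm]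

/-- Every primitive recursive function has an oracle program, which ignores its oracle. -/
theorem exists_eval_of_primrec {f : ℕ → ℕ} (hf : Primrec f) :
    ∃ c : OracleCode, ∀ p n, c.eval p n = Part.some (f n) := by
  have hf := Primrec.nat_iff.1 hf
  induction hf with
  | zero => exact ⟨zero, fun _ _ => rfl⟩
  | succ => exact ⟨succ, fun _ _ => rfl⟩
  | left => exact ⟨left, fun _ _ => rfl⟩
  | right => exact ⟨right, fun _ _ => rfl⟩
  | pair h1 h2 ih1 ih2 =>
    obtain ⟨c1, h1⟩ := ih1 (Primrec.nat_iff.2 h1)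
    obtain ⟨c2, h2⟩ := ih2 (Primrec.nat_iff.2 h2)
    exact ⟨pair c1 c2, fun p n => eval_pair (h1 p n) (h2 p n)⟩
  | comp h1 h2 ih1 ih2 =>
    obtain ⟨c1, h1⟩ := ih1 (Primrec.nat_iff.2 h1)
    obtain ⟨c2, h2⟩ := ih2 (Primrec.nat_iff.2 h2)
    exact ⟨comp c1 c2, fun p n => eval_comp (h2 p n) (h1 p _)⟩
  | @prec f g h1 h2 ih1 ih2 =>
    obtain ⟨c1, h1⟩ := ih1 (Primrec.nat_iff.2 h1)
    obtain ⟨c2, h2⟩ := ih2 (Primrec.nat_iff.2 h2)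
    refine ⟨OracleCode.prec c1 c2, fun p n => ?_⟩
    have := eval_prec_eq_some (p := p) (cf := c1) (cg := c2) (a := n.unpair.1)
      (h := fun m => Nat.rec (f n.unpair.1)
        (fun y IH => g (Nat.pair n.unpair.1 (Nat.pair y IH))) m) (h1 p _) (fun y => h2 p _) n.unpair.2
    rwa [Nat.pair_unpair] at this

end OracleCode

/-- The graph of `p` on `{0, …, n - 1}`, as a list. -/
def graphList (p : ℕ → ℕ) : ℕ → List (ℕ × ℕ)
  | 0 => []
  | n + 1 => (n, p n) :: graphList p n

theorem mem_graphList {p : ℕ → ℕ} {n : ℕ} {t : ℕ × ℕ} :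
    t ∈ graphList p n ↔ t.1 < n ∧ p t.1 = t.2 := by
  induction n with
  | zero => simp [graphList]
  | succ n ih =>
    rw [graphList, List.mem_cons, ih]
    constructor
    · rintro (rfl | ⟨h1, h2⟩)
      · simp
      · exact ⟨by omega, h2⟩
    · rintro ⟨h1, h2⟩
      rcases Nat.lt_succ_iff_lt_or_eq.1 h1 with h | h
      · exact Or.inr ⟨h, h2⟩
      · left; ext <;> simp [h, ← h2]

open Encodable in
theorem OracleCode.exists_eval_graphList :
    ∃ c : OracleCode, ∀ p n, c.eval p n = Part.some (encode (graphList p n)) := by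
  obtain ⟨d, hd⟩ := exists_eval_of_primrec (f := fun n => Nat.pair 0 n) (by fun_prop)
  obtain ⟨z, hz⟩ := exists_eval_of_primrec (Primrec.const (α := ℕ) (encode (graphList id 0)))
  -- `e` receives `⟨p y, ⟨a, ⟨y, code of the graph below y⟩⟩⟩`.
  obtain ⟨e, he⟩ := exists_eval_of_primrec (f := fun n =>
    Nat.succ (Nat.pair (Nat.pair n.unpair.2.unpair.2.unpair.1 n.unpair.1)
      n.unpair.2.unpair.2.unpair.2)) (Primrec.succ.comp (by fun_prop))
  obtain ⟨y, hy⟩ := exists_eval_of_primrec (f := fun n => n.unpair.2.unpair.1) (by fun_prop)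
  obtain ⟨i, hi⟩ := exists_eval_of_primrec (f := fun n => n) (by fun_prop)
  refine ⟨comp (OracleCode.prec z (comp e (pair (comp oracle y) i))) d, fun p n => ?_⟩
  refine eval_comp (hd p n) (eval_prec_eq_some (h := fun n => encode (graphList p n)) (hz p 0) ?_ n)
  intro m
  refine eval_comp (eval_pair (eval_comp (hy p _) rfl) (hi p _)) ?_
  rw [he]
  simp [graphList]

/-! ### Semidecidable relations between an oracle and discrete data -/

section Semi

open Encodable

variable {α β : Type} [Primcodable α] [Primcodable β]

/-- `S p a` is semidecidable, uniformly in the oracle `p`: it holds iff there is a certificate `w`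
that stands in a primitive recursive relation `E` to `a` and whose finitely many claims `L w` about
the values of `p` are true. -/
def Semi (S : (ℕ → ℕ) → α → Prop) : Prop :=
  ∃ (γ : Type) (_ : Primcodable γ) (E : α → γ → Prop) (L : γ → List (ℕ × ℕ)),
    PrimrecRel E ∧ Primrec L ∧ ∀ p a, S p a ↔ ∃ w, (∀ t ∈ L w, p t.1 = t.2) ∧ E a w

theorem Semi.of_eq {S T : (ℕ → ℕ) → α → Prop} (h : Semi S) (e : ∀ p a, S p a ↔ T p a) : Semi T := by
  have : S = T := by ext p a; exact e p a
  exact this ▸ h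

theorem PrimrecPred.semi {P : α → Prop} (h : PrimrecPred P) : Semi fun _ a => P a :=
  ⟨Unit, inferInstance, fun a _ => P a, fun _ => [], h.comp Primrec.fst, by fun_prop, by simp⟩

theorem Semi.comp {S : (ℕ → ℕ) → β → Prop} (h : Semi S) {f : α → β} (hf : Primrec f) :
    Semi fun p a => S p (f a) := by
  obtain ⟨γ, _, E, L, hE, hL, h⟩ := h
  exact ⟨γ, inferInstance, fun a w => E (f a) w, L, hE.comp (by fun_prop) (by fun_prop), hL,
    fun p a => h p (f a)⟩

theorem Semi.and {S T : (ℕ → ℕ) → α → Prop} (hS : Semi S) (hT : Semi T) :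
    Semi fun p a => S p a ∧ T p a := by
  obtain ⟨γ, _, E, L, hE, hL, h⟩ := hS
  obtain ⟨γ', _, E', L', hE', hL', h'⟩ := hT
  refine ⟨γ × γ', inferInstance, fun a w => E a w.1 ∧ E' a w.2, fun w => L w.1 ++ L' w.2,
    (hE.comp (f := fun x : α × γ × γ' => x.1) (g := fun x => x.2.1) (by fun_prop)
      (by fun_prop)).and (hE'.comp (f := fun x : α × γ × γ' => x.1) (g := fun x => x.2.2)
        (by fun_prop) (by fun_prop)),
    Primrec.list_append.comp (by fun_prop) (by fun_prop), fun p a => ?_⟩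
  beta_reduce
  rw [h, h']
  constructor
  · rintro ⟨⟨w, h1, h2⟩, ⟨w', h1', h2'⟩⟩
    refine ⟨(w, w'), fun t ht => ?_, h2, h2'⟩
    rcases List.mem_append.1 ht with ht | ht
    exacts [h1 t ht, h1' t ht]
  · rintro ⟨w, h1, h2, h2'⟩
    exact ⟨⟨w.1, fun t ht => h1 t (List.mem_append_left _ ht), h2⟩,
      ⟨w.2, fun t ht => h1 t (List.mem_append_right _ ht), h2'⟩⟩

theorem Semi.ex {S : (ℕ → ℕ) → α × β → Prop} (hS : Semi S) :
    Semi fun p a => ∃ b, S p (a, b) := by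
  obtain ⟨γ, _, E, L, hE, hL, h⟩ := hS
  refine ⟨β × γ, inferInstance, fun a w => E (a, w.1) w.2, fun w => L w.2,
    hE.comp (f := fun x : α × β × γ => (x.1, x.2.1)) (g := fun x => x.2.2) (by fun_prop)
      (by fun_prop), by fun_prop, fun p a => ?_⟩
  simp only [h, Prod.exists]

theorem Semi.or {S T : (ℕ → ℕ) → α → Prop} (hS : Semi S) (hT : Semi T) :
    Semi fun p a => S p a ∨ T p a := by
  obtain ⟨γ, _, E, L, hE, hL, h⟩ := hS
  obtain ⟨γ', _, E', L', hE', hL', h'⟩ := hT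
  classical
  refine ⟨γ ⊕ γ', inferInstance, fun a w => w.elim (E a) (E' a), fun w => w.elim L L', ?_,
    ?_, fun p a => ?_⟩
  · refine Primrec₂.primrecRel (R := fun a (w : γ ⊕ γ') => w.elim (E a) (E' a)) ?_
    refine (Primrec.sumCasesOn (f := fun x : α × (γ ⊕ γ') => x.2)
      (g := fun x w => decide (E x.1 w)) (h := fun x w => decide (E' x.1 w)) (by fun_prop)
      (hE.decide.comp (by fun_prop) (by fun_prop))
      (hE'.decide.comp (by fun_prop) (by fun_prop))).of_eq ?_
    rintro ⟨a, w | w⟩ <;> simp only [Sum.elim_inl, Sum.elim_inr] <;> congr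
  · refine (Primrec.sumCasesOn (f := fun x : γ ⊕ γ' => x) (g := fun _ w => L w)
      (h := fun _ w => L' w) (by fun_prop) (hL.comp (by fun_prop))
      (hL'.comp (by fun_prop))).of_eq ?_
    rintro (w | w) <;> simp
  · beta_reduce
    rw [h, h']
    constructor
    · rintro (⟨w, hw⟩ | ⟨w, hw⟩)
      exacts [⟨.inl w, hw⟩, ⟨.inr w, hw⟩]
    · rintro ⟨w | w, hw⟩
      exacts [.inl ⟨w, hw⟩, .inr ⟨w, hw⟩]

theorem Semi.forall_mem [DecidableEq β] {S : (ℕ → ℕ) → α × β → Prop} (hS : Semi S)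
    {l : α → List β} (hl : Primrec l) : Semi fun p a => ∀ b ∈ l a, S p (a, b) := by
  obtain ⟨γ, _, E, L, hE, hL, h⟩ := hS
  refine ⟨List (β × γ), inferInstance,
    fun a ws => ∀ b ∈ l a, ∃ w ∈ ws, w.1 = b ∧ E (a, b) w.2,
    fun ws => ws.flatMap fun w => L w.2, ?_,
    Primrec.list_flatMap (by fun_prop)
      (Primrec.to₂ (f := fun x : List (β × γ) × β × γ => L x.2.2) (by fun_prop)), fun p a => ?_⟩
  · have h1 : PrimrecRel fun (w : β × γ) (x : α × β) => w.1 = x.2 ∧ E x w.2 :=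
      (Primrec.eq.comp (f := fun x : (β × γ) × α × β => x.1.1) (g := fun x => x.2.2) (by fun_prop)
        (by fun_prop)).and
      (hE.comp (f := fun x : (β × γ) × α × β => x.2) (g := fun x => x.1.2) (by fun_prop)
        (by fun_prop))
    have h2 : PrimrecRel fun (b : β) (x : α × List (β × γ)) =>
        ∃ w ∈ x.2, w.1 = b ∧ E (x.1, b) w.2 :=
      h1.exists_mem_list.comp (f := fun x : β × α × List (β × γ) => x.2.2)
        (g := fun x => (x.2.1, x.1)) (by fun_prop) (by fun_prop)
    exact h2.forall_mem_list.comp (f := fun x : α × List (β × γ) => l x.1) (g := fun x => x)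
      (by fun_prop) (by fun_prop)
  · constructor
    · intro H
      have : ∀ b : {b // b ∈ l a}, ∃ w, (∀ t ∈ L w, p t.1 = t.2) ∧ E (a, b.1) w :=
        fun b => (h p _).1 (H b.1 b.2)
      choose w hw using this
      refine ⟨(l a).attach.map fun b => (b.1, w b), ?_, ?_⟩
      · intro t ht
        obtain ⟨x, hx, htx⟩ := List.mem_flatMap.1 ht
        obtain ⟨b, -, rfl⟩ := List.mem_map.1 hx
        exact (hw b).1 t htx
      · intro b hb
        exact ⟨_, List.mem_map.2 ⟨⟨b, hb⟩, List.mem_attach _ _, rfl⟩, rfl, (hw ⟨b, hb⟩).2⟩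
    · rintro ⟨ws, h1, h2⟩ b hb
      obtain ⟨w, hw, -, hE⟩ := h2 b hb
      exact (h p _).2 ⟨w.2, fun t ht => h1 t (List.mem_flatMap.2 ⟨w, hw, ht⟩), hE⟩

/-- A semidecidable relation may refer to values of the oracle. -/
theorem Semi.query {S : (ℕ → ℕ) → α × ℕ → Prop} (hS : Semi S) {i : α → ℕ} (hi : Primrec i) :
    Semi fun p a => S p (a, p (i a)) := by
  have h : Semi fun p (x : α × ℕ) => p (i x.1) = x.2 :=
    ⟨ℕ × ℕ, inferInstance, fun x w => w = (i x.1, x.2), fun w => [w],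
      Primrec.eq.comp (f := fun x : (α × ℕ) × ℕ × ℕ => x.2) (g := fun x => (i x.1.1, x.1.2))
        (by fun_prop) (by fun_prop),
      Primrec.list_cons.comp (by fun_prop) (by fun_prop), fun p x => by simp⟩
  exact (h.and hS).ex.of_eq fun p a => by simp

/-- The certificates of a semidecidable relation can be checked by an oracle program. -/
theorem Semi.exists_test {S : (ℕ → ℕ) → α → Prop} (hS : Semi S) :
    ∃ (c : OracleCode) (T : (ℕ → ℕ) → ℕ → ℕ), (∀ p n, c.eval p n = Part.some (T p n)) ∧
      ∀ p a, S p a ↔ ∃ w, T p (Nat.pair (encode a) w) = 0 := by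
  classical
  obtain ⟨γ, _, E, L, hE, hL, h⟩ := hS
  obtain ⟨g, hg⟩ := OracleCode.exists_eval_graphList
  -- `Q` checks the certificate against a finite part of the graph of the oracle.
  let Q : List (ℕ × ℕ) → ℕ → Prop := fun gr n =>
    ∃ w ∈ (decode (α := γ) n.unpair.2.unpair.1).toList, (∀ t ∈ L w, t ∈ gr) ∧
      ∃ a ∈ (decode (α := α) n.unpair.1).toList, E a w
  have hQ : PrimrecRel Q := by
    have h1 : PrimrecRel fun (a : α) (x : γ × List (ℕ × ℕ) × ℕ) => E a x.1 :=
      hE.comp (f := fun x : α × γ × List (ℕ × ℕ) × ℕ => x.1) (g := fun x => x.2.1) (by fun_prop)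
        (by fun_prop)
    have h2 : PrimrecRel fun (t : ℕ × ℕ) (gr : List (ℕ × ℕ)) => t ∈ gr :=
      (Primrec.eq (α := ℕ × ℕ)).exists_mem_list.swap.of_eq fun a b => by simp [Function.swap]
    have h3 : PrimrecRel fun (w : γ) (x : List (ℕ × ℕ) × ℕ) => (∀ t ∈ L w, t ∈ x.1) ∧
        ∃ a ∈ (decode (α := α) x.2.unpair.1).toList, E a w :=
      (h2.forall_mem_list.comp (f := fun x : γ × List (ℕ × ℕ) × ℕ => L x.1) (g := fun x => x.2.1)
        (by fun_prop) (by fun_prop)).and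
      (h1.exists_mem_list.comp (f := fun x : γ × List (ℕ × ℕ) × ℕ =>
          (decode (α := α) x.2.2.unpair.1).toList) (g := fun x => x)
        (Primrec.optionToList.comp (Primrec.decode.comp (by fun_prop))) (by fun_prop))
    exact h3.exists_mem_list.comp (f := fun x : List (ℕ × ℕ) × ℕ =>
        (decode (α := γ) x.2.unpair.2.unpair.1).toList) (g := fun x => x)
      (Primrec.optionToList.comp (Primrec.decode.comp (by fun_prop))) (by fun_prop)
  obtain ⟨e, he⟩ := OracleCode.exists_eval_of_primrec (f := fun m => if Q
      ((decode (α := List (ℕ × ℕ)) m.unpair.1).getD []) m.unpair.2 then 0 else 1)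
    (Primrec.ite (hQ.comp (Primrec.option_getD.comp (Primrec.decode.comp (by fun_prop))
      (by fun_prop)) (by fun_prop)) (by fun_prop) (by fun_prop))
  obtain ⟨b, hb⟩ := OracleCode.exists_eval_of_primrec (f := fun n => n.unpair.2.unpair.2)
    (by fun_prop)
  obtain ⟨i, hi⟩ := OracleCode.exists_eval_of_primrec (f := fun n => n) (by fun_prop)
  refine ⟨.comp e (.pair (.comp g b) i), _,
    fun p n => OracleCode.eval_comp (OracleCode.eval_pair (OracleCode.eval_comp (hb p n) (hg p _))
      (hi p n)) (he p _), fun p a => ?_⟩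
  rw [h]
  simp only [Nat.unpair_pair, encodek, Option.getD_some, ite_eq_left_iff, one_ne_zero, imp_false,
    not_not, Q, mem_graphList, Option.mem_toList, Option.some.injEq]
  constructor
  · rintro ⟨w, h1, h2⟩
    refine ⟨Nat.pair (encode w) ((L w).foldr (fun t s => t.1 + 1 + s) 0), w, by simp, ?_, a, rfl,
      h2⟩
    intro t ht
    refine ⟨?_, h1 t ht⟩
    rw [Nat.unpair_pair]
    generalize L w = l at ht
    induction l with
    | nil => simp at ht
    | cons u l ih =>
      rw [List.foldr_cons]
      rcases List.mem_cons.1 ht with rfl | ht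
      · omega
      · have := ih ht
        omega
  · rintro ⟨_, w, -, h1, a, rfl, h2⟩
    exact ⟨w, fun t ht => (h1 t ht).2, h2⟩

/-- Selection: an oracle program finds a value that stands in a given semidecidable relation to its
input, whenever there is one. -/
theorem Semi.exists_select {S : (ℕ → ℕ) → ℕ × ℕ → Prop} (hS : Semi S) :
    ∃ c : OracleCode, ∀ p n, (∃ v, S p (n, v)) → ∃ v, c.eval p n = Part.some v ∧ S p (n, v) := by
  obtain ⟨c, T, hc, hT⟩ := hS.exists_test
  obtain ⟨d, hd⟩ := OracleCode.exists_eval_of_primrec (f := fun m =>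
    Nat.pair (Nat.pair m.unpair.1 m.unpair.2.unpair.1) m.unpair.2.unpair.2) (by fun_prop)
  obtain ⟨e, he⟩ := OracleCode.exists_eval_of_primrec (f := fun m => m.unpair.1) (by fun_prop)
  refine ⟨.comp e (.rfind (.comp c d)), fun p n ⟨v, hv⟩ => ?_⟩
  obtain ⟨w, hw⟩ := (hT p _).1 hv
  obtain ⟨m, hm, hm0⟩ := OracleCode.eval_rfind (p := p) (cf := .comp c d) (a := n)
    (h := fun m => T p (Nat.pair (Nat.pair n m.unpair.1) m.unpair.2))
    (fun m => OracleCode.eval_comp (hd p _) (by rw [hc]; simp))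
    ⟨Nat.pair v w, by simpa using hw⟩
  exact ⟨_, OracleCode.eval_comp hm (he p _), (hT p _).2 ⟨m.unpair.2, by simpa using hm0⟩⟩

/-- Enumeration: an oracle program lists the elements of a nonempty semidecidable set. -/
theorem Semi.exists_enum {S : (ℕ → ℕ) → ℕ → Prop} (hS : Semi S) :
    ∃ c : OracleCode, ∀ p, (∃ v, S p v) →
      ∃ q : ℕ → ℕ, (∀ n, c.eval p n = Part.some (q n)) ∧ ∀ v, S p v ↔ v ∈ range q := by
  obtain ⟨c, T, hc, hT⟩ := hS.exists_test
  obtain ⟨s, hs⟩ := (hS.comp (α := ℕ × ℕ) (f := fun x => x.2) (by fun_prop)).exists_select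
  obtain ⟨z, hz⟩ := OracleCode.exists_eval_of_primrec (Primrec.const (α := ℕ) 0)
  obtain ⟨i, hi⟩ := OracleCode.exists_eval_of_primrec (f := fun n => n) (by fun_prop)
  obtain ⟨e, he⟩ := OracleCode.exists_eval_of_primrec (f := fun m =>
      if m.unpair.1 = 0 then m.unpair.2.unpair.1.unpair.1 else m.unpair.2.unpair.2)
    (Primrec.ite (Primrec.eq.comp (by fun_prop) (by fun_prop)) (by fun_prop) (by fun_prop))
  refine ⟨.comp e (.pair c (.pair i (.comp s z))), fun p hp => ?_⟩
  obtain ⟨v₀, hv₀, hSv₀⟩ := hs p 0 hp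
  refine ⟨_, fun n => OracleCode.eval_comp (OracleCode.eval_pair (hc p n)
    (OracleCode.eval_pair (hi p n) (OracleCode.eval_comp (hz p n) hv₀))) (he p _), fun v => ?_⟩
  simp only [Nat.unpair_pair, mem_range]
  constructor
  · intro hv
    obtain ⟨w, hw⟩ := (hT p v).1 hv
    exact ⟨Nat.pair v w, (if_pos hw).trans (by rw [Nat.unpair_pair])⟩
  · rintro ⟨n, rfl⟩
    split_ifs with h
    · exact (hT p _).2 ⟨n.unpair.2, by simpa using h⟩
    · exact hSv₀

end Semi

/-! ### Monotonicity and contraction of a geometric Lorenz return map -/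

theorem plane_eta (z : Plane) : !₂[z 0, z 1] = z := by
  ext i
  fin_cases i <;> rfl

theorem continuous_planeMk : Continuous fun x : ℝ × ℝ => (!₂[x.1, x.2] : Plane) := by
  fun_prop

theorem isCompact_planeRect (a b c d : ℝ) :
    IsCompact {z : Plane | z 0 ∈ Icc a b ∧ z 1 ∈ Icc c d} := by
  have : {z : Plane | z 0 ∈ Icc a b ∧ z 1 ∈ Icc c d} =
      (fun x : ℝ × ℝ => (!₂[x.1, x.2] : Plane)) '' (Icc a b ×ˢ Icc c d) := by
    ext z
    constructor
    · exact fun h => ⟨(z 0, z 1), ⟨h.1, h.2⟩, plane_eta z⟩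
    · rintro ⟨x, hx, rfl⟩
      exact ⟨hx.1, hx.2⟩
  rw [this]
  exact (isCompact_Icc.prod isCompact_Icc).image continuous_planeMk

namespace LorenzReturnMap

variable (L : LorenzReturnMap)

/-- The number `r⁺`. -/
def r : ℝ := L.ρminus 0

/-- The second coordinate `t⁻` of `ρ⁺`. -/
def t : ℝ := L.ρplus 1

theorem zero_lt_r : 0 < L.r := L.r_pos

theorem mem_V {z : Plane} : z ∈ L.V ↔ (-L.r ≤ z 0 ∧ z 0 ≤ L.r) ∧ (-27 ≤ z 1 ∧ z 1 ≤ 27) := by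
  simp only [V, lorenzV, L.r_symm, mem_ofPred_eq, mem_Icc, r]

theorem neg_mem_V {z : Plane} (hz : z ∈ L.V) : -z ∈ L.V := by
  rw [mem_V] at hz ⊢
  simp only [PiLp.neg_apply]
  refine ⟨⟨?_, ?_⟩, ?_, ?_⟩ <;> linarith [hz.1.1, hz.1.2, hz.2.1, hz.2.2]

theorem mem_VD {z : Plane} : z ∈ L.V \ L.D ↔ z ∈ L.V ∧ z 0 ≠ 0 := by
  simp only [D, lorenzD, V, Set.mem_sdiff, mem_ofPred_eq]
  tauto

theorem F_mem_V {z : Plane} (hz : z ∈ L.V) (h0 : z 0 ≠ 0) : L.F z ∈ L.V :=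
  L.mapsTo ((L.mem_VD).2 ⟨hz, h0⟩)

theorem F_neg {z : Plane} (hz : z ∈ L.V) (h0 : z 0 ≠ 0) : L.F (-z) = -L.F z :=
  L.odd z ((L.mem_VD).2 ⟨hz, h0⟩)

theorem F_skew : ∃ f f' g gx gy c, IsLorenzSkewProduct L.F (-L.r) L.r f f' g gx gy c := by
  obtain ⟨f, f', g, gx, gy, c, h⟩ := L.skew
  rw [L.r_symm] at h
  exact ⟨f, f', g, gx, gy, c, h⟩

theorem F_zero_congr {z w : Plane} (hz : z ∈ L.V) (hw : w ∈ L.V) (h0 : z 0 ≠ 0)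
    (h : z 0 = w 0) : L.F z 0 = L.F w 0 := by
  obtain ⟨f, f', g, gx, gy, c, H⟩ := L.F_skew
  rw [mem_V] at hz hw
  rw [← plane_eta z, ← plane_eta w, H.eq _ hz.1 h0 _ hz.2, H.eq _ hw.1 (h ▸ h0) _ hw.2, h]
  simp

theorem F_zero_lt {z w : Plane} (hz : z ∈ L.V) (hw : w ∈ L.V) (h0 : 0 < z 0)
    (h : z 0 < w 0) : L.F z 0 < L.F w 0 := by
  obtain ⟨f, f', g, gx, gy, c, H⟩ := L.F_skew
  rw [mem_V] at hz hw
  have hr := L.zero_lt_r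
  have hsub : Ioc 0 L.r ⊆ Icc (-L.r) L.r := fun x hx => ⟨by linarith [hx.1], hx.2⟩
  have hd : ∀ x ∈ Ioc 0 L.r, HasDerivWithinAt f (f' x) (Ioc 0 L.r) x := fun x hx =>
    (H.hasDeriv x (hsub hx) hx.1.ne').mono hsub
  have hmono : StrictMonoOn f (Ioc 0 L.r) := by
    refine strictMonoOn_of_hasDerivWithinAt_pos (f' := f') (convex_Ioc _ _)
      (fun x hx => (hd x hx).continuousWithinAt)
      (fun x hx => (hd x (interior_subset hx)).mono interior_subset) fun x hx => ?_
    have hx := interior_subset hx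
    exact (Real.sqrt_nonneg 2).trans_lt (H.sqrt_two_lt x (hsub hx) hx.1.ne')
  rw [← plane_eta z, ← plane_eta w, H.eq _ hz.1 h0.ne' _ hz.2,
    H.eq _ hw.1 (h0.trans h).ne' _ hw.2]
  exact hmono ⟨h0, hz.1.2⟩ ⟨h0.trans h, hw.1.2⟩ h

theorem F_zero_le {z w : Plane} (hz : z ∈ L.V) (hw : w ∈ L.V) (h0 : 0 < z 0)
    (h : z 0 ≤ w 0) : L.F z 0 ≤ L.F w 0 := by
  rcases h.lt_or_eq with h | h
  exacts [(L.F_zero_lt hz hw h0 h).le, (L.F_zero_congr hz hw h0.ne' h).le]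

theorem F_one_le {z w : Plane} (hz : z ∈ L.V) (hw : w ∈ L.V) (h0 : 0 < z 0)
    (h : z 0 ≤ w 0) (h1 : z 1 ≤ w 1) : L.F z 1 ≤ L.F w 1 := by
  obtain ⟨f, f', g, gx, gy, c, H⟩ := L.F_skew
  rw [mem_V] at hz hw
  have hr := L.zero_lt_r
  have hsub : Ioc 0 L.r ⊆ Icc (-L.r) L.r := fun x hx => ⟨by linarith [hx.1], hx.2⟩
  have hd : ∀ y ∈ Icc (-27 : ℝ) 27, ∀ x ∈ Ioc 0 L.r,
      HasDerivWithinAt (fun s => g s y) (gx x y) (Ioc 0 L.r) x := fun y hy x hx =>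
    (H.hasDeriv_x x (hsub hx) hx.1.ne' y hy).mono hsub
  have hmono : ∀ y ∈ Icc (-27 : ℝ) 27, StrictMonoOn (fun s => g s y) (Ioc 0 L.r) := by
    intro y hy
    refine strictMonoOn_of_hasDerivWithinAt_pos (f' := fun x => gx x y) (convex_Ioc _ _)
      (fun x hx => (hd y hy x hx).continuousWithinAt)
      (fun x hx => (hd y hy x (interior_subset hx)).mono interior_subset) fun x hx => ?_
    have hx := interior_subset hx
    exact (H.gx_bound x (hsub hx) hx.1.ne' y hy).1
  have hmono' : StrictMonoOn (g (w 0)) (Icc (-27) 27) := by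
    have hw0 := (h0.trans_le h).ne'
    refine strictMonoOn_of_hasDerivWithinAt_pos (f' := gy (w 0)) (convex_Icc _ _)
      (fun y hy => (H.hasDeriv_y _ hw.1 hw0 y hy).continuousWithinAt)
      (fun y hy => (H.hasDeriv_y _ hw.1 hw0 y (interior_subset hy)).mono interior_subset)
      fun y hy => (H.gy_bound _ hw.1 hw0 y (interior_subset hy)).1
  rw [← plane_eta z, ← plane_eta w, H.eq _ hz.1 h0.ne' _ hz.2,
    H.eq _ hw.1 (h0.trans_le h).ne' _ hw.2]
  exact ((hmono _ hz.2).monotoneOn ⟨h0, hz.1.2⟩ ⟨h0.trans_le h, hw.1.2⟩ h).trans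
    (hmono'.monotoneOn hz.2 hw.2 h1)

theorem abs_F_one_sub_le {z w : Plane} (hz : z ∈ L.V) (hw : w ∈ L.V) (h0 : z 0 ≠ 0)
    (h : z 0 = w 0) : |L.F z 1 - L.F w 1| ≤ 1 / √2 * |z 1 - w 1| := by
  obtain ⟨f, f', g, gx, gy, c, H⟩ := L.F_skew
  rw [mem_V] at hz hw
  have := (convex_Icc (-27 : ℝ) 27).norm_image_sub_le_of_norm_hasDerivWithin_le
    (f := g (z 0)) (f' := gy (z 0)) (C := c) (fun y hy => H.hasDeriv_y _ hz.1 h0 y hy)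
    (fun y hy => by
      have := H.gy_bound _ hz.1 h0 y hy
      rw [Real.norm_eq_abs, abs_of_pos this.1]
      exact this.2) hw.2 hz.2
  rw [← plane_eta z, ← plane_eta w, H.eq _ hz.1 h0 _ hz.2, H.eq _ hw.1 (h ▸ h0) _ hw.2, ← h]
  exact this.trans (mul_le_mul_of_nonneg_right H.c_lt.le (norm_nonneg _))

theorem mk_mem_V {x y : ℝ} (hx : 0 < x) (hxr : x ≤ L.r) (hy : -27 ≤ y) (hy' : y ≤ 27) :
    (!₂[x, y] : Plane) ∈ L.V := by
  rw [mem_V]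
  exact ⟨⟨by simpa using by linarith [L.zero_lt_r], by simpa using hxr⟩, by simpa using hy,
    by simpa using hy'⟩

theorem tendsto_F_zero : Tendsto (fun x : ℝ => L.F !₂[x, 27] 0) (𝓝[>] 0) (𝓝 (-L.r)) := by
  have h := L.tendsto_right 27 (by norm_num)
  have := ((EuclideanSpace.proj (𝕜 := ℝ) (0 : Fin 2)).continuous.tendsto L.ρplus).comp h
  rwa [show (EuclideanSpace.proj (𝕜 := ℝ) (0 : Fin 2)) L.ρplus = -L.r from L.r_symm] at this

theorem tendsto_F_one {y : ℝ} (hy : y ∈ Icc (-27) 27) :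
    Tendsto (fun x : ℝ => L.F !₂[x, y] 1) (𝓝[>] 0) (𝓝 L.t) := by
  have h := L.tendsto_right y hy
  exact ((EuclideanSpace.proj (𝕜 := ℝ) (1 : Fin 2)).continuous.tendsto L.ρplus).comp h

theorem ρplus_eq : !₂[-L.r, L.t] = L.ρplus := by
  rw [← plane_eta L.ρplus, L.r_symm]
  rfl

theorem neg_r_lt_F {z : Plane} (hz : z ∈ L.V) (h0 : 0 < z 0) : -L.r < L.F z 0 := by
  have hz' := (L.mem_V).1 hz
  have hmid := L.mk_mem_V (y := 27) (half_pos h0) (by linarith [hz'.1.2]) (by norm_num) le_rfl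
  refine lt_of_le_of_lt (le_of_tendsto L.tendsto_F_zero ?_)
    (L.F_zero_lt hmid hz (by simpa using h0) (by simpa using h0))
  filter_upwards [Ioc_mem_nhdsGT (half_pos h0)] with x hx
  exact L.F_zero_le (L.mk_mem_V hx.1 (by linarith [hx.2, hz'.1.2]) (by norm_num) le_rfl) hmid
    (by simpa using hx.1) (by simpa using hx.2)

theorem t_le_F {z : Plane} (hz : z ∈ L.V) (h0 : 0 < z 0) : L.t ≤ L.F z 1 := by
  have hz' := (L.mem_V).1 hz
  refine le_of_tendsto (L.tendsto_F_one hz'.2) ?_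
  filter_upwards [Ioc_mem_nhdsGT h0] with x hx
  exact L.F_one_le (L.mk_mem_V hx.1 (hx.2.trans hz'.1.2) hz'.2.1 hz'.2.2) hz
    (by simpa using hx.1) (by simpa using hx.2) (by simp)

theorem F_corner_pos {y : ℝ} (hy : y ∈ Icc (-27) 27) : 0 < L.F !₂[L.r, y] 0 := by
  obtain ⟨f, f', g, gx, gy, c, H⟩ := L.F_skew
  have hr := L.zero_lt_r
  rw [H.eq _ ⟨by linarith, le_rfl⟩ hr.ne' _ hy]
  exact H.f_right.1

theorem continuousWithinAt_F {z : Plane} (hz : z ∈ L.V) (h0 : z 0 ≠ 0) :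
    ContinuousWithinAt L.F (L.V \ L.D) z := L.continuousOn z ((L.mem_VD).2 ⟨hz, h0⟩)

/-! ### The attractor and the images of the rectangle -/

/-- The images `Fⁿ` of the points of `V ∖ D` with `|x| < r⁺`. Every fibre `x = const` with
`0 < |x| < r⁺` meets all of them. -/
def innerIter (L : LorenzReturnMap) : ℕ → Set Plane
  | 0 => {z ∈ L.V | z 0 ≠ 0 ∧ |z 0| < L.r}
  | n + 1 => L.F '' (L.innerIter n \ L.D)

theorem iter_subset_V (n : ℕ) : L.iter n ⊆ L.V := by
  induction n with
  | zero => exact sdiff_subset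
  | succ n ih =>
    rintro _ ⟨z, hz, rfl⟩
    exact L.mapsTo ⟨ih hz.1, hz.2⟩

theorem innerIter_subset_iter (n : ℕ) : L.innerIter n ⊆ L.iter n := by
  induction n with
  | zero => exact fun z hz => (L.mem_VD).2 ⟨hz.1, hz.2.1⟩
  | succ n ih => exact image_mono (sdiff_subset_sdiff_left ih)

theorem isCompact_V : IsCompact L.V := isCompact_planeRect _ _ _ _

theorem closure_iter_subset_V (n : ℕ) : closure (L.iter n) ⊆ L.V :=
  closure_minimal (L.iter_subset_V n) L.isCompact_V.isClosed

theorem V_subset_closure : L.V ⊆ closure (L.innerIter 0) := by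
  intro z hz
  have hz' := (L.mem_V).1 hz
  have hr := L.zero_lt_r
  have hc : Continuous fun x : ℝ => (!₂[x, z 1] : Plane) :=
    continuous_planeMk.comp (by fun_prop : Continuous fun x : ℝ => (x, z 1))
  rw [← plane_eta z]
  rcases le_total 0 (z 0) with h | h
  · refine map_mem_closure hc (s := Ioo 0 L.r) (by rw [closure_Ioo hr.ne]; exact ⟨h, hz'.1.2⟩) ?_
    intro x hx
    refine ⟨(L.mem_V).2 ?_, by simpa using hx.1.ne', ?_⟩
    · exact ⟨⟨by simpa using by linarith [hx.1], by simpa using hx.2.le⟩, hz'.2⟩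
    · simpa [abs_lt] using ⟨by linarith [hx.1], hx.2⟩
  · refine map_mem_closure hc (s := Ioo (-L.r) 0)
      (by rw [closure_Ioo (neg_lt_zero.2 hr).ne]; exact ⟨hz'.1.1, h⟩) ?_
    intro x hx
    refine ⟨(L.mem_V).2 ?_, by simpa using hx.2.ne, ?_⟩
    · exact ⟨⟨by simpa using hx.1.le, by simpa using by linarith [hx.2]⟩, hz'.2⟩
    · simpa [abs_lt] using ⟨hx.1, by linarith [hx.2]⟩

theorem F_mem_closure {S : Set Plane} (hS : S ⊆ L.V) {z : Plane} (hz : z ∈ closure S)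
    (h0 : z 0 ≠ 0) : L.F z ∈ closure (L.F '' (S \ L.D)) := by
  have hzV : z ∈ L.V := closure_minimal hS L.isCompact_V.isClosed hz
  have ho : IsOpen {z : Plane | z 0 ≠ 0} := isOpen_ne_fun (by fun_prop) (by fun_prop)
  refine ((L.continuousWithinAt_F hzV h0).mono
    (sdiff_subset_sdiff_left hS)).mem_closure_image (closure_mono ?_ (ho.inter_closure ⟨h0, hz⟩))
  exact fun w hw => ⟨hw.2, fun h => hw.1 h.2⟩

theorem F_mem_closure_iter {n : ℕ} {z : Plane} (hz : z ∈ closure (L.iter n)) (h0 : z 0 ≠ 0) :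
    L.F z ∈ closure (L.iter (n + 1)) := L.F_mem_closure (L.iter_subset_V n) hz h0

theorem iter_subset_closure_innerIter (n : ℕ) : L.iter n ⊆ closure (L.innerIter n) := by
  induction n with
  | zero => exact sdiff_subset.trans L.V_subset_closure
  | succ n ih =>
    rintro _ ⟨z, hz, rfl⟩
    exact L.F_mem_closure ((L.innerIter_subset_iter n).trans (L.iter_subset_V n)) (ih hz.1)
      ((L.mem_VD).1 ⟨L.iter_subset_V n hz.1, hz.2⟩).2

theorem closure_iter_zero : closure (L.iter 0) = L.V :=
  (L.closure_iter_subset_V 0).antisymm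
    (L.V_subset_closure.trans (closure_mono (L.innerIter_subset_iter 0)))

theorem closure_iter_succ_subset (n : ℕ) : closure (L.iter (n + 1)) ⊆ closure (L.iter n) := by
  refine closure_minimal ?_ isClosed_closure
  induction n with
  | zero => exact (L.iter_subset_V 1).trans L.closure_iter_zero.ge
  | succ n ih =>
    rintro _ ⟨z, hz, rfl⟩
    exact L.F_mem_closure_iter (ih hz.1) ((L.mem_VD).1 ⟨L.iter_subset_V _ hz.1, hz.2⟩).2

theorem exists_pos_F_zero_eq {x : ℝ} (hx : -L.r < x) (hx' : x ≤ 0) :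
    ∃ s, 0 < s ∧ s < L.r ∧ L.F !₂[s, 27] 0 = x := by
  have hr := L.zero_lt_r
  obtain ⟨a, ha, ha0⟩ := ((L.tendsto_F_zero.eventually (gt_mem_nhds hx)).and
    (Ioo_mem_nhdsGT hr)).exists
  have hcont : ContinuousOn (fun s : ℝ => L.F !₂[s, 27] 0) (Icc a L.r) := by
    have h1 : ContinuousOn (fun s : ℝ => L.F !₂[s, 27]) (Icc a L.r) := by
      refine L.continuousOn.comp (Continuous.continuousOn ?_) ?_
      · exact continuous_planeMk.comp (by fun_prop : Continuous fun x : ℝ => (x, (27 : ℝ)))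
      · intro s hs
        have : 0 < s := ha0.1.trans_le hs.1
        exact (L.mem_VD).2 ⟨L.mk_mem_V this hs.2 (by norm_num) le_rfl, by simpa using this.ne'⟩
    exact (EuclideanSpace.proj (𝕜 := ℝ) (0 : Fin 2)).continuous.comp_continuousOn h1
  obtain ⟨s, hs, hsx⟩ := intermediate_value_Icc ha0.2.le hcont
    ⟨ha.le, hx'.trans (L.F_corner_pos (by norm_num)).le⟩
  refine ⟨s, ha0.1.trans_le hs.1, lt_of_le_of_ne hs.2 ?_, hsx⟩
  rintro rfl
  have := L.F_corner_pos (y := 27) (by norm_num)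
  simp only at hsx
  linarith

/-- All images meet all fibres, since the first coordinate of `F` maps `(-r⁺, r⁺) ∖ {0}` onto
`(-r⁺, r⁺)`. -/
theorem exists_mem_innerIter (n : ℕ) {x : ℝ} (hx0 : x ≠ 0) (hx : |x| < L.r) :
    ∃ z ∈ L.innerIter n, z 0 = x := by
  induction n generalizing x with
  | zero =>
    have := abs_lt.1 hx
    exact ⟨!₂[x, 0], ⟨(L.mem_V).2 ⟨⟨by simpa using this.1.le, by simpa using this.2.le⟩, by simp⟩,
      by simpa using hx0, by simpa using hx⟩, by simp⟩
  | succ n ih =>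
    have hxx := abs_lt.1 hx
    have main : ∃ s, s ≠ 0 ∧ |s| < L.r ∧ ∀ z ∈ L.V, z 0 = s → L.F z 0 = x := by
      rcases le_total x 0 with h | h
      · obtain ⟨s, h1, h2, h3⟩ := L.exists_pos_F_zero_eq hxx.1 h
        refine ⟨s, h1.ne', abs_lt.2 ⟨by linarith, h2⟩, fun z hz hzs => ?_⟩
        rw [← h3]
        exact L.F_zero_congr hz (L.mk_mem_V h1 h2.le (by norm_num) le_rfl) (hzs ▸ h1.ne')
          (by simpa using hzs)
      · obtain ⟨s, h1, h2, h3⟩ := L.exists_pos_F_zero_eq (x := -x) (by linarith) (by linarith)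
        refine ⟨-s, neg_ne_zero.2 h1.ne', abs_lt.2 ⟨by linarith, by linarith⟩, fun z hz hzs => ?_⟩
        have h4 := L.F_zero_congr (L.neg_mem_V hz) (L.mk_mem_V h1 h2.le (by norm_num) le_rfl)
          (by rw [PiLp.neg_apply, hzs, neg_neg]; exact h1.ne') (by simp [hzs])
        rw [h3, L.F_neg hz (by rw [hzs]; exact neg_ne_zero.2 h1.ne'), PiLp.neg_apply] at h4
        linarith
    obtain ⟨s, hs0, hsr, hs⟩ := main
    obtain ⟨z, hz, hzs⟩ := ih hs0 hsr
    have hzV := L.iter_subset_V n (L.innerIter_subset_iter n hz)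
    exact ⟨L.F z, ⟨z, ⟨hz, fun h => hs0 (hzs ▸ h.2)⟩, rfl⟩, hs z hzV hzs⟩

theorem ρplus_mem_closure_iter (n : ℕ) : L.ρplus ∈ closure (L.iter (n + 1)) := by
  have hr := L.zero_lt_r
  have hex : ∀ x : ℝ, ∃ z : Plane, x ≠ 0 → |x| < L.r → z ∈ L.innerIter n ∧ z 0 = x := by
    intro x
    by_cases h : x ≠ 0 ∧ |x| < L.r
    · obtain ⟨z, hz⟩ := L.exists_mem_innerIter n h.1 h.2
      exact ⟨z, fun _ _ => hz⟩
    · exact ⟨0, fun h1 h2 => absurd ⟨h1, h2⟩ h⟩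
  choose z hz using hex
  have hz' : ∀ᶠ x in 𝓝[>] (0 : ℝ), 0 < x ∧ z x ∈ L.innerIter n ∧ z x 0 = x ∧ x ≤ L.r := by
    filter_upwards [Ioo_mem_nhdsGT hr] with x hx
    have := hz x hx.1.ne' (abs_lt.2 ⟨by linarith [hx.1], hx.2⟩)
    exact ⟨hx.1, this.1, this.2, hx.2.le⟩
  have hVz : ∀ x, z x ∈ L.innerIter n → z x ∈ L.V := fun x h =>
    L.iter_subset_V n (L.innerIter_subset_iter n h)
  have h0 : Tendsto (fun x => L.F (z x) 0) (𝓝[>] 0) (𝓝 (-L.r)) := by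
    refine L.tendsto_F_zero.congr' ?_
    filter_upwards [hz'] with x ⟨h1, h2, h3, h4⟩
    exact L.F_zero_congr (L.mk_mem_V h1 h4 (by norm_num) le_rfl) (hVz x h2) (by simpa using h1.ne')
      (by simp [h3])
  have h1 : Tendsto (fun x => L.F (z x) 1) (𝓝[>] 0) (𝓝 L.t) := by
    refine tendsto_of_tendsto_of_tendsto_of_le_of_le' tendsto_const_nhds
      (L.tendsto_F_one (y := 27) (by norm_num)) ?_ ?_
    · filter_upwards [hz'] with x ⟨h1, h2, h3, h4⟩
      exact L.t_le_F (hVz x h2) (by rw [h3]; exact h1)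
    · filter_upwards [hz'] with x ⟨h1, h2, h3, h4⟩
      exact L.F_one_le (hVz x h2) (L.mk_mem_V h1 h4 (by norm_num) le_rfl) (by rw [h3]; exact h1)
        (by simp [h3]) (by simpa using ((L.mem_V).1 (hVz x h2)).2.2)
  have h2 := (continuous_planeMk.tendsto (-L.r, L.t)).comp (h0.prodMk_nhds h1)
  rw [show (!₂[(-L.r, L.t).1, (-L.r, L.t).2] : Plane) = L.ρplus from L.ρplus_eq] at h2
  refine mem_closure_of_tendsto h2 ?_
  filter_upwards [hz'] with x ⟨h1, h2, h3, h4⟩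
  refine ⟨z x, ⟨L.innerIter_subset_iter n h2, fun h => ?_⟩, (plane_eta _).symm⟩
  exact h1.ne' (h3 ▸ h.2)

theorem neg_mem_iter {n : ℕ} {z : Plane} (hz : z ∈ L.iter n) : -z ∈ L.iter n := by
  induction n generalizing z with
  | zero =>
    rw [iter, mem_VD] at hz ⊢
    exact ⟨L.neg_mem_V hz.1, by simpa using hz.2⟩
  | succ n ih =>
    obtain ⟨w, hw, rfl⟩ := hz
    have hw' := (L.mem_VD).1 ⟨L.iter_subset_V n hw.1, hw.2⟩
    exact ⟨-w, ⟨ih hw.1, fun h => hw'.2 (by simpa using h.2)⟩, L.F_neg hw'.1 hw'.2⟩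

theorem neg_mem_closure_iter {n : ℕ} {z : Plane} (hz : z ∈ closure (L.iter n)) :
    -z ∈ closure (L.iter n) :=
  map_mem_closure continuous_neg hz fun _ => L.neg_mem_iter

/-- Fibrewise, the points of `Fⁿ(V ∖ D)` and of `Fⁿ⁺ᵐ(V ∖ D)` differ by at most `54 · 2^(-n/2)`:
both arise from points on one fibre of `V` by `n` fibrewise contractions. -/
theorem exists_mem_iter_add {n : ℕ} (m : ℕ) {z : Plane} (hz : z ∈ L.innerIter n) :
    ∃ w ∈ L.iter (m + n), w 0 = z 0 ∧ |w 1 - z 1| ≤ 54 * (1 / √2) ^ n := by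
  induction n generalizing z with
  | zero =>
    obtain ⟨w, hw, hwz⟩ := L.exists_mem_innerIter m hz.2.1 hz.2.2
    have hw' := L.innerIter_subset_iter m hw
    refine ⟨w, hw', hwz, ?_⟩
    have h1 := ((L.mem_V).1 (L.iter_subset_V m hw')).2
    have h2 := ((L.mem_V).1 hz.1).2
    rw [pow_zero, mul_one, abs_le]
    constructor <;> linarith [h1.1, h1.2, h2.1, h2.2]
  | succ n ih =>
    obtain ⟨u, hu, rfl⟩ := hz
    obtain ⟨w, hw, hwu, hle⟩ := ih hu.1
    have huV := L.iter_subset_V n (L.innerIter_subset_iter n hu.1)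
    have hwV := L.iter_subset_V _ hw
    have hu0 : u 0 ≠ 0 := ((L.mem_VD).1 ⟨huV, hu.2⟩).2
    have hw0 : w 0 ≠ 0 := hwu ▸ hu0
    refine ⟨L.F w, ⟨w, ⟨hw, fun h => hw0 h.2⟩, rfl⟩, L.F_zero_congr hwV huV hw0 hwu, ?_⟩
    refine (L.abs_F_one_sub_le hwV huV hw0 hwu).trans ?_
    rw [pow_succ]
    calc 1 / √2 * |w 1 - u 1| ≤ 1 / √2 * (54 * (1 / √2) ^ n) :=
          mul_le_mul_of_nonneg_left hle (by positivity)
      _ = _ := by ring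

theorem exists_mem_attractor_near {m : ℕ} {z : Plane} (hz : z ∈ L.innerIter (2 * m)) :
    ∃ a ∈ L.attractor, a 0 = z 0 ∧ |a 1 - z 1| ≤ 54 * (1 / 2) ^ m := by
  have hpow : (1 / √2 : ℝ) ^ (2 * m) = (1 / 2) ^ m := by
    rw [pow_mul, div_pow, Real.sq_sqrt (by norm_num), one_pow]
  let B : Set Plane := {a | a 0 = z 0 ∧ |a 1 - z 1| ≤ 54 * (1 / 2) ^ m}
  have hB : IsClosed B := (isClosed_eq (f := fun a : Plane => a 0) (by fun_prop)
    (by fun_prop)).inter (isClosed_le (f := fun a : Plane => |a 1 - z 1|) (by fun_prop)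
      (by fun_prop))
  have hne : ∀ k, (closure (L.iter k) ∩ B).Nonempty := by
    intro k
    obtain ⟨w, hw, hwB⟩ := L.exists_mem_iter_add k hz
    rw [hpow] at hwB
    exact ⟨w, antitone_nat_of_succ_le (f := fun k => closure (L.iter k)) L.closure_iter_succ_subset (Nat.le_add_right k (2 * m))
      (subset_closure hw), hwB⟩
  obtain ⟨a, ha⟩ := IsCompact.nonempty_iInter_of_sequence_nonempty_isCompact_isClosed
    (fun k => closure (L.iter k) ∩ B)
    (fun k => inter_subset_inter_left _ (L.closure_iter_succ_subset k)) hne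
    (L.isCompact_V.of_isClosed_subset (isClosed_closure.inter hB)
      (inter_subset_left.trans (L.closure_iter_subset_V 0)))
    (fun k => isClosed_closure.inter hB)
  rw [mem_iInter] at ha
  exact ⟨a, mem_iInter.2 fun k => (ha k).1, (ha 0).2⟩

end LorenzReturnMap

/-! ### Evaluation of coded polynomials -/

/-- The value at `(x, y)` of the polynomial with code `n`. -/
def codedPoly {K : Type*} [Field K] (n : ℕ) (x y : K) : K :=
  ((Denumerable.ofNat (List (ℕ × ℕ × ℕ)) n).map fun t =>
    (ratOfCode t.1 : K) * x ^ t.2.1 * y ^ t.2.2).sum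

theorem aeval_polyOfCode (n : ℕ) (x y : ℝ) :
    MvPolynomial.aeval ![x, y] (polyOfCode n) = codedPoly n x y := by
  rw [polyOfCode, codedPoly, map_list_sum, List.map_map]
  congr 1
  refine List.map_congr_left fun t _ => ?_
  simp

theorem codedPoly_cast (n : ℕ) (x y : ℚ) :
    ((codedPoly n x y : ℚ) : ℝ) = codedPoly n (x : ℝ) (y : ℝ) := by
  rw [codedPoly, codedPoly, Rat.cast_list_sum, List.map_map]
  congr 1
  refine List.map_congr_left fun t _ => ?_
  simp

/-- A Lipschitz constant in `x` of the polynomial with code `n` on the square `[-M, M]²`. -/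
def codedLip (n M : ℕ) : ℚ :=
  ((Denumerable.ofNat (List (ℕ × ℕ × ℕ)) n).map fun t =>
    (((t.1.unpair.1.unpair.1 + t.1.unpair.1.unpair.2) * t.2.1 * M ^ (t.2.1 + t.2.2) : ℕ) : ℚ)).sum

theorem abs_ratOfCode_le (n : ℕ) :
    |(ratOfCode n : ℝ)| ≤ ((n.unpair.1.unpair.1 + n.unpair.1.unpair.2 : ℕ) : ℝ) := by
  rw [ratOfCode]
  push_cast
  rw [abs_div, abs_of_pos (by positivity : (0 : ℝ) < n.unpair.2 + 1)]
  refine (div_le_self (abs_nonneg _) (by simp)).trans ?_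
  refine (abs_sub _ _).trans ?_
  simp

theorem abs_codedPoly_sub_le (n : ℕ) {M : ℕ} (hM : 1 ≤ M) {x x' y : ℝ} (hx : |x| ≤ M)
    (hx' : |x'| ≤ M) (hy : |y| ≤ M) :
    |codedPoly n x y - codedPoly n x' y| ≤ codedLip n M * |x - x'| := by
  rw [codedPoly, codedPoly, codedLip]
  have hM' : (1 : ℝ) ≤ M := by exact_mod_cast hM
  induction Denumerable.ofNat (List (ℕ × ℕ × ℕ)) n with
  | nil => simp
  | cons t l ih =>
    obtain ⟨a, i, j⟩ := t
    simp only [List.map_cons, List.sum_cons] at ih ⊢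
    have h1 : |x ^ i - x' ^ i| ≤ |x - x'| * i * M ^ i := by
      refine (abs_pow_sub_pow_le x x' i).trans ?_
      gcongr
      refine (pow_le_pow_left₀ (by positivity) (max_le hx hx') _).trans ?_
      exact pow_le_pow_right₀ hM' (Nat.sub_le _ _)
    have h2 : |y ^ j| ≤ M ^ j := by
      rw [abs_pow]
      gcongr
    have h3 : |(ratOfCode a : ℝ) * x ^ i * y ^ j - ratOfCode a * x' ^ i * y ^ j| ≤
        (((a.unpair.1.unpair.1 + a.unpair.1.unpair.2 : ℕ) : ℝ) * i * M ^ (i + j)) * |x - x'| := by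
      rw [show (ratOfCode a : ℝ) * x ^ i * y ^ j - ratOfCode a * x' ^ i * y ^ j =
        ratOfCode a * (x ^ i - x' ^ i) * y ^ j by ring, abs_mul, abs_mul]
      calc _ ≤ ((a.unpair.1.unpair.1 + a.unpair.1.unpair.2 : ℕ) : ℝ) * (|x - x'| * i * M ^ i) *
            M ^ j := by
            gcongr
            exact abs_ratOfCode_le a
        _ = _ := by ring
    push_cast at h3 ih ⊢
    rw [add_mul]
    refine le_trans ?_ (add_le_add h3 ih)
    refine le_trans (le_of_eq ?_) (abs_add_le _ _)
    congr 1
    ring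

@[fun_prop] theorem Primrec.codedPoly {α : Type*} [Primcodable α] {f : α → ℕ} {φ ψ : α → ℚ}
    (hf : Primrec f) (hφ : PrimrecRat φ) (hψ : PrimrecRat ψ) :
    PrimrecRat fun a => codedPoly (f a) (φ a) (ψ a) := by
  have h : PrimrecRat fun x : α × ℕ × ℕ × ℕ =>
      ratOfCode x.2.1 * φ x.1 ^ x.2.2.1 * ψ x.1 ^ x.2.2.2 :=
    ((Primrec.primrecRat (by fun_prop)).mul ((hφ.comp Primrec.fst).pow (by fun_prop))).mul
      ((hψ.comp Primrec.fst).pow (by fun_prop))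
  refine (PrimrecRat.list_sum (l := fun a => Denumerable.ofNat (List (ℕ × ℕ × ℕ)) (f a))
    ((Primrec.ofNat _).comp hf) h)

@[fun_prop] theorem Primrec.codedLip {α : Type*} [Primcodable α] {f g : α → ℕ}
    (hf : Primrec f) (hg : Primrec g) : PrimrecRat fun a => codedLip (f a) (g a) := by
  have h : PrimrecRat fun x : α × ℕ × ℕ × ℕ =>
      (((x.2.1.unpair.1.unpair.1 + x.2.1.unpair.1.unpair.2) * x.2.2.1 *
        g x.1 ^ (x.2.2.1 + x.2.2.2) : ℕ) : ℚ) :=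
    Primrec.natCast_rat (by fun_prop)
  refine (PrimrecRat.list_sum (l := fun a => Denumerable.ofNat (List (ℕ × ℕ × ℕ)) (f a))
    ((Primrec.ofNat _).comp hf) h)

/-! ### Semidecidable inequalities -/

theorem exists_ratOfCode_between {a b : ℝ} (h : a < b) :
    ∃ n, a < ratOfCode n ∧ (ratOfCode n : ℝ) < b := by
  obtain ⟨q, h1, h2⟩ := exists_rat_btwn h
  obtain ⟨n, rfl⟩ := ratOfCode_surjective q
  exact ⟨n, h1, h2⟩

theorem exists_half_pow_lt {ε : ℝ} (h : 0 < ε) : ∃ k : ℕ, (1 / 2 : ℝ) ^ k < ε :=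
  exists_pow_lt_of_lt_one h (by norm_num)

theorem abs_apply_sub_le_dist (x y : Plane) (i : Fin 2) : |x i - y i| ≤ dist x y := by
  rw [dist_eq_norm]
  exact PiLp.norm_apply_le (x - y) i

/-- The `k`-th approximation of `r⁺` that a name `p` of a return map provides. -/
def rApprox (p : ℕ → ℕ) (k : ℕ) : ℚ := ratOfCode (p (Nat.pair 2 k)).unpair.1

/-- The `k`-th approximation of `t⁻` that a name `p` of a return map provides. -/
def tApprox (p : ℕ → ℕ) (k : ℕ) : ℚ := ratOfCode (p (Nat.pair 1 k)).unpair.2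

/-- The code of the polynomial that a name `p` of a return map provides for the `i`-th coordinate
of `F` on the `k`-th member of the exhaustion of the right half of `V`, with error `2⁻ˡ`. -/
def rightPoly (p : ℕ → ℕ) (i k l : ℕ) : ℕ := p (Nat.pair 0 (Nat.pair i (Nat.pair k l)))

/-- The rational with code `q` lies below `r⁺`, as witnessed by a name `p`. -/
def BelowR (p : ℕ → ℕ) (q : ℕ) : Prop := ∃ k : ℕ, ratOfCode q + (1 / 2) ^ k ≤ rApprox p k

/-- The rational with code `q` lies above `r⁺`, as witnessed by a name `p`. -/
def AboveR (p : ℕ → ℕ) (q : ℕ) : Prop := ∃ k : ℕ, rApprox p k + (1 / 2) ^ k ≤ ratOfCode q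

/-- The rational with code `q` lies below `t⁻`, as witnessed by a name `p`. -/
def BelowT (p : ℕ → ℕ) (q : ℕ) : Prop := ∃ k : ℕ, ratOfCode q + (1 / 2) ^ k ≤ tApprox p k

/-- The `i`-th coordinate of `F (x, y)` is less than `v`, as witnessed by a name `p`. -/
def ImageLt (p : ℕ → ℕ) (i x y v : ℕ) : Prop := ∃ k l : ℕ, (1 / 2) ^ k ≤ ratOfCode x ∧
  codedPoly (rightPoly p i k l) (ratOfCode x) (ratOfCode y) + (1 / 2) ^ l ≤ ratOfCode v

/-- The `i`-th coordinate of `F (x, y)` is greater than `v`, as witnessed by a name `p`. -/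
def ImageGt (p : ℕ → ℕ) (i x y v : ℕ) : Prop := ∃ k l : ℕ, (1 / 2) ^ k ≤ ratOfCode x ∧
  ratOfCode v + (1 / 2) ^ l ≤ codedPoly (rightPoly p i k l) (ratOfCode x) (ratOfCode y)

/-- The `i`-th coordinate of `F (r⁺, y)` is less than `v`, as witnessed by a name `p`. Since `r⁺`
need not be rational, the polynomial is evaluated at an approximation of `r⁺`, which may lie outside
the domain of `F`, and the error is controlled by a Lipschitz constant of the polynomial. -/
def EndImageLt (p : ℕ → ℕ) (i y v : ℕ) : Prop := ∃ k l m M : ℕ,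
  (1 / 2) ^ k + (1 / 2) ^ m ≤ rApprox p m ∧ rApprox p m + 1 ≤ M ∧ 27 ≤ M ∧
    codedPoly (rightPoly p i k l) (rApprox p m) (ratOfCode y) +
      codedLip (rightPoly p i k l) M * (1 / 2) ^ m + (1 / 2) ^ l ≤ ratOfCode v

theorem semi_belowR : Semi BelowR := by
  have h : Semi (α := (ℕ × ℕ) × ℕ) fun _ x =>
      ratOfCode x.1.1 + (1 / 2) ^ x.1.2 ≤ ratOfCode x.2.unpair.1 :=
    (PrimrecRat.le (by fun_prop) (by fun_prop)).semi
  exact (h.query (i := fun x => Nat.pair 2 x.2) (by fun_prop)).ex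

theorem semi_aboveR : Semi AboveR := by
  have h : Semi (α := (ℕ × ℕ) × ℕ) fun _ x =>
      ratOfCode x.2.unpair.1 + (1 / 2) ^ x.1.2 ≤ ratOfCode x.1.1 :=
    (PrimrecRat.le (by fun_prop) (by fun_prop)).semi
  exact (h.query (i := fun x => Nat.pair 2 x.2) (by fun_prop)).ex

theorem semi_belowT : Semi BelowT := by
  have h : Semi (α := (ℕ × ℕ) × ℕ) fun _ x =>
      ratOfCode x.1.1 + (1 / 2) ^ x.1.2 ≤ ratOfCode x.2.unpair.2 :=
    (PrimrecRat.le (by fun_prop) (by fun_prop)).semi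
  exact (h.query (i := fun x => Nat.pair 1 x.2) (by fun_prop)).ex

theorem semi_imageLt (i : ℕ) :
    Semi fun p (x : ℕ × ℕ × ℕ) => ImageLt p i x.1 x.2.1 x.2.2 := by
  have h : Semi (α := (((ℕ × ℕ × ℕ) × ℕ) × ℕ) × ℕ) fun _ x =>
      (1 / 2) ^ x.1.1.2 ≤ ratOfCode x.1.1.1.1 ∧
        codedPoly x.2 (ratOfCode x.1.1.1.1) (ratOfCode x.1.1.1.2.1) + (1 / 2) ^ x.1.2 ≤
          ratOfCode x.1.1.1.2.2 :=
    ((PrimrecRat.le (by fun_prop) (by fun_prop)).and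
      (PrimrecRat.le (by fun_prop) (by fun_prop))).semi
  exact (h.query (i := fun x => Nat.pair 0 (Nat.pair i (Nat.pair x.1.2 x.2)))
    (by fun_prop)).ex.ex

theorem semi_imageGt (i : ℕ) :
    Semi fun p (x : ℕ × ℕ × ℕ) => ImageGt p i x.1 x.2.1 x.2.2 := by
  have h : Semi (α := (((ℕ × ℕ × ℕ) × ℕ) × ℕ) × ℕ) fun _ x =>
      (1 / 2) ^ x.1.1.2 ≤ ratOfCode x.1.1.1.1 ∧ ratOfCode x.1.1.1.2.2 + (1 / 2) ^ x.1.2 ≤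
        codedPoly x.2 (ratOfCode x.1.1.1.1) (ratOfCode x.1.1.1.2.1) :=
    ((PrimrecRat.le (by fun_prop) (by fun_prop)).and
      (PrimrecRat.le (by fun_prop) (by fun_prop))).semi
  exact (h.query (i := fun x => Nat.pair 0 (Nat.pair i (Nat.pair x.1.2 x.2)))
    (by fun_prop)).ex.ex

theorem semi_endImageLt (i : ℕ) : Semi fun p (x : ℕ × ℕ) => EndImageLt p i x.1 x.2 := by
  have h : Semi (α := ((((((ℕ × ℕ) × ℕ) × ℕ) × ℕ) × ℕ) × ℕ) × ℕ) fun _ x =>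
      (1 / 2) ^ x.1.1.1.1.1.2 + (1 / 2) ^ x.1.1.1.2 ≤ ratOfCode x.1.2.unpair.1 ∧
      ratOfCode x.1.2.unpair.1 + 1 ≤ (x.1.1.2 : ℚ) ∧ 27 ≤ x.1.1.2 ∧
      codedPoly x.2 (ratOfCode x.1.2.unpair.1) (ratOfCode x.1.1.1.1.1.1.1) +
        codedLip x.2 x.1.1.2 * (1 / 2) ^ x.1.1.1.2 + (1 / 2) ^ x.1.1.1.1.2 ≤
          ratOfCode x.1.1.1.1.1.1.2 :=
    ((PrimrecRat.le (by fun_prop) (by fun_prop)).and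
      ((PrimrecRat.le (by fun_prop) (by fun_prop)).and
      ((Primrec.nat_le.comp (by fun_prop) (by fun_prop)).and
      (PrimrecRat.le (by fun_prop) (by fun_prop))))).semi
  exact ((h.query (i := fun x => Nat.pair 0 (Nat.pair i (Nat.pair x.1.1.1.1.2 x.1.1.1.2)))
    (by fun_prop)).query (i := fun x => Nat.pair 2 x.1.2) (by fun_prop)).ex.ex.ex.ex

namespace LorenzReturnMap

variable {L : LorenzReturnMap} {p : ℕ → ℕ}

theorem IsName.abs_rApprox_sub (h : L.IsName p) (k : ℕ) :
    |(rApprox p k : ℝ) - L.r| < (1 / 2) ^ k := by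
  rw [abs_sub_comm]
  exact (abs_apply_sub_le_dist L.ρminus (ratPointOfCode (slice p 2 k)) 0).trans_lt (h.2.2 k)

theorem IsName.abs_tApprox_sub (h : L.IsName p) (k : ℕ) :
    |(tApprox p k : ℝ) - L.t| < (1 / 2) ^ k := by
  rw [abs_sub_comm]
  exact (abs_apply_sub_le_dist L.ρplus (ratPointOfCode (slice p 1 k)) 1).trans_lt (h.2.1 k)

theorem IsName.abs_rightPoly_sub (h : L.IsName p) (i : Fin 2) (k l : ℕ) {x y : ℝ}
    (hx : (1 / 2) ^ k ≤ x) (hxr : x ≤ L.r) (hy : y ∈ Icc (-27) 27) :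
    |codedPoly (rightPoly p i k l) x y - L.F !₂[x, y] i| < (1 / 2) ^ l := by
  have hr := L.zero_lt_r
  have h0 : 0 < x := lt_of_lt_of_le (by positivity) hx
  have hxs : x ∈ shrink (Ioc 0 (L.ρminus 0)) k := by
    refine ⟨⟨h0, hxr⟩, fun _ => ?_, fun h => ?_⟩
    · rwa [csInf_Ioc (show (0 : ℝ) < L.ρminus 0 from hr), zero_add]
    · rw [csSup_Ioc (show (0 : ℝ) < L.ρminus 0 from hr)] at h
      exact absurd ⟨hr, le_rfl⟩ h
  have hys : y ∈ shrink (Icc (-27) 27) k := by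
    refine ⟨hy, fun h => ?_, fun h => ?_⟩
    · rw [csInf_Icc (by norm_num)] at h
      exact absurd ⟨le_rfl, by norm_num⟩ h
    · rw [csSup_Icc (by norm_num)] at h
      exact absurd ⟨by norm_num, le_rfl⟩ h
  rw [← aeval_polyOfCode]
  obtain ⟨⟨h0, h1, -⟩, -⟩ := h
  fin_cases i
  exacts [h0 k l x hxs y hys, h1 k l x hxs y hys]

/-- A strict inequality between reals is semidecidable from approximations. -/
theorem exists_add_half_pow_le_iff {x : ℝ} {a : ℕ → ℚ} (h : ∀ k, |(a k : ℝ) - x| < (1 / 2) ^ k)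
    (q : ℚ) : (∃ k : ℕ, q + (1 / 2) ^ k ≤ a k) ↔ (q : ℝ) < x := by
  constructor
  · rintro ⟨k, hk⟩
    have hk' := (Rat.cast_le (K := ℝ)).2 hk
    push_cast at hk'
    linarith [(abs_lt.1 (h k)).2]
  · intro hq
    obtain ⟨k, hk⟩ := exists_half_pow_lt (half_pos (sub_pos.2 hq))
    refine ⟨k, ?_⟩
    rw [← Rat.cast_le (K := ℝ)]
    push_cast
    linarith [(abs_lt.1 (h k)).1]

theorem IsName.belowR_iff (h : L.IsName p) (q : ℕ) : BelowR p q ↔ (ratOfCode q : ℝ) < L.r :=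
  exists_add_half_pow_le_iff h.abs_rApprox_sub _

theorem IsName.belowT_iff (h : L.IsName p) (q : ℕ) : BelowT p q ↔ (ratOfCode q : ℝ) < L.t :=
  exists_add_half_pow_le_iff h.abs_tApprox_sub _

theorem IsName.aboveR_iff (h : L.IsName p) (q : ℕ) : AboveR p q ↔ L.r < (ratOfCode q : ℝ) := by
  have h' : ∀ k, |((-rApprox p k : ℚ) : ℝ) - -L.r| < (1 / 2) ^ k := fun k => by
    have := h.abs_rApprox_sub k
    rw [abs_sub_comm] at this
    rw [Rat.cast_neg]
    convert this using 2
    ring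
  have := exists_add_half_pow_le_iff h' (-ratOfCode q)
  rw [Rat.cast_neg, neg_lt_neg_iff] at this
  rw [← this, AboveR]
  refine exists_congr fun k => ?_
  constructor <;> intro h <;> linarith

theorem IsName.imageLt_iff (h : L.IsName p) (i : Fin 2) {x y : ℕ} (v : ℕ)
    (hx : 0 < (ratOfCode x : ℝ)) (hxr : (ratOfCode x : ℝ) ≤ L.r)
    (hy : (ratOfCode y : ℝ) ∈ Icc (-27) 27) :
    ImageLt p i x y v ↔ L.F !₂[(ratOfCode x : ℝ), (ratOfCode y : ℝ)] i < ratOfCode v := by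
  constructor
  · rintro ⟨k, l, h1, h2⟩
    have h1' := (Rat.cast_le (K := ℝ)).2 h1
    have h2' := (Rat.cast_le (K := ℝ)).2 h2
    push_cast [codedPoly_cast] at h1' h2'
    linarith [(abs_lt.1 (h.abs_rightPoly_sub i k l h1' hxr hy)).1]
  · intro hv
    obtain ⟨k, hk⟩ := exists_half_pow_lt hx
    obtain ⟨l, hl⟩ := exists_half_pow_lt (half_pos (sub_pos.2 hv))
    refine ⟨k, l, by simpa using (Rat.cast_le (K := ℝ)).1 (by simpa using hk.le), ?_⟩
    rw [← Rat.cast_le (K := ℝ)]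
    push_cast [codedPoly_cast]
    linarith [(abs_lt.1 (h.abs_rightPoly_sub i k l hk.le hxr hy)).2]

theorem IsName.imageGt_iff (h : L.IsName p) (i : Fin 2) {x y : ℕ} (v : ℕ)
    (hx : 0 < (ratOfCode x : ℝ)) (hxr : (ratOfCode x : ℝ) ≤ L.r)
    (hy : (ratOfCode y : ℝ) ∈ Icc (-27) 27) :
    ImageGt p i x y v ↔ ratOfCode v < L.F !₂[(ratOfCode x : ℝ), (ratOfCode y : ℝ)] i := by
  constructor
  · rintro ⟨k, l, h1, h2⟩
    have h1' := (Rat.cast_le (K := ℝ)).2 h1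
    have h2' := (Rat.cast_le (K := ℝ)).2 h2
    push_cast [codedPoly_cast] at h1' h2'
    linarith [(abs_lt.1 (h.abs_rightPoly_sub i k l h1' hxr hy)).2]
  · intro hv
    obtain ⟨k, hk⟩ := exists_half_pow_lt hx
    obtain ⟨l, hl⟩ := exists_half_pow_lt (half_pos (sub_pos.2 hv))
    refine ⟨k, l, by simpa using (Rat.cast_le (K := ℝ)).1 (by simpa using hk.le), ?_⟩
    rw [← Rat.cast_le (K := ℝ)]
    push_cast [codedPoly_cast]
    linarith [(abs_lt.1 (h.abs_rightPoly_sub i k l hk.le hxr hy)).1]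

theorem IsName.endImageLt_iff (h : L.IsName p) (i : Fin 2) {y : ℕ} (v : ℕ)
    (hy : (ratOfCode y : ℝ) ∈ Icc (-27) 27) :
    EndImageLt p i y v ↔ L.F !₂[L.r, (ratOfCode y : ℝ)] i < ratOfCode v := by
  have hr := L.zero_lt_r
  have hya : |(ratOfCode y : ℝ)| ≤ 27 := abs_le.2 hy
  have lip : ∀ k l m M : ℕ, 0 < rApprox p m → rApprox p m + 1 ≤ M → 27 ≤ M →
      |codedPoly (rightPoly p i k l) (rApprox p m : ℝ) (ratOfCode y : ℝ) -
        codedPoly (rightPoly p i k l) L.r (ratOfCode y : ℝ)| ≤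
          codedLip (rightPoly p i k l) M * (1 / 2) ^ m := by
    intro k l m M h0 h1 h2
    have hm := h.abs_rApprox_sub m
    have h0' : (0 : ℝ) < rApprox p m := by exact_mod_cast h0
    have h1' : (rApprox p m : ℝ) + 1 ≤ M := by exact_mod_cast h1
    have h2' : (27 : ℝ) ≤ M := by exact_mod_cast h2
    have h3 : (1 / 2 : ℝ) ^ m ≤ 1 := pow_le_one₀ (by norm_num) (by norm_num)
    have hlip : (0 : ℝ) ≤ codedLip (rightPoly p i k l) M := by
      have : (0 : ℚ) ≤ codedLip (rightPoly p i k l) M := by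
        rw [codedLip]
        refine List.sum_nonneg fun x hx => ?_
        obtain ⟨t, -, rfl⟩ := List.mem_map.1 hx
        positivity
      exact_mod_cast this
    refine (abs_codedPoly_sub_le _ (by omega) ?_ ?_ (hya.trans h2')).trans
      (mul_le_mul_of_nonneg_left hm.le hlip)
    · rw [abs_of_pos h0']
      linarith
    · rw [abs_of_pos hr]
      linarith [(abs_lt.1 hm).1]
  constructor
  · rintro ⟨k, l, m, M, h1, h2, h3, h4⟩
    have h0 : 0 < rApprox p m := lt_of_lt_of_le (by positivity) h1
    have hl := lip k l m M h0 h2 h3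
    have h1' := (Rat.cast_le (K := ℝ)).2 h1
    have h4' := (Rat.cast_le (K := ℝ)).2 h4
    push_cast [codedPoly_cast] at h1' h4'
    have hk : (1 / 2 : ℝ) ^ k ≤ L.r := by linarith [(abs_lt.1 (h.abs_rApprox_sub m)).2]
    linarith [(abs_lt.1 (h.abs_rightPoly_sub i k l hk le_rfl hy)).1, (abs_le.1 hl).1]
  · intro hv
    obtain ⟨k, hk⟩ := exists_half_pow_lt hr
    obtain ⟨l, hl⟩ := exists_half_pow_lt (show 0 <
      ((ratOfCode v : ℝ) - L.F !₂[L.r, (ratOfCode y : ℝ)] i) / 4 by linarith)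
    obtain ⟨M, hM⟩ := exists_nat_ge (max 27 (L.r + 2))
    have hM1 : 27 ≤ M := by exact_mod_cast (le_max_left _ _).trans hM
    have hM2 := (le_max_right _ _).trans hM
    -- `m` is taken so large that `r⁺` is well separated from `2⁻ᵏ` and the Lipschitz error is small.
    obtain ⟨m, hm⟩ := exists_half_pow_lt (show 0 < min ((L.r - (1 / 2) ^ k) / 2)
      ((1 / 2) ^ l / (|(codedLip (rightPoly p i k l) M : ℝ)| + 1)) from
        lt_min (by linarith) (by positivity))
    obtain ⟨hm1, hm2⟩ := lt_min_iff.1 hm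
    rw [lt_div_iff₀ (by positivity)] at hm2
    have hm3 : (codedLip (rightPoly p i k l) M : ℝ) * (1 / 2) ^ m ≤ (1 / 2) ^ l := by
      have := mul_le_mul_of_nonneg_right (le_abs_self (codedLip (rightPoly p i k l) M : ℝ))
        (by positivity : (0 : ℝ) ≤ (1 / 2) ^ m)
      have h1 : (0 : ℝ) ≤ (1 / 2) ^ m := by positivity
      linarith
    have hrm := abs_lt.1 (h.abs_rApprox_sub m)
    have h1 : (1 / 2) ^ k + (1 / 2) ^ m ≤ rApprox p m := by
      rw [← Rat.cast_le (K := ℝ)]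
      push_cast
      linarith [hrm.1]
    have h2 : rApprox p m + 1 ≤ M := by
      rw [← Rat.cast_le (K := ℝ)]
      push_cast
      have h3 : (1 / 2 : ℝ) ^ m ≤ 1 := pow_le_one₀ (by norm_num) (by norm_num)
      linarith [hrm.2]
    refine ⟨k, l, m, M, h1, h2, hM1, ?_⟩
    have hl' := lip k l m M (lt_of_lt_of_le (by positivity) h1) h2 hM1
    rw [← Rat.cast_le (K := ℝ)]
    push_cast [codedPoly_cast]
    linarith [(abs_lt.1 (h.abs_rightPoly_sub i k l hk.le le_rfl hy)).2, (abs_le.1 hl').2]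

end LorenzReturnMap

/-! ### Rational boxes and verified steps of the return map -/

/-- Codes `(a, b, c, d)` of the rational box `[a, b] × [c, d]`. -/
abbrev Box := ℕ × ℕ × ℕ × ℕ

/-- The point `z` lies in the closed box with code `b`. -/
def InBox (b : Box) (z : Plane) : Prop :=
  ((ratOfCode b.1 : ℝ) ≤ z 0 ∧ z 0 ≤ (ratOfCode b.2.1 : ℝ)) ∧
    ((ratOfCode b.2.2.1 : ℝ) ≤ z 1 ∧ z 1 ≤ (ratOfCode b.2.2.2 : ℝ))

/-- The point `z` lies in the interior of the box with code `b`. -/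
def InBoxInterior (b : Box) (z : Plane) : Prop :=
  ((ratOfCode b.1 : ℝ) < z 0 ∧ z 0 < (ratOfCode b.2.1 : ℝ)) ∧
    ((ratOfCode b.2.2.1 : ℝ) < z 1 ∧ z 1 < (ratOfCode b.2.2.2 : ℝ))

theorem isOpen_inBoxInterior (b : Box) : IsOpen {z | InBoxInterior b z} := by
  have h0 : Continuous fun z : Plane => z 0 := by fun_prop
  have h1 : Continuous fun z : Plane => z 1 := by fun_prop
  exact ((isOpen_lt continuous_const h0).inter (isOpen_lt h0 continuous_const)).inter
    ((isOpen_lt continuous_const h1).inter (isOpen_lt h1 continuous_const))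

theorem exists_box {z : Plane} {x₁ x₂ y₁ y₂ : ℝ} (h1 : x₁ < z 0) (h2 : z 0 < x₂) (h3 : y₁ < z 1)
    (h4 : z 1 < y₂) : ∃ b : Box, InBoxInterior b z ∧ x₁ < ratOfCode b.1 ∧ ratOfCode b.2.1 < x₂ ∧
      y₁ < ratOfCode b.2.2.1 ∧ ratOfCode b.2.2.2 < y₂ := by
  obtain ⟨b₁, hb₁, hb₁'⟩ := exists_ratOfCode_between h1
  obtain ⟨b₂, hb₂, hb₂'⟩ := exists_ratOfCode_between h2
  obtain ⟨b₃, hb₃, hb₃'⟩ := exists_ratOfCode_between h3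
  obtain ⟨b₄, hb₄, hb₄'⟩ := exists_ratOfCode_between h4
  exact ⟨(b₁, b₂, b₃, b₄), ⟨⟨hb₁', hb₂⟩, hb₃', hb₄⟩, hb₁, hb₂', hb₃, hb₄'⟩

/-- The code of the negative of the rational with code `n`. -/
def negCode (n : ℕ) : ℕ :=
  Nat.pair (Nat.pair n.unpair.1.unpair.2 n.unpair.1.unpair.1) n.unpair.2

@[simp] theorem ratOfCode_negCode (n : ℕ) : ratOfCode (negCode n) = -ratOfCode n := by
  rw [negCode, ratOfCode_pair, ratOfCode]
  ring

@[fun_prop] theorem primrec_negCode : Primrec negCode := by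
  unfold negCode
  fun_prop

/-- The code of the reflection of a box in the origin. -/
def negBox (b : Box) : Box := (negCode b.2.1, negCode b.1, negCode b.2.2.2, negCode b.2.2.1)

@[fun_prop] theorem primrec_negBox : Primrec negBox := by
  unfold negBox
  fun_prop

theorem inBox_negBox {b : Box} {z : Plane} : InBox (negBox b) z ↔ InBox b (-z) := by
  simp only [InBox, negBox, ratOfCode_negCode, Rat.cast_neg, PiLp.neg_apply]
  constructor <;> rintro ⟨⟨h1, h2⟩, h3, h4⟩ <;> refine ⟨⟨?_, ?_⟩, ?_, ?_⟩ <;> linarith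

theorem inBoxInterior_negBox {b : Box} {z : Plane} :
    InBoxInterior (negBox b) z ↔ InBoxInterior b (-z) := by
  simp only [InBoxInterior, negBox, ratOfCode_negCode, Rat.cast_neg, PiLp.neg_apply]
  constructor <;> rintro ⟨⟨h1, h2⟩, h3, h4⟩ <;> refine ⟨⟨?_, ?_⟩, ?_, ?_⟩ <;> linarith

/-- A name `p` witnesses that `F` maps the points of `b ∩ V` with `x > 0` to points above and to the
right of the lower left corner of `b'`. As `F` is monotone there, it suffices to look at `ρ⁺`, the
limit at `x = 0`, or at one rational point below and to the left of `b`. -/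
def StepLower (p : ℕ → ℕ) (b b' : Box) : Prop :=
  (AboveR p (negCode b'.1) ∧ BelowT p b'.2.2.1) ∨
  ∃ x y : ℕ, (0 < ratOfCode x ∧ BelowR p x ∧ -27 ≤ ratOfCode y ∧ ratOfCode y ≤ 27) ∧
    (ratOfCode x ≤ ratOfCode b.1 ∧ (ratOfCode y ≤ ratOfCode b.2.2.1 ∨ ratOfCode y ≤ -27)) ∧
    ImageGt p 0 x y b'.1 ∧ ImageGt p 1 x y b'.2.2.1

/-- A name `p` witnesses that `F` maps the points of `b ∩ V` with `x > 0` to points below and to the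
left of the upper right corner of `b'`. As `F` is monotone there, it suffices to look at one point
above and to the right of `b`, whose first coordinate is rational or equal to `r⁺`. -/
def StepUpper (p : ℕ → ℕ) (b b' : Box) : Prop :=
  ∃ y : ℕ, (-27 ≤ ratOfCode y ∧ ratOfCode y ≤ 27 ∧
      (ratOfCode b.2.2.2 ≤ ratOfCode y ∨ 27 ≤ ratOfCode y)) ∧
    ((EndImageLt p 0 y b'.2.1 ∧ EndImageLt p 1 y b'.2.2.2) ∨
    ∃ x : ℕ, (0 < ratOfCode x ∧ BelowR p x ∧ ratOfCode b.2.1 ≤ ratOfCode x) ∧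
      ImageLt p 0 x y b'.2.1 ∧ ImageLt p 1 x y b'.2.2.2)

/-- A name `p` witnesses that `F` maps the part of `b ∩ V` with `x > 0` into `b'`. -/
def StepRight (p : ℕ → ℕ) (b b' : Box) : Prop := StepLower p b b' ∧ StepUpper p b b'

/-- A name `p` witnesses that `F` maps the part of `b ∩ V` with `x < 0` into `b'`; by symmetry,
this is a statement about the part with `x > 0`. -/
def StepLeft (p : ℕ → ℕ) (b b' : Box) : Prop := StepRight p (negBox b) (negBox b')

theorem semi_stepLower : Semi fun p (x : Box × Box) => StepLower p x.1 x.2 := by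
  have h : Semi (α := ((Box × Box) × ℕ) × ℕ) fun p x =>
      (0 < ratOfCode x.1.2 ∧ BelowR p x.1.2 ∧ -27 ≤ ratOfCode x.2 ∧ ratOfCode x.2 ≤ 27) ∧
      (ratOfCode x.1.2 ≤ ratOfCode x.1.1.1.1 ∧
        (ratOfCode x.2 ≤ ratOfCode x.1.1.1.2.2.1 ∨ ratOfCode x.2 ≤ -27)) ∧
      ImageGt p 0 x.1.2 x.2 x.1.1.2.1 ∧ ImageGt p 1 x.1.2 x.2 x.1.1.2.2.2.1 :=
    ((PrimrecRat.lt (by fun_prop) (by fun_prop)).semi.and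
      ((semi_belowR.comp (by fun_prop)).and
        ((PrimrecRat.le (by fun_prop) (by fun_prop)).and
          (PrimrecRat.le (by fun_prop) (by fun_prop))).semi)).and
    (((PrimrecRat.le (by fun_prop) (by fun_prop)).and
      ((PrimrecRat.le (by fun_prop) (by fun_prop)).or
        (PrimrecRat.le (by fun_prop) (by fun_prop)))).semi.and
    (((semi_imageGt 0).comp (f := fun x : ((Box × Box) × ℕ) × ℕ => (x.1.2, x.2, x.1.1.2.1))
        (by fun_prop)).and
      ((semi_imageGt 1).comp (f := fun x : ((Box × Box) × ℕ) × ℕ => (x.1.2, x.2, x.1.1.2.2.2.1))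
        (by fun_prop))))
  exact ((semi_aboveR.comp (f := fun x : Box × Box => negCode x.2.1) (by fun_prop)).and
    (semi_belowT.comp (f := fun x : Box × Box => x.2.2.2.1) (by fun_prop))).or h.ex.ex

theorem semi_stepUpper : Semi fun p (x : Box × Box) => StepUpper p x.1 x.2 := by
  have h : Semi (α := ((Box × Box) × ℕ) × ℕ) fun p x =>
      (0 < ratOfCode x.2 ∧ BelowR p x.2 ∧ ratOfCode x.1.1.1.2.1 ≤ ratOfCode x.2) ∧
      ImageLt p 0 x.2 x.1.2 x.1.1.2.2.1 ∧ ImageLt p 1 x.2 x.1.2 x.1.1.2.2.2.2 :=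
    ((PrimrecRat.lt (by fun_prop) (by fun_prop)).semi.and
      ((semi_belowR.comp (by fun_prop)).and
        (PrimrecRat.le (by fun_prop) (by fun_prop)).semi)).and
    (((semi_imageLt 0).comp (f := fun x : ((Box × Box) × ℕ) × ℕ => (x.2, x.1.2, x.1.1.2.2.1))
        (by fun_prop)).and
      ((semi_imageLt 1).comp (f := fun x : ((Box × Box) × ℕ) × ℕ => (x.2, x.1.2, x.1.1.2.2.2.2))
        (by fun_prop)))
  have h' : Semi (α := (Box × Box) × ℕ) fun p x =>
      (-27 ≤ ratOfCode x.2 ∧ ratOfCode x.2 ≤ 27 ∧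
        (ratOfCode x.1.1.2.2.2 ≤ ratOfCode x.2 ∨ 27 ≤ ratOfCode x.2)) ∧
      ((EndImageLt p 0 x.2 x.1.2.2.1 ∧ EndImageLt p 1 x.2 x.1.2.2.2.2) ∨
      ∃ y : ℕ, (0 < ratOfCode y ∧ BelowR p y ∧ ratOfCode x.1.1.2.1 ≤ ratOfCode y) ∧
        ImageLt p 0 y x.2 x.1.2.2.1 ∧ ImageLt p 1 y x.2 x.1.2.2.2.2) :=
    ((PrimrecRat.le (by fun_prop) (by fun_prop)).and
      ((PrimrecRat.le (by fun_prop) (by fun_prop)).and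
      ((PrimrecRat.le (by fun_prop) (by fun_prop)).or
        (PrimrecRat.le (by fun_prop) (by fun_prop))))).semi.and
    ((((semi_endImageLt 0).comp (f := fun x : (Box × Box) × ℕ => (x.2, x.1.2.2.1))
        (by fun_prop)).and
      ((semi_endImageLt 1).comp (f := fun x : (Box × Box) × ℕ => (x.2, x.1.2.2.2.2))
        (by fun_prop))).or h.ex)
  exact h'.ex

theorem semi_stepRight : Semi fun p (x : Box × Box) => StepRight p x.1 x.2 :=
  semi_stepLower.and semi_stepUpper

theorem semi_stepLeft : Semi fun p (x : Box × Box) => StepLeft p x.1 x.2 :=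
  semi_stepRight.comp (f := fun x : Box × Box => (negBox x.1, negBox x.2)) (by fun_prop)

namespace LorenzReturnMap

variable {L : LorenzReturnMap} {p : ℕ → ℕ}

theorem IsName.F_mem_of_stepLower (h : L.IsName p) {b b' : Box} (hs : StepLower p b b')
    {z : Plane} (hz : z ∈ L.V) (h0 : 0 < z 0) (hb : InBox b z) :
    (ratOfCode b'.1 : ℝ) < L.F z 0 ∧ (ratOfCode b'.2.2.1 : ℝ) < L.F z 1 := by
  rcases hs with ⟨h1, h2⟩ | ⟨x, y, ⟨hx0, hxr, hy, hy'⟩, ⟨hxb, hyb⟩, h1, h2⟩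
  · rw [h.aboveR_iff, ratOfCode_negCode, Rat.cast_neg] at h1
    rw [h.belowT_iff] at h2
    exact ⟨by linarith [L.neg_r_lt_F hz h0], h2.trans_le (L.t_le_F hz h0)⟩
  · rw [h.belowR_iff] at hxr
    have hx0 : (0 : ℝ) < ratOfCode x := by exact_mod_cast hx0
    have hy : (-27 : ℝ) ≤ ratOfCode y := by exact_mod_cast hy
    have hy' : (ratOfCode y : ℝ) ≤ 27 := by exact_mod_cast hy'
    have hxb : (ratOfCode x : ℝ) ≤ ratOfCode b.1 := by exact_mod_cast hxb
    replace h1 := (h.imageGt_iff 0 _ hx0 hxr.le ⟨hy, hy'⟩).1 h1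
    replace h2 := (h.imageGt_iff 1 _ hx0 hxr.le ⟨hy, hy'⟩).1 h2
    have hV := L.mk_mem_V hx0 hxr.le hy hy'
    have hxz : (!₂[(ratOfCode x : ℝ), (ratOfCode y : ℝ)] : Plane) 0 ≤ z 0 := by
      simpa using hxb.trans hb.1.1
    have hyz : (!₂[(ratOfCode x : ℝ), (ratOfCode y : ℝ)] : Plane) 1 ≤ z 1 := by
      rcases hyb with hyb | hyb
      · have hyb : (ratOfCode y : ℝ) ≤ ratOfCode b.2.2.1 := by exact_mod_cast hyb
        simpa using hyb.trans hb.2.1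
      · have hyb : (ratOfCode y : ℝ) ≤ -27 := by exact_mod_cast hyb
        simpa using hyb.trans ((L.mem_V).1 hz).2.1
    exact ⟨h1.trans_le (L.F_zero_le hV hz (by simpa using hx0) hxz),
      h2.trans_le (L.F_one_le hV hz (by simpa using hx0) hxz hyz)⟩

theorem IsName.F_mem_of_stepUpper (h : L.IsName p) {b b' : Box} (hs : StepUpper p b b')
    {z : Plane} (hz : z ∈ L.V) (h0 : 0 < z 0) (hb : InBox b z) :
    L.F z 0 < (ratOfCode b'.2.1 : ℝ) ∧ L.F z 1 < (ratOfCode b'.2.2.2 : ℝ) := by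
  obtain ⟨y, ⟨hy, hy', hyb⟩, hs⟩ := hs
  have hzV := (L.mem_V).1 hz
  have hy : (-27 : ℝ) ≤ ratOfCode y := by exact_mod_cast hy
  have hy' : (ratOfCode y : ℝ) ≤ 27 := by exact_mod_cast hy'
  have hyz : z 1 ≤ ratOfCode y := by
    rcases hyb with hyb | hyb
    · have hyb : (ratOfCode b.2.2.2 : ℝ) ≤ ratOfCode y := by exact_mod_cast hyb
      exact hb.2.2.trans hyb
    · have hyb : (27 : ℝ) ≤ ratOfCode y := by exact_mod_cast hyb
      exact hzV.2.2.trans hyb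
  have main : ∀ x : ℝ, 0 < x → x ≤ L.r → z 0 ≤ x →
      L.F !₂[x, (ratOfCode y : ℝ)] 0 < ratOfCode b'.2.1 →
      L.F !₂[x, (ratOfCode y : ℝ)] 1 < ratOfCode b'.2.2.2 →
      L.F z 0 < (ratOfCode b'.2.1 : ℝ) ∧ L.F z 1 < (ratOfCode b'.2.2.2 : ℝ) := by
    intro x hx0 hxr hxz h1 h2
    have hV := L.mk_mem_V hx0 hxr hy hy'
    exact ⟨(L.F_zero_le hz hV h0 (by simpa using hxz)).trans_lt h1,
      (L.F_one_le hz hV h0 (by simpa using hxz) (by simpa using hyz)).trans_lt h2⟩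
  rcases hs with ⟨h1, h2⟩ | ⟨x, ⟨hx0, hxr, hxb⟩, h1, h2⟩
  · exact main L.r L.zero_lt_r le_rfl hzV.1.2 ((h.endImageLt_iff 0 _ ⟨hy, hy'⟩).1 h1)
      ((h.endImageLt_iff 1 _ ⟨hy, hy'⟩).1 h2)
  · rw [h.belowR_iff] at hxr
    have hx0 : (0 : ℝ) < ratOfCode x := by exact_mod_cast hx0
    have hxb : (ratOfCode b.2.1 : ℝ) ≤ ratOfCode x := by exact_mod_cast hxb
    exact main _ hx0 hxr.le (hb.1.2.trans hxb) ((h.imageLt_iff 0 _ hx0 hxr.le ⟨hy, hy'⟩).1 h1)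
      ((h.imageLt_iff 1 _ hx0 hxr.le ⟨hy, hy'⟩).1 h2)

theorem IsName.inBox_of_stepRight (h : L.IsName p) {b b' : Box} (hs : StepRight p b b')
    {z : Plane} (hz : z ∈ L.V) (h0 : 0 < z 0) (hb : InBox b z) : InBox b' (L.F z) :=
  have h1 := h.F_mem_of_stepLower hs.1 hz h0 hb
  have h2 := h.F_mem_of_stepUpper hs.2 hz h0 hb
  ⟨⟨h1.1.le, h2.1.le⟩, h1.2.le, h2.2.le⟩

theorem IsName.inBox_of_stepLeft (h : L.IsName p) {b b' : Box} (hs : StepLeft p b b')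
    {z : Plane} (hz : z ∈ L.V) (h0 : z 0 < 0) (hb : InBox b z) : InBox b' (L.F z) := by
  have := h.inBox_of_stepRight hs (L.neg_mem_V hz) (by simpa using h0)
    (inBox_negBox.2 (by rwa [neg_neg]))
  rwa [L.F_neg hz h0.ne, inBox_negBox, neg_neg] at this

/-- Near a point of `V` with `x > 0`, the continuity of `F` is witnessed by a step of boxes. -/
theorem IsName.exists_stepRight (h : L.IsName p) {b' : Box} {z : Plane} (hz : z ∈ L.V)
    (h0 : 0 < z 0) (hb' : InBoxInterior b' (L.F z)) :
    ∃ b, InBoxInterior b z ∧ 0 < ratOfCode b.1 ∧ StepRight p b b' := by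
  have hzV := (L.mem_V).1 hz
  have hr := L.zero_lt_r
  obtain ⟨ε, hε, hball⟩ := Metric.mem_nhdsWithin_iff.1
    ((L.continuousWithinAt_F hz h0.ne').preimage_mem_nhdsWithin
      ((isOpen_inBoxInterior b').mem_nhds hb'))
  have key : ∀ x y : ℝ, 0 < x → x ≤ L.r → y ∈ Icc (-27) 27 → |x - z 0| < ε / 2 →
      |y - z 1| < ε / 2 → InBoxInterior b' (L.F !₂[x, y]) := by
    intro x y hx hxr hy hxz hyz
    refine hball ⟨?_, (L.mem_VD).2 ⟨L.mk_mem_V hx hxr hy.1 hy.2, by simpa using hx.ne'⟩⟩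
    rw [Metric.mem_ball, EuclideanSpace.dist_eq, Fin.sum_univ_two]
    refine (Real.sqrt_lt' hε).2 ?_
    simp only [Real.dist_eq, sq_abs, Matrix.cons_val_zero, Matrix.cons_val_one]
    have h1 := sq_lt_sq' (abs_lt.1 hxz).1 (abs_lt.1 hxz).2
    have h2 := sq_lt_sq' (abs_lt.1 hyz).1 (abs_lt.1 hyz).2
    nlinarith
  -- a rational point of `V` to the left of and below `z`
  obtain ⟨x₁, hx₁, hx₁'⟩ := exists_ratOfCode_between (max_lt h0 (sub_lt_self (z 0) (half_pos hε)))
  rw [max_lt_iff] at hx₁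
  obtain ⟨y₁, c, hy₁, hy₁ε, hy₁c, hc⟩ : ∃ y c : ℕ, (ratOfCode y : ℝ) ∈ Icc (-27) 27 ∧
      |(ratOfCode y : ℝ) - z 1| < ε / 2 ∧ (ratOfCode y ≤ ratOfCode c ∨ ratOfCode y ≤ -27) ∧
      (ratOfCode c : ℝ) < z 1 := by
    rcases hzV.2.1.eq_or_lt with hz1 | hz1
    · obtain ⟨y, hy⟩ := ratOfCode_surjective (-27)
      obtain ⟨c, hc⟩ := ratOfCode_surjective (-28)
      refine ⟨y, c, ?_, ?_, Or.inr hy.le, ?_⟩ <;> simp [hy, hc, ← hz1] <;> linarith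
    · obtain ⟨y, hy, hy'⟩ :=
        exists_ratOfCode_between (max_lt hz1 (sub_lt_self (z 1) (half_pos hε)))
      rw [max_lt_iff] at hy
      exact ⟨y, y, ⟨hy.1.le, hy'.le.trans hzV.2.2⟩, abs_lt.2 ⟨by linarith, by linarith⟩,
        Or.inl le_rfl, hy'⟩
  -- a point of `V` to the right of and above `z`
  obtain ⟨y₂, d, hy₂, hy₂ε, hy₂d, hd⟩ : ∃ y d : ℕ, (ratOfCode y : ℝ) ∈ Icc (-27) 27 ∧
      |(ratOfCode y : ℝ) - z 1| < ε / 2 ∧ (ratOfCode d ≤ ratOfCode y ∨ 27 ≤ ratOfCode y) ∧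
      z 1 < (ratOfCode d : ℝ) := by
    rcases hzV.2.2.eq_or_lt with hz1 | hz1
    · obtain ⟨y, hy⟩ := ratOfCode_surjective 27
      obtain ⟨d, hd⟩ := ratOfCode_surjective 28
      refine ⟨y, d, ?_, ?_, Or.inr hy.ge, ?_⟩ <;> simp [hy, hd, hz1] <;> linarith
    · obtain ⟨y, hy, hy'⟩ :=
        exists_ratOfCode_between (lt_min hz1 (lt_add_of_pos_right (z 1) (half_pos hε)))
      rw [lt_min_iff] at hy'
      exact ⟨y, y, ⟨hzV.2.1.trans hy.le, hy'.1.le⟩, abs_lt.2 ⟨by linarith, by linarith⟩,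
        Or.inl le_rfl, hy⟩
  have hx₁r : (ratOfCode x₁ : ℝ) < L.r := hx₁'.trans_le hzV.1.2
  have hlow := key _ _ hx₁.1 hx₁r.le hy₁ (abs_lt.2 ⟨by linarith, by linarith⟩) hy₁ε
  have hxQ : 0 < ratOfCode x₁ := by exact_mod_cast hx₁.1
  have lower : ∀ b₂, StepLower p (x₁, b₂, c, d) b' := fun b₂ => by
    refine Or.inr ⟨x₁, y₁, ⟨hxQ, (h.belowR_iff _).2 hx₁r, ?_, ?_⟩, ⟨le_rfl, hy₁c⟩,
      (h.imageGt_iff 0 _ hx₁.1 hx₁r.le hy₁).2 hlow.1.1,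
      (h.imageGt_iff 1 _ hx₁.1 hx₁r.le hy₁).2 hlow.2.1⟩
    · exact_mod_cast hy₁.1
    · exact_mod_cast hy₁.2
  have hy₂Q : -27 ≤ ratOfCode y₂ ∧ ratOfCode y₂ ≤ 27 := by
    constructor
    · exact_mod_cast hy₂.1
    · exact_mod_cast hy₂.2
  rcases hzV.1.2.eq_or_lt with hzr | hzr
  · obtain ⟨b₂, hb₂, -⟩ := exists_ratOfCode_between (lt_add_one (z 0))
    have hup := key L.r _ hr le_rfl hy₂ (by rw [hzr]; simpa using hε) hy₂ε
    exact ⟨(x₁, b₂, c, d), ⟨⟨hx₁', hb₂⟩, hc, hd⟩, hxQ, lower b₂, y₂, ⟨hy₂Q.1, hy₂Q.2, hy₂d⟩,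
      Or.inl ⟨(h.endImageLt_iff 0 _ hy₂).2 hup.1.2, (h.endImageLt_iff 1 _ hy₂).2 hup.2.2⟩⟩
  · obtain ⟨x₂, hx₂, hx₂'⟩ :=
      exists_ratOfCode_between (lt_min hzr (lt_add_of_pos_right (z 0) (half_pos hε)))
    rw [lt_min_iff] at hx₂'
    have hx₂0 := h0.trans hx₂
    have hup := key _ _ hx₂0 hx₂'.1.le hy₂ (abs_lt.2 ⟨by linarith, by linarith⟩) hy₂ε
    exact ⟨(x₁, x₂, c, d), ⟨⟨hx₁', hx₂⟩, hc, hd⟩, hxQ, lower x₂, y₂, ⟨hy₂Q.1, hy₂Q.2, hy₂d⟩,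
      Or.inr ⟨x₂, ⟨Rat.cast_pos.1 hx₂0, (h.belowR_iff _).2 hx₂'.1, le_rfl⟩,
        (h.imageLt_iff 0 _ hx₂0 hx₂'.1.le hy₂).2 hup.1.2,
        (h.imageLt_iff 1 _ hx₂0 hx₂'.1.le hy₂).2 hup.2.2⟩⟩

theorem IsName.exists_stepLeft (h : L.IsName p) {b' : Box} {z : Plane} (hz : z ∈ L.V)
    (h0 : z 0 < 0) (hb' : InBoxInterior b' (L.F z)) :
    ∃ b, InBoxInterior b z ∧ ratOfCode b.2.1 < 0 ∧ StepLeft p b b' := by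
  obtain ⟨b, hb, hb0, hs⟩ := h.exists_stepRight (b' := negBox b') (L.neg_mem_V hz)
    (by simpa using h0) (by rwa [inBoxInterior_negBox, L.F_neg hz h0.ne, neg_neg])
  refine ⟨negBox b, inBoxInterior_negBox.2 hb, by simpa [negBox] using hb0, ?_⟩
  obtain ⟨a₁, a₂, a₃, a₄⟩ := b
  have : ∀ n, negCode (negCode n) = n := fun n => by simp [negCode]
  simpa only [StepLeft, negBox, this] using hs

/-- All boxes to the left of a suitable vertical line `x = X > 0` step into a given neighbourhood
of `ρ⁺`. -/
theorem IsName.exists_stepRight_zero (h : L.IsName p) {b' : Box}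
    (hb' : InBoxInterior b' L.ρplus) :
    ∃ x, 0 < ratOfCode x ∧ ∀ b : Box, ratOfCode b.2.1 ≤ ratOfCode x → StepRight p b b' := by
  have h0 : L.ρplus 0 = -L.r := L.r_symm
  obtain ⟨⟨h1, h2⟩, h3, h4⟩ := hb'
  rw [h0] at h1 h2
  have he := (L.tendsto_F_zero.eventually (gt_mem_nhds h2)).and
    (((L.tendsto_F_one (y := 27) (by norm_num)).eventually (gt_mem_nhds h4)).and
      (Ioo_mem_nhdsGT L.zero_lt_r))
  obtain ⟨s, hs1, hs2, hs⟩ := he.exists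
  obtain ⟨x, hx, hxs⟩ := exists_ratOfCode_between hs.1
  obtain ⟨y, hy⟩ := ratOfCode_surjective 27
  have hy' : ((ratOfCode y : ℚ) : ℝ) = 27 := by simp [hy]
  have hyI : (ratOfCode y : ℝ) ∈ Icc (-27) 27 := by rw [hy']; norm_num
  have hxr := hxs.trans hs.2
  have hxV := L.mk_mem_V (y := 27) hx hxr.le (by norm_num) le_rfl
  have hsV := L.mk_mem_V (y := 27) hs.1 hs.2.le (by norm_num) le_rfl
  have hx0 : 0 < ratOfCode x := by exact_mod_cast hx
  refine ⟨x, hx0, fun b hb => ⟨Or.inl ⟨(h.aboveR_iff _).2 ?_, (h.belowT_iff _).2 h3⟩, y,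
    ⟨by rw [hy]; norm_num, hy.le, Or.inr hy.ge⟩,
    Or.inr ⟨x, ⟨hx0, (h.belowR_iff _).2 hxr, hb⟩, (h.imageLt_iff 0 _ hx hxr.le hyI).2 ?_,
      (h.imageLt_iff 1 _ hx hxr.le hyI).2 ?_⟩⟩⟩
  · rw [ratOfCode_negCode, Rat.cast_neg]
    linarith
  · rw [hy']
    exact (L.F_zero_le hxV hsV (by simpa using hx) (by simpa using hxs.le)).trans_lt hs1
  · rw [hy']
    exact (L.F_one_le hxV hsV (by simpa using hx) (by simpa using hxs.le) (by simp)).trans_lt hs2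

end LorenzReturnMap

/-! ### Approximation of the attractor from inside -/

theorem dist_le_abs_add_abs (z w : Plane) : dist z w ≤ |z 0 - w 0| + |z 1 - w 1| := by
  rw [EuclideanSpace.dist_eq, Fin.sum_univ_two]
  refine Real.sqrt_le_iff.2 ⟨by positivity, ?_⟩
  simp only [Real.dist_eq]
  nlinarith [abs_nonneg (z 0 - w 0), abs_nonneg (z 1 - w 1)]

/-- A name `p` witnesses that the box `b` contains a rational point of `V` with `0 < |x| < r⁺`. -/
def StartBox (p : ℕ → ℕ) (b : Box) : Prop := ∃ x y : ℕ,
  ((0 < ratOfCode x ∨ ratOfCode x < 0) ∧ BelowR p x ∧ BelowR p (negCode x) ∧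
    -27 ≤ ratOfCode y ∧ ratOfCode y ≤ 27) ∧
  ratOfCode b.1 ≤ ratOfCode x ∧ ratOfCode x ≤ ratOfCode b.2.1 ∧
  ratOfCode b.2.2.1 ≤ ratOfCode y ∧ ratOfCode y ≤ ratOfCode b.2.2.2

/-- A name `p` witnesses that the box `b` does not meet `D` and that `F (b ∩ V) ⊆ b'`. -/
def StepOff (p : ℕ → ℕ) (b b' : Box) : Prop :=
  (0 < ratOfCode b.1 ∧ StepRight p b b') ∨ (ratOfCode b.2.1 < 0 ∧ StepLeft p b b')

/-- The claim `f = (n, b)`, that the box `b` meets `Fⁿ(V ∖ D)`, is justified by claims from `l`. -/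
def ReachJustified (p : ℕ → ℕ) (l : List (ℕ × Box)) (f : ℕ × Box) : Prop :=
  (f.1 = 0 ∧ StartBox p f.2) ∨ ∃ f', (f' ∈ l ∧ f'.1 + 1 = f.1) ∧ StepOff p f'.2 f.2

/-- A name `p` witnesses, by a list of justified claims, that the box `b` meets `Fⁿ(V ∖ D)`. -/
def Reach (p : ℕ → ℕ) (n : ℕ) (b : Box) : Prop :=
  ∃ l : List (ℕ × Box), (n, b) ∈ l ∧ ∀ f ∈ l, ReachJustified p l f

/-- A name `p` witnesses that the open square with centre `z` and half side `2⁻ᵏ` meets the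
attractor: a smaller square meets `F²ᵐ(V ∖ D)`, whose points are `54 · 2⁻ᵐ`-close to the
attractor. -/
def Near (p : ℕ → ℕ) (z k : ℕ) : Prop := ∃ (m : ℕ) (b : Box),
  (ratOfCode z.unpair.1 - (1 / 2) ^ k + 54 * (1 / 2) ^ m < ratOfCode b.1 ∧
    ratOfCode b.2.1 < ratOfCode z.unpair.1 + (1 / 2) ^ k - 54 * (1 / 2) ^ m ∧
    ratOfCode z.unpair.2 - (1 / 2) ^ k + 54 * (1 / 2) ^ m < ratOfCode b.2.2.1 ∧
    ratOfCode b.2.2.2 < ratOfCode z.unpair.2 + (1 / 2) ^ k - 54 * (1 / 2) ^ m) ∧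
  Reach p (2 * m) b

theorem primrecPred_mem_list {α β : Type} [Primcodable α] [Primcodable β] {f : α → β}
    {l : α → List β} (hf : Primrec f) (hl : Primrec l) : PrimrecPred fun a => f a ∈ l a := by
  have h : PrimrecRel fun (l : List β) (b : β) => b ∈ l :=
    (Primrec.eq (α := β)).exists_mem_list.of_eq fun a b => by simp
  exact h.comp hl hf

theorem semi_startBox : Semi StartBox := by
  have h : Semi (α := (Box × ℕ) × ℕ) fun p x =>
      ((0 < ratOfCode x.1.2 ∨ ratOfCode x.1.2 < 0) ∧ BelowR p x.1.2 ∧ BelowR p (negCode x.1.2) ∧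
        -27 ≤ ratOfCode x.2 ∧ ratOfCode x.2 ≤ 27) ∧
      ratOfCode x.1.1.1 ≤ ratOfCode x.1.2 ∧ ratOfCode x.1.2 ≤ ratOfCode x.1.1.2.1 ∧
      ratOfCode x.1.1.2.2.1 ≤ ratOfCode x.2 ∧ ratOfCode x.2 ≤ ratOfCode x.1.1.2.2.2 :=
    (((PrimrecRat.lt (by fun_prop) (by fun_prop)).or
      (PrimrecRat.lt (by fun_prop) (by fun_prop))).semi.and
      ((semi_belowR.comp (by fun_prop)).and ((semi_belowR.comp (f := fun x : (Box × ℕ) × ℕ =>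
        negCode x.1.2) (by fun_prop)).and
        ((PrimrecRat.le (by fun_prop) (by fun_prop)).and
          (PrimrecRat.le (by fun_prop) (by fun_prop))).semi))).and
    ((PrimrecRat.le (by fun_prop) (by fun_prop)).and
      ((PrimrecRat.le (by fun_prop) (by fun_prop)).and
      ((PrimrecRat.le (by fun_prop) (by fun_prop)).and
        (PrimrecRat.le (by fun_prop) (by fun_prop))))).semi
  exact h.ex.ex

theorem semi_stepOff : Semi fun p (x : Box × Box) => StepOff p x.1 x.2 :=
  ((PrimrecRat.lt (by fun_prop) (by fun_prop)).semi.and semi_stepRight).or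
    ((PrimrecRat.lt (by fun_prop) (by fun_prop)).semi.and semi_stepLeft)

theorem semi_reachJustified :
    Semi fun p (x : List (ℕ × Box) × ℕ × Box) => ReachJustified p x.1 x.2 := by
  have h : Semi (α := (List (ℕ × Box) × ℕ × Box) × ℕ × Box) fun p x =>
      (x.2 ∈ x.1.1 ∧ x.2.1 + 1 = x.1.2.1) ∧ StepOff p x.2.2 x.1.2.2 :=
    ((primrecPred_mem_list (by fun_prop) (by fun_prop)).and
      (Primrec.eq.comp (by fun_prop) (by fun_prop))).semi.and
    (semi_stepOff.comp (f := fun x : (List (ℕ × Box) × ℕ × Box) × ℕ × Box => (x.2.2, x.1.2.2))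
      (by fun_prop))
  exact ((Primrec.eq.comp (f := fun x : List (ℕ × Box) × ℕ × Box => x.2.1) (g := fun _ => 0)
    (by fun_prop) (by fun_prop)).semi.and
      (semi_startBox.comp (f := fun x : List (ℕ × Box) × ℕ × Box => x.2.2) (by fun_prop))).or h.ex

theorem semi_reach : Semi fun p (x : ℕ × Box) => Reach p x.1 x.2 := by
  have h : Semi (α := ((ℕ × Box) × List (ℕ × Box)) × ℕ × Box) fun p x =>
      ReachJustified p x.1.2 x.2 :=
    semi_reachJustified.comp (f := fun x : ((ℕ × Box) × List (ℕ × Box)) × ℕ × Box => (x.1.2, x.2))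
      (by fun_prop)
  have h' : Semi (α := (ℕ × Box) × List (ℕ × Box)) fun p x =>
      (x.1.1, x.1.2) ∈ x.2 ∧ ∀ f ∈ x.2, ReachJustified p x.2 f :=
    (primrecPred_mem_list (f := fun x : (ℕ × Box) × List (ℕ × Box) => (x.1.1, x.1.2)) (by fun_prop)
      (by fun_prop)).semi.and (h.forall_mem (l := fun x : (ℕ × Box) × List (ℕ × Box) => x.2)
        (by fun_prop))
  exact h'.ex

theorem semi_near : Semi fun p (x : ℕ × ℕ) => Near p x.1 x.2 := by
  have h : Semi (α := ((ℕ × ℕ) × ℕ) × Box) fun p x =>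
      (ratOfCode x.1.1.1.unpair.1 - (1 / 2) ^ x.1.1.2 + 54 * (1 / 2) ^ x.1.2 < ratOfCode x.2.1 ∧
      ratOfCode x.2.2.1 < ratOfCode x.1.1.1.unpair.1 + (1 / 2) ^ x.1.1.2 - 54 * (1 / 2) ^ x.1.2 ∧
      ratOfCode x.1.1.1.unpair.2 - (1 / 2) ^ x.1.1.2 + 54 * (1 / 2) ^ x.1.2 <
        ratOfCode x.2.2.2.1 ∧
      ratOfCode x.2.2.2.2 < ratOfCode x.1.1.1.unpair.2 + (1 / 2) ^ x.1.1.2 -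
        54 * (1 / 2) ^ x.1.2) ∧ Reach p (2 * x.1.2) x.2 :=
    ((PrimrecRat.lt (by fun_prop) (by fun_prop)).and
      ((PrimrecRat.lt (by fun_prop) (by fun_prop)).and
      ((PrimrecRat.lt (by fun_prop) (by fun_prop)).and
        (PrimrecRat.lt (by fun_prop) (by fun_prop))))).semi.and
    (semi_reach.comp (f := fun x : ((ℕ × ℕ) × ℕ) × Box => (2 * x.1.2, x.2)) (by fun_prop))
  exact h.ex.ex

namespace LorenzReturnMap

variable {L : LorenzReturnMap} {p : ℕ → ℕ}

theorem innerIter_subset_V (n : ℕ) : L.innerIter n ⊆ L.V :=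
  (L.innerIter_subset_iter n).trans (L.iter_subset_V n)

theorem IsName.exists_mem_of_startBox (h : L.IsName p) {b : Box} (hb : StartBox p b) :
    ∃ z ∈ L.innerIter 0, InBox b z := by
  obtain ⟨x, y, ⟨hx, h1, h2, h3, h4⟩, h5, h6, h7, h8⟩ := hb
  rw [h.belowR_iff] at h1 h2
  rw [ratOfCode_negCode, Rat.cast_neg] at h2
  have hx' : (ratOfCode x : ℝ) ≠ 0 := by
    rw [Rat.cast_ne_zero]
    rcases hx with hx | hx
    exacts [hx.ne', hx.ne]
  refine ⟨!₂[(ratOfCode x : ℝ), (ratOfCode y : ℝ)], ⟨(L.mem_V).2 ⟨⟨?_, ?_⟩, ?_, ?_⟩, ?_, ?_⟩,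
    ⟨?_, ?_⟩, ?_, ?_⟩
  · simpa using by linarith
  · simpa using h1.le
  · simpa using (Rat.cast_le (K := ℝ)).2 h3
  · simpa using (Rat.cast_le (K := ℝ)).2 h4
  · simpa using hx'
  · simpa [abs_lt] using ⟨by linarith, h1⟩
  · simpa using h5
  · simpa using h6
  · simpa using h7
  · simpa using h8

theorem IsName.exists_mem_of_reach (h : L.IsName p) {n : ℕ} {b : Box} (hb : Reach p n b) :
    ∃ z ∈ L.innerIter n, InBox b z := by
  obtain ⟨l, hl, H⟩ := hb
  induction n generalizing b with
  | zero =>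
    rcases H _ hl with ⟨-, hs⟩ | ⟨f', ⟨-, hf⟩, -⟩
    · exact h.exists_mem_of_startBox hs
    · exact absurd hf (by simp)
  | succ n ih =>
    rcases H _ hl with ⟨h0, -⟩ | ⟨⟨n', b'⟩, ⟨hf', hf⟩, hs⟩
    · exact absurd h0 (by simp)
    · obtain rfl : n' = n := by simpa using hf
      obtain ⟨z, hz, hzb⟩ := ih hf'
      have hzV := innerIter_subset_V _ hz
      rcases hs with ⟨h0, hs⟩ | ⟨h0, hs⟩
      · have h0' : 0 < z 0 := (Rat.cast_pos.2 h0).trans_le hzb.1.1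
        exact ⟨L.F z, ⟨z, ⟨hz, fun h => h0'.ne' h.2⟩, rfl⟩, h.inBox_of_stepRight hs hzV h0' hzb⟩
      · have h0' : z 0 < 0 := hzb.1.2.trans_lt (Rat.cast_lt_zero.2 h0)
        exact ⟨L.F z, ⟨z, ⟨hz, fun h => h0'.ne h.2⟩, rfl⟩, h.inBox_of_stepLeft hs hzV h0' hzb⟩

theorem _root_.ReachJustified.mono {l l' : List (ℕ × Box)} {f : ℕ × Box}
    (h : ReachJustified p l f) (hl : l ⊆ l') : ReachJustified p l' f := by
  rcases h with h | ⟨f', ⟨h1, h2⟩, h3⟩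
  exacts [Or.inl h, Or.inr ⟨f', ⟨hl h1, h2⟩, h3⟩]

theorem IsName.reach_of_mem (h : L.IsName p) {n : ℕ} {b : Box} {z : Plane}
    (hz : z ∈ L.innerIter n) (hb : InBoxInterior b z) : Reach p n b := by
  induction n generalizing b z with
  | zero =>
    refine ⟨[(0, b)], by simp, fun f hf => ?_⟩
    obtain rfl : f = (0, b) := by simpa using hf
    obtain ⟨hzV, hz0, hzr⟩ := hz
    have hzV' := (L.mem_V).1 hzV
    obtain ⟨hzr1, hzr2⟩ := abs_lt.1 hzr
    obtain ⟨⟨hb1, hb2⟩, hb3, hb4⟩ := hb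
    -- a rational point in the intersection of `b` with `V`
    obtain ⟨x, hx0, hxr, hxr', hxb, hxb'⟩ : ∃ x, (0 < ratOfCode x ∨ ratOfCode x < 0) ∧
        (ratOfCode x : ℝ) < L.r ∧ -L.r < ratOfCode x ∧ (ratOfCode b.1 : ℝ) ≤ ratOfCode x ∧
        (ratOfCode x : ℝ) ≤ ratOfCode b.2.1 := by
      rcases hz0.lt_or_gt with h0 | h0
      · obtain ⟨x, hx, hx'⟩ := exists_ratOfCode_between (max_lt hb1 hzr1)
        obtain ⟨hx1, hx2⟩ := max_lt_iff.1 hx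
        exact ⟨x, Or.inr (Rat.cast_lt_zero.1 (hx'.trans h0)), hx'.trans hzr2, hx2, hx1.le,
          (hx'.trans hb2).le⟩
      · obtain ⟨x, hx, hx'⟩ := exists_ratOfCode_between (lt_min hb2 hzr2)
        obtain ⟨hx1, hx2⟩ := lt_min_iff.1 hx'
        exact ⟨x, Or.inl (Rat.cast_pos.1 (h0.trans hx)), hx2, hzr1.trans hx, (hb1.trans hx).le,
          hx1.le⟩
    obtain ⟨y, hy, hy', hyb, hyb'⟩ : ∃ y, (-27 : ℝ) ≤ ratOfCode y ∧ (ratOfCode y : ℝ) ≤ 27 ∧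
        (ratOfCode b.2.2.1 : ℝ) ≤ ratOfCode y ∧ (ratOfCode y : ℝ) ≤ ratOfCode b.2.2.2 := by
      rcases hzV'.2.1.eq_or_lt with h0 | h0
      · obtain ⟨y, hy, hy'⟩ := exists_ratOfCode_between
          (lt_min hb4 (show z 1 < 27 by rw [← h0]; norm_num))
        obtain ⟨hy1, hy2⟩ := lt_min_iff.1 hy'
        exact ⟨y, h0.trans_le hy.le, hy2.le, (hb3.trans hy).le, hy1.le⟩
      · obtain ⟨y, hy, hy'⟩ := exists_ratOfCode_between (max_lt hb3 h0)
        obtain ⟨hy1, hy2⟩ := max_lt_iff.1 hy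
        exact ⟨y, hy2.le, hy'.le.trans hzV'.2.2, hy1.le, (hy'.trans hb4).le⟩
    refine Or.inl ⟨rfl, x, y, ⟨hx0, (h.belowR_iff _).2 hxr, (h.belowR_iff _).2 ?_, ?_, ?_⟩,
      Rat.cast_le.1 hxb, Rat.cast_le.1 hxb', Rat.cast_le.1 hyb, Rat.cast_le.1 hyb'⟩
    · rw [ratOfCode_negCode, Rat.cast_neg]
      linarith
    · exact_mod_cast hy
    · exact_mod_cast hy'
  | succ n ih =>
    obtain ⟨w, hw, rfl⟩ := hz
    have hwV := innerIter_subset_V n hw.1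
    have hw0 : w 0 ≠ 0 := ((L.mem_VD).1 ⟨hwV, hw.2⟩).2
    obtain ⟨b₀, hb₀, hs⟩ : ∃ b₀, InBoxInterior b₀ w ∧ StepOff p b₀ b := by
      rcases hw0.lt_or_gt with h0 | h0
      · obtain ⟨b₀, h1, h2, h3⟩ := h.exists_stepLeft hwV h0 hb
        exact ⟨b₀, h1, Or.inr ⟨h2, h3⟩⟩
      · obtain ⟨b₀, h1, h2, h3⟩ := h.exists_stepRight hwV h0 hb
        exact ⟨b₀, h1, Or.inl ⟨h2, h3⟩⟩
    obtain ⟨l, hl, H⟩ := ih hw.1 hb₀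
    refine ⟨(n + 1, b) :: l, by simp, fun f hf => ?_⟩
    rcases List.mem_cons.1 hf with rfl | hf
    · exact Or.inr ⟨(n, b₀), ⟨List.mem_cons_of_mem _ hl, rfl⟩, hs⟩
    · exact (H f hf).mono (List.subset_cons_self _ _)

/-- Soundness and completeness of the certificates from inside. -/
theorem IsName.near_iff (h : L.IsName p) (z k : ℕ) :
    Near p z k ↔ ∃ a ∈ L.attractor, |a 0 - ratPointOfCode z 0| < (1 / 2) ^ k ∧
      |a 1 - ratPointOfCode z 1| < (1 / 2) ^ k := by
  have e0 : ratPointOfCode z 0 = ratOfCode z.unpair.1 := rfl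
  have e1 : ratPointOfCode z 1 = ratOfCode z.unpair.2 := rfl
  rw [e0, e1]
  constructor
  · rintro ⟨m, b, ⟨h1, h2, h3, h4⟩, hb⟩
    obtain ⟨w, hw, ⟨⟨hb1, hb2⟩, hb3, hb4⟩⟩ := h.exists_mem_of_reach hb
    obtain ⟨a, ha, ha0, ha1⟩ := L.exists_mem_attractor_near hw
    have h1 := (Rat.cast_lt (K := ℝ)).2 h1
    have h2 := (Rat.cast_lt (K := ℝ)).2 h2
    have h3 := (Rat.cast_lt (K := ℝ)).2 h3
    have h4 := (Rat.cast_lt (K := ℝ)).2 h4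
    push_cast at h1 h2 h3 h4
    have hm : (0 : ℝ) < (1 / 2) ^ m := by positivity
    obtain ⟨ha2, ha3⟩ := abs_le.1 ha1
    exact ⟨a, ha, abs_lt.2 ⟨by linarith, by linarith⟩, abs_lt.2 ⟨by linarith, by linarith⟩⟩
  · rintro ⟨a, ha, h0, h1⟩
    obtain ⟨ε, hε, hε0, hε1⟩ : ∃ ε > 0, |a 0 - ratOfCode z.unpair.1| + 2 * ε < (1 / 2) ^ k ∧
        |a 1 - ratOfCode z.unpair.2| + 2 * ε < (1 / 2) ^ k := by
      refine ⟨min ((1 / 2) ^ k - |a 0 - ratOfCode z.unpair.1|)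
        ((1 / 2) ^ k - |a 1 - ratOfCode z.unpair.2|) / 3, ?_, ?_, ?_⟩
      · have := lt_min (sub_pos.2 h0) (sub_pos.2 h1)
        linarith
      · have := min_le_left ((1 / 2) ^ k - |a 0 - (ratOfCode z.unpair.1 : ℝ)|)
          ((1 / 2) ^ k - |a 1 - ratOfCode z.unpair.2|)
        linarith
      · have := min_le_right ((1 / 2) ^ k - |a 0 - (ratOfCode z.unpair.1 : ℝ)|)
          ((1 / 2) ^ k - |a 1 - ratOfCode z.unpair.2|)
        linarith
    obtain ⟨m, hm⟩ := exists_half_pow_lt (show 0 < ε / 54 by positivity)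
    have ha' : a ∈ closure (L.innerIter (2 * m)) :=
      closure_minimal (L.iter_subset_closure_innerIter (2 * m)) isClosed_closure
        (mem_iInter.1 ha (2 * m))
    obtain ⟨w, hw, hwa⟩ := Metric.mem_closure_iff.1 ha' ε hε
    have hw0 := abs_lt.1 ((abs_apply_sub_le_dist a w 0).trans_lt hwa)
    have hw1 := abs_lt.1 ((abs_apply_sub_le_dist a w 1).trans_lt hwa)
    have ha0 := abs_le.1 (le_refl |a 0 - ratOfCode z.unpair.1|)
    have ha1 := abs_le.1 (le_refl |a 1 - ratOfCode z.unpair.2|)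
    obtain ⟨b, hb, hb1, hb2, hb3, hb4⟩ := exists_box (z := w)
      (show (ratOfCode z.unpair.1 : ℝ) - (1 / 2) ^ k + 54 * (1 / 2) ^ m < w 0 by linarith)
      (show w 0 < (ratOfCode z.unpair.1 : ℝ) + (1 / 2) ^ k - 54 * (1 / 2) ^ m by linarith)
      (show (ratOfCode z.unpair.2 : ℝ) - (1 / 2) ^ k + 54 * (1 / 2) ^ m < w 1 by linarith)
      (show w 1 < (ratOfCode z.unpair.2 : ℝ) + (1 / 2) ^ k - 54 * (1 / 2) ^ m by linarith)
    refine ⟨m, b, ⟨?_, ?_, ?_, ?_⟩, h.reach_of_mem hw hb⟩ <;>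
    · rw [← Rat.cast_lt (K := ℝ)]
      push_cast
      assumption

end LorenzReturnMap

/-! ### Exclusion of balls from the attractor -/

/-- A name `p` witnesses that the box `b` is disjoint from `V`. -/
def OutsideV (p : ℕ → ℕ) (b : Box) : Prop :=
  (AboveR p b.1 ∨ AboveR p (negCode b.2.1)) ∨ 27 < ratOfCode b.2.2.1 ∨ ratOfCode b.2.2.2 < -27

/-- The box `b` is disjoint from the open square about the ball with code `u`. -/
def DisjointBall (u : ℕ) (b : Box) : Prop :=
  (ratOfCode u.unpair.1.unpair.1 + ratOfCode u.unpair.2 ≤ ratOfCode b.1 ∨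
    ratOfCode b.2.1 ≤ ratOfCode u.unpair.1.unpair.1 - ratOfCode u.unpair.2) ∨
  (ratOfCode u.unpair.1.unpair.2 + ratOfCode u.unpair.2 ≤ ratOfCode b.2.2.1 ∨
    ratOfCode b.2.2.2 ≤ ratOfCode u.unpair.1.unpair.2 - ratOfCode u.unpair.2)

/-- The claim `f = (n, b)`, that no orbit from `b ∩ V` is in the ball `u` after `n` steps, is
justified by claims from `l`. -/
def AvoidJustified (p : ℕ → ℕ) (u : ℕ) (l : List (ℕ × Box)) (f : ℕ × Box) : Prop :=
  OutsideV p f.2 ∨ (f.1 = 0 ∧ DisjointBall u f.2) ∨ (0 < f.1 ∧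
    (ratOfCode f.2.2.1 ≤ 0 ∨ ∃ f', (f' ∈ l ∧ f'.1 + 1 = f.1) ∧ StepRight p f.2 f'.2) ∧
    (0 ≤ ratOfCode f.2.1 ∨ ∃ f', (f' ∈ l ∧ f'.1 + 1 = f.1) ∧ StepLeft p f.2 f'.2))

/-- The code of `i / (M + 1) - R`. -/
def gridCode (R M i : ℕ) : ℕ := Nat.pair (Nat.pair i (R * (M + 1))) M

/-- The cell `(i, j)` of a grid of cells of side `1 / (M + 1)` on the square `[-R, R]²` is contained
in the box with code `b`. -/
def CellSubset (R M i j : ℕ) (b : Box) : Prop :=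
  (ratOfCode b.1 ≤ ratOfCode (gridCode R M i) ∧
    ratOfCode (gridCode R M (i + 1)) ≤ ratOfCode b.2.1) ∧
  (ratOfCode b.2.2.1 ≤ ratOfCode (gridCode R M j) ∧
    ratOfCode (gridCode R M (j + 1)) ≤ ratOfCode b.2.2.2)

/-- A name `p` witnesses that the ball with code `u` is disjoint from the attractor: a list of
justified claims shows that `F^N(V ∖ D)` avoids the ball, as it contains claims `(N, b)` for boxes
`b` that cover a grid on a square `[-R, R]²` around `V`. -/
def Excluded (p : ℕ → ℕ) (u : ℕ) : Prop := ∃ (l : List (ℕ × Box)) (N R M : ℕ),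
  (AboveR p (Nat.pair (Nat.pair R 0) 0) ∧ 28 ≤ R) ∧ (∀ f ∈ l, AvoidJustified p u l f) ∧
    ∀ i ∈ List.range (2 * R * (M + 1)), ∀ j ∈ List.range (2 * R * (M + 1)),
      ∃ f, (f ∈ l ∧ f.1 = N) ∧ CellSubset R M i j f.2

theorem semi_outsideV : Semi OutsideV :=
  ((semi_aboveR.comp (f := fun b : Box => b.1) (by fun_prop)).or
    (semi_aboveR.comp (f := fun b : Box => negCode b.2.1) (by fun_prop))).or
  ((PrimrecRat.lt (by fun_prop) (by fun_prop)).or (PrimrecRat.lt (by fun_prop) (by fun_prop))).semi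

theorem primrecPred_disjointBall : PrimrecPred fun x : ℕ × Box => DisjointBall x.1 x.2 :=
  ((PrimrecRat.le (by fun_prop) (by fun_prop)).or (PrimrecRat.le (by fun_prop) (by fun_prop))).or
    ((PrimrecRat.le (by fun_prop) (by fun_prop)).or (PrimrecRat.le (by fun_prop) (by fun_prop)))

@[fun_prop] theorem primrec_gridCode {α : Type} [Primcodable α] {f g h : α → ℕ} (hf : Primrec f)
    (hg : Primrec g) (hh : Primrec h) : Primrec fun a => gridCode (f a) (g a) (h a) := by
  unfold gridCode
  fun_prop

theorem semi_avoidJustified :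
    Semi fun p (x : ℕ × List (ℕ × Box) × ℕ × Box) => AvoidJustified p x.1 x.2.1 x.2.2 := by
  have h1 : Semi (α := (ℕ × List (ℕ × Box) × ℕ × Box) × ℕ × Box) fun p x =>
      (x.2 ∈ x.1.2.1 ∧ x.2.1 + 1 = x.1.2.2.1) ∧ StepRight p x.1.2.2.2 x.2.2 :=
    ((primrecPred_mem_list (by fun_prop) (by fun_prop)).and
      (Primrec.eq.comp (by fun_prop) (by fun_prop))).semi.and
    (semi_stepRight.comp (f := fun x : (ℕ × List (ℕ × Box) × ℕ × Box) × ℕ × Box =>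
      (x.1.2.2.2, x.2.2)) (by fun_prop))
  have h2 : Semi (α := (ℕ × List (ℕ × Box) × ℕ × Box) × ℕ × Box) fun p x =>
      (x.2 ∈ x.1.2.1 ∧ x.2.1 + 1 = x.1.2.2.1) ∧ StepLeft p x.1.2.2.2 x.2.2 :=
    ((primrecPred_mem_list (by fun_prop) (by fun_prop)).and
      (Primrec.eq.comp (by fun_prop) (by fun_prop))).semi.and
    (semi_stepLeft.comp (f := fun x : (ℕ × List (ℕ × Box) × ℕ × Box) × ℕ × Box =>
      (x.1.2.2.2, x.2.2)) (by fun_prop))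
  exact (semi_outsideV.comp (f := fun x : ℕ × List (ℕ × Box) × ℕ × Box => x.2.2.2)
    (by fun_prop)).or
    (((Primrec.eq.comp (f := fun x : ℕ × List (ℕ × Box) × ℕ × Box => x.2.2.1) (g := fun _ => 0)
      (by fun_prop) (by fun_prop)).and (primrecPred_disjointBall.comp
        (f := fun x : ℕ × List (ℕ × Box) × ℕ × Box => (x.1, x.2.2.2)) (by fun_prop))).semi.or
    ((Primrec.nat_lt.comp (f := fun _ : ℕ × List (ℕ × Box) × ℕ × Box => 0) (g := fun x => x.2.2.1)
      (by fun_prop) (by fun_prop)).semi.and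
      (((PrimrecRat.le (by fun_prop) (by fun_prop)).semi.or h1.ex).and
        ((PrimrecRat.le (by fun_prop) (by fun_prop)).semi.or h2.ex))))

theorem semi_excluded : Semi Excluded := by
  have h1 : Semi (α := ((((((ℕ × List (ℕ × Box)) × ℕ) × ℕ) × ℕ) × ℕ) × ℕ) × ℕ × Box) fun _ x =>
      (x.2 ∈ x.1.1.1.1.1.1.2 ∧ x.2.1 = x.1.1.1.1.1.2) ∧
        CellSubset x.1.1.1.1.2 x.1.1.1.2 x.1.1.2 x.1.2 x.2.2 :=
    (((primrecPred_mem_list (by fun_prop) (by fun_prop)).and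
      (Primrec.eq.comp (by fun_prop) (by fun_prop))).and
    (((PrimrecRat.le (by fun_prop) (by fun_prop)).and
        (PrimrecRat.le (by fun_prop) (by fun_prop))).and
      ((PrimrecRat.le (by fun_prop) (by fun_prop)).and
        (PrimrecRat.le (by fun_prop) (by fun_prop))))).semi
  have h2 : Semi (α := (((ℕ × List (ℕ × Box)) × ℕ) × ℕ) × ℕ) fun _ x =>
      ∀ i ∈ List.range (2 * x.1.2 * (x.2 + 1)), ∀ j ∈ List.range (2 * x.1.2 * (x.2 + 1)),
        ∃ f, (f ∈ x.1.1.1.2 ∧ f.1 = x.1.1.2) ∧ CellSubset x.1.2 x.2 i j f.2 :=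
    (h1.ex.forall_mem (l := fun x : ((((ℕ × List (ℕ × Box)) × ℕ) × ℕ) × ℕ) × ℕ =>
      List.range (2 * x.1.1.2 * (x.1.2 + 1))) (Primrec.list_range.comp (by fun_prop))).forall_mem
        (l := fun x : (((ℕ × List (ℕ × Box)) × ℕ) × ℕ) × ℕ =>
          List.range (2 * x.1.2 * (x.2 + 1))) (Primrec.list_range.comp (by fun_prop))
  have h3 : Semi (α := ((((ℕ × List (ℕ × Box)) × ℕ) × ℕ) × ℕ) × ℕ × Box) fun p x =>
      AvoidJustified p x.1.1.1.1.1 x.1.1.1.1.2 x.2 :=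
    semi_avoidJustified.comp (f := fun x : ((((ℕ × List (ℕ × Box)) × ℕ) × ℕ) × ℕ) × ℕ × Box =>
      (x.1.1.1.1.1, x.1.1.1.1.2, x.2)) (by fun_prop)
  have h4 := (((semi_aboveR.comp (f := fun x : (((ℕ × List (ℕ × Box)) × ℕ) × ℕ) × ℕ =>
    Nat.pair (Nat.pair x.1.2 0) 0) (by fun_prop)).and (Primrec.nat_le.comp
      (f := fun _ : (((ℕ × List (ℕ × Box)) × ℕ) × ℕ) × ℕ => 28) (g := fun x => x.1.2) (by fun_prop)
        (by fun_prop)).semi).and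
    ((h3.forall_mem (l := fun x : (((ℕ × List (ℕ × Box)) × ℕ) × ℕ) × ℕ => x.1.1.1.2)
      (by fun_prop)).and h2))
  exact h4.ex.ex.ex.ex

namespace LorenzReturnMap

variable {L : LorenzReturnMap} {p : ℕ → ℕ}

/-- The orbit of `z` under `F` avoids `D` for `n` steps and arrives at `w`. -/
def OrbitTo (L : LorenzReturnMap) : ℕ → Plane → Plane → Prop
  | 0, z, w => w = z
  | n + 1, z, w => z 0 ≠ 0 ∧ L.OrbitTo n (L.F z) w

theorem OrbitTo.succ {n : ℕ} {z w : Plane} (h : L.OrbitTo n z w) (h0 : w 0 ≠ 0) :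
    L.OrbitTo (n + 1) z (L.F w) := by
  induction n generalizing z with
  | zero =>
    obtain rfl : w = z := h
    exact ⟨h0, rfl⟩
  | succ n ih => exact ⟨h.1, ih h.2⟩

theorem exists_orbitTo {n : ℕ} {w : Plane} (hw : w ∈ L.iter n) : ∃ z ∈ L.V, L.OrbitTo n z w := by
  induction n generalizing w with
  | zero => exact ⟨w, hw.1, rfl⟩
  | succ n ih =>
    obtain ⟨u, hu, rfl⟩ := hw
    obtain ⟨z, hz, hzu⟩ := ih hu.1
    exact ⟨z, hz, hzu.succ ((L.mem_VD).1 ⟨L.iter_subset_V n hu.1, hu.2⟩).2⟩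

theorem IsName.outsideV_iff (h : L.IsName p) (b : Box) :
    OutsideV p b ↔ (L.r < ratOfCode b.1 ∨ (ratOfCode b.2.1 : ℝ) < -L.r) ∨
      (27 : ℝ) < ratOfCode b.2.2.1 ∨ (ratOfCode b.2.2.2 : ℝ) < -27 := by
  rw [OutsideV, h.aboveR_iff, h.aboveR_iff, ratOfCode_negCode, Rat.cast_neg, lt_neg]
  refine or_congr Iff.rfl (or_congr ?_ ?_)
  · rw [← Rat.cast_lt (K := ℝ)]
    norm_num
  · rw [← Rat.cast_lt (K := ℝ)]
    norm_num

/-- Soundness of lists of justified claims, by induction along the orbit. -/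
theorem IsName.notMem_ball_of_avoidJustified (h : L.IsName p) {u : ℕ} {l : List (ℕ × Box)}
    (hl : ∀ f ∈ l, AvoidJustified p u l f) {n : ℕ} {b : Box} (hb : (n, b) ∈ l) {z w : Plane}
    (hz : z ∈ L.V) (hzb : InBox b z) (hw : L.OrbitTo n z w) :
    w ∉ Metric.ball (ratPointOfCode u.unpair.1) (ratOfCode u.unpair.2 : ℝ) := by
  induction n generalizing b z with
  | zero =>
    obtain rfl : w = z := hw
    intro hwu
    have hz' := (L.mem_V).1 hz
    obtain ⟨⟨hb1, hb2⟩, hb3, hb4⟩ := hzb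
    rcases hl _ hb with H | ⟨-, H⟩ | ⟨H, -⟩
    · rw [h.outsideV_iff] at H
      dsimp only at H
      rcases H with (H | H) | H | H <;> linarith [hz'.1.1, hz'.1.2, hz'.2.1, hz'.2.2]
    · have h0 := abs_lt.1 ((abs_apply_sub_le_dist _ _ 0).trans_lt (Metric.mem_ball.1 hwu))
      have h1 := abs_lt.1 ((abs_apply_sub_le_dist _ _ 1).trans_lt (Metric.mem_ball.1 hwu))
      have e0 : ratPointOfCode u.unpair.1 0 = ratOfCode u.unpair.1.unpair.1 := rfl
      have e1 : ratPointOfCode u.unpair.1 1 = ratOfCode u.unpair.1.unpair.2 := rfl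
      rw [e0] at h0
      rw [e1] at h1
      rcases H with (H | H) | H | H <;>
      · have H := (Rat.cast_le (K := ℝ)).2 H
        push_cast at H
        linarith [h0.1, h0.2, h1.1, h1.2]
    · exact absurd H (lt_irrefl 0)
  | succ n ih =>
    obtain ⟨hz0, hw⟩ := hw
    have hz' := (L.mem_V).1 hz
    rcases hl _ hb with H | ⟨H, -⟩ | ⟨-, H1, H2⟩
    · obtain ⟨⟨hb1, hb2⟩, hb3, hb4⟩ := hzb
      rw [h.outsideV_iff] at H
      dsimp only at H
      rcases H with (H | H) | H | H <;> linarith [hz'.1.1, hz'.1.2, hz'.2.1, hz'.2.2]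
    · exact absurd H (by simp)
    · rcases hz0.lt_or_gt with h0 | h0
      · rcases H2 with H2 | ⟨⟨n', b'⟩, ⟨hf, hn⟩, hs⟩
        · exact absurd ((Rat.cast_nonneg (K := ℝ)).2 H2) (not_le.2 (hzb.1.1.trans_lt h0))
        · obtain rfl : n' = n := by simpa using hn
          exact ih hf (L.F_mem_V hz hz0) (h.inBox_of_stepLeft hs hz h0 hzb) hw
      · rcases H1 with H1 | ⟨⟨n', b'⟩, ⟨hf, hn⟩, hs⟩
        · exact absurd ((Rat.cast_nonpos (K := ℝ)).2 H1) (not_le.2 (h0.trans_le hzb.1.2))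
        · obtain rfl : n' = n := by simpa using hn
          exact ih hf (L.F_mem_V hz hz0) (h.inBox_of_stepRight hs hz h0 hzb) hw

theorem ratOfCode_gridCode (R M i : ℕ) :
    ((ratOfCode (gridCode R M i) : ℚ) : ℝ) = i / (M + 1) - R := by
  rw [gridCode, ratOfCode_pair]
  push_cast
  field_simp

/-- Every point of `[-R, R)` lies in a cell of the grid. -/
theorem exists_gridCode_le {R : ℕ} (M : ℕ) {x : ℝ} (h1 : -R ≤ x) (h2 : x < R) :
    ∃ i ∈ List.range (2 * R * (M + 1)), (ratOfCode (gridCode R M i) : ℝ) ≤ x ∧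
      x ≤ ratOfCode (gridCode R M (i + 1)) := by
  have hM : (0 : ℝ) < M + 1 := by positivity
  have h0 : 0 ≤ (x + R) * (M + 1) := mul_nonneg (by linarith) hM.le
  refine ⟨⌊(x + R) * (M + 1)⌋₊, ?_, ?_, ?_⟩
  · rw [List.mem_range, Nat.floor_lt h0]
    push_cast
    exact mul_lt_mul_of_pos_right (by linarith) hM
  · rw [ratOfCode_gridCode, sub_le_iff_le_add, div_le_iff₀ hM]
    exact Nat.floor_le h0
  · rw [ratOfCode_gridCode, le_sub_iff_add_le, le_div_iff₀ hM]
    push_cast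
    exact (Nat.lt_floor_add_one _).le

theorem IsName.disjoint_of_excluded (h : L.IsName p) {u : ℕ} (hu : Excluded p u) :
    Disjoint (Metric.ball (ratPointOfCode u.unpair.1) (ratOfCode u.unpair.2 : ℝ))
      (L.attractor : Set Plane) := by
  obtain ⟨l, N, R, M, ⟨hR, hR28⟩, hl, hcell⟩ := hu
  rw [h.aboveR_iff, ratOfCode_pair] at hR
  have hR : L.r < R := by simpa using hR
  have hR28 : (28 : ℝ) ≤ R := by exact_mod_cast hR28
  have hiter : Disjoint (Metric.ball (ratPointOfCode u.unpair.1) (ratOfCode u.unpair.2 : ℝ))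
      (L.iter N) := by
    refine Set.disjoint_right.2 fun w hw => ?_
    obtain ⟨z, hz, hzw⟩ := exists_orbitTo hw
    have hz' := (L.mem_V).1 hz
    obtain ⟨i, hi, hi1, hi2⟩ := exists_gridCode_le (R := R) M (x := z 0) (by linarith [hz'.1.1])
      (by linarith [hz'.1.2])
    obtain ⟨j, hj, hj1, hj2⟩ := exists_gridCode_le (R := R) M (x := z 1) (by linarith [hz'.2.1])
      (by linarith [hz'.2.2])
    obtain ⟨⟨n, b⟩, ⟨hf, rfl⟩, ⟨hb1, hb2⟩, hb3, hb4⟩ := hcell i hi j hj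
    exact h.notMem_ball_of_avoidJustified hl hf hz
      ⟨⟨(Rat.cast_le.2 hb1).trans hi1, hi2.trans (Rat.cast_le.2 hb2)⟩,
        (Rat.cast_le.2 hb3).trans hj1, hj2.trans (Rat.cast_le.2 hb4)⟩ hzw
  exact (hiter.closure_right Metric.isOpen_ball).mono_right
    (iInter_subset (fun n => closure (L.iter n)) N)

theorem _root_.AvoidJustified.mono {u : ℕ} {l l' : List (ℕ × Box)} {f : ℕ × Box}
    (h : AvoidJustified p u l f) (hl : l ⊆ l') : AvoidJustified p u l' f := by
  rcases h with h | h | ⟨h0, h1, h2⟩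
  · exact Or.inl h
  · exact Or.inr (Or.inl h)
  · refine Or.inr (Or.inr ⟨h0, h1.imp id ?_, h2.imp id ?_⟩) <;>
    · rintro ⟨f', ⟨h3, h4⟩, h5⟩
      exact ⟨f', ⟨hl h3, h4⟩, h5⟩

/-- If `z` lies in the closure of `Fʲ(V ∖ D)`, and the closure of `Fʲ⁺ⁿ(V ∖ D)` avoids the closed
square about the ball `u`, then a list of justified claims shows this for a neighbourhood of `z`.
The two claims needed at a point of `D` are about `ρ⁺` and `-ρ⁺`. -/
theorem IsName.exists_avoidJustified (h : L.IsName p) {u N : ℕ}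
    (hu : ∀ w ∈ closure (L.iter N),
      (ratOfCode u.unpair.2 : ℝ) < |w 0 - ratPointOfCode u.unpair.1 0| ∨
      (ratOfCode u.unpair.2 : ℝ) < |w 1 - ratPointOfCode u.unpair.1 1|)
    {n j : ℕ} (hn : j + n = N) {z : Plane} (hz : z ∈ closure (L.iter j)) :
    ∃ (l : List (ℕ × Box)) (b : Box), (∀ f ∈ l, AvoidJustified p u l f) ∧ (n, b) ∈ l ∧
      InBoxInterior b z := by
  induction n generalizing j z with
  | zero =>
    obtain rfl : j = N := hn
    have e0 : ratPointOfCode u.unpair.1 0 = ratOfCode u.unpair.1.unpair.1 := rfl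
    have e1 : ratPointOfCode u.unpair.1 1 = ratOfCode u.unpair.1.unpair.2 := rfl
    obtain ⟨b, hb, hub⟩ : ∃ b, InBoxInterior b z ∧ DisjointBall u b := by
      have hl0 := sub_one_lt (z 0)
      have hl1 := sub_one_lt (z 1)
      have hg0 := lt_add_one (z 0)
      have hg1 := lt_add_one (z 1)
      rcases hu z hz with H | H
      · rw [e0] at H
        rcases lt_abs.1 H with H | H
        · obtain ⟨b, hb, h1, -⟩ := exists_box (lt_sub_iff_add_lt'.1 H) hg0 hl1 hg1
          refine ⟨b, hb, Or.inl (Or.inl ?_)⟩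
          exact_mod_cast h1.le
        · obtain ⟨b, hb, -, h1, -⟩ := exists_box hl0 (show z 0 < ratOfCode u.unpair.1.unpair.1 -
            ratOfCode u.unpair.2 by linarith) hl1 hg1
          refine ⟨b, hb, Or.inl (Or.inr ?_)⟩
          exact (Rat.cast_lt (K := ℝ).1 (by rw [Rat.cast_sub]; exact h1)).le
      · rw [e1] at H
        rcases lt_abs.1 H with H | H
        · obtain ⟨b, hb, -, -, h1, -⟩ := exists_box hl0 hg0 (lt_sub_iff_add_lt'.1 H) hg1
          refine ⟨b, hb, Or.inr (Or.inl ?_)⟩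
          exact_mod_cast h1.le
        · obtain ⟨b, hb, -, -, -, h1⟩ := exists_box hl0 hg0 hl1 (show z 1 <
            ratOfCode u.unpair.1.unpair.2 - ratOfCode u.unpair.2 by linarith)
          refine ⟨b, hb, Or.inr (Or.inr ?_)⟩
          exact (Rat.cast_lt (K := ℝ).1 (by rw [Rat.cast_sub]; exact h1)).le
    refine ⟨[(0, b)], b, fun f hf => ?_, by simp, hb⟩
    obtain rfl : f = (0, b) := by simpa using hf
    exact Or.inr (Or.inl ⟨rfl, hub⟩)
  | succ n ih =>
    have hzV := L.closure_iter_subset_V j hz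
    have hn' : j + 1 + n = N := by omega
    rcases lt_trichotomy (z 0) 0 with h0 | h0 | h0
    · obtain ⟨l, b', hl, hb', hF⟩ := ih hn' (L.F_mem_closure_iter hz h0.ne)
      obtain ⟨b, hb, hb0, hs⟩ := h.exists_stepLeft hzV h0 hF
      refine ⟨(n + 1, b) :: l, b, fun f hf => ?_, by simp, hb⟩
      rcases List.mem_cons.1 hf with rfl | hf
      · exact Or.inr (Or.inr ⟨Nat.succ_pos n, Or.inl hb0.le,
          Or.inr ⟨(n, b'), ⟨List.mem_cons_of_mem _ hb', rfl⟩, hs⟩⟩)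
      · exact (hl f hf).mono (List.subset_cons_self _ _)
    · obtain ⟨l, b', hl, hb', hF⟩ := ih hn' (L.ρplus_mem_closure_iter j)
      obtain ⟨l', b'', hl', hb'', hF'⟩ :=
        ih hn' (L.neg_mem_closure_iter (L.ρplus_mem_closure_iter j))
      obtain ⟨x, hx, hs⟩ := h.exists_stepRight_zero hF
      obtain ⟨x', hx', hs'⟩ := h.exists_stepRight_zero (inBoxInterior_negBox.2 hF')
      obtain ⟨b, hb, h1, h2, -⟩ := exists_box (z := z) (x₁ := -ratOfCode x') (x₂ := ratOfCode x)
        (by rw [h0]; exact neg_neg_of_pos (Rat.cast_pos.2 hx')) (by rw [h0]; exact Rat.cast_pos.2 hx)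
        (sub_one_lt _) (lt_add_one _)
      have h1' : -ratOfCode b.1 ≤ ratOfCode x' := by
        have : -ratOfCode x' < ratOfCode b.1 := by exact_mod_cast h1
        linarith
      refine ⟨(n + 1, b) :: (l ++ l'), b, fun f hf => ?_, by simp, hb⟩
      rcases List.mem_cons.1 hf with rfl | hf
      · exact Or.inr (Or.inr ⟨Nat.succ_pos n,
          Or.inr ⟨(n, b'), ⟨List.mem_cons_of_mem _ (List.mem_append_left _ hb'), rfl⟩,
            hs b (Rat.cast_lt.1 h2).le⟩,
          Or.inr ⟨(n, b''), ⟨List.mem_cons_of_mem _ (List.mem_append_right _ hb''), rfl⟩,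
            hs' (negBox b) (by simpa [negBox] using h1')⟩⟩)
      · rcases List.mem_append.1 hf with hf | hf
        · exact (hl f hf).mono fun _ hg => List.mem_cons_of_mem _ (List.mem_append_left _ hg)
        · exact (hl' f hf).mono fun _ hg => List.mem_cons_of_mem _ (List.mem_append_right _ hg)
    · obtain ⟨l, b', hl, hb', hF⟩ := ih hn' (L.F_mem_closure_iter hz h0.ne')
      obtain ⟨b, hb, hb0, hs⟩ := h.exists_stepRight hzV h0 hF
      refine ⟨(n + 1, b) :: l, b, fun f hf => ?_, by simp, hb⟩
      rcases List.mem_cons.1 hf with rfl | hf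
      · exact Or.inr (Or.inr ⟨Nat.succ_pos n,
          Or.inr ⟨(n, b'), ⟨List.mem_cons_of_mem _ hb', rfl⟩, hs⟩, Or.inl hb0.le⟩)
      · exact (hl f hf).mono (List.subset_cons_self _ _)

theorem IsName.exists_outsideV (h : L.IsName p) {z : Plane} (hz : z ∉ L.V) :
    ∃ b, OutsideV p b ∧ InBoxInterior b z := by
  have hl0 := sub_one_lt (z 0)
  have hl1 := sub_one_lt (z 1)
  have hg0 := lt_add_one (z 0)
  have hg1 := lt_add_one (z 1)
  simp only [h.outsideV_iff]
  rw [mem_V, not_and_or, not_and_or, not_and_or] at hz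
  simp only [not_le] at hz
  rcases hz with (hz | hz) | hz | hz
  · obtain ⟨b, hb, -, h1, -⟩ := exists_box hl0 hz hl1 hg1
    exact ⟨b, Or.inl (Or.inr h1), hb⟩
  · obtain ⟨b, hb, h1, -⟩ := exists_box hz hg0 hl1 hg1
    exact ⟨b, Or.inl (Or.inl h1), hb⟩
  · obtain ⟨b, hb, -, -, -, h1⟩ := exists_box hl0 hg0 hl1 hz
    exact ⟨b, Or.inr (Or.inr h1), hb⟩
  · obtain ⟨b, hb, -, -, h1, -⟩ := exists_box hl0 hg0 hz hg1
    exact ⟨b, Or.inr (Or.inl h1), hb⟩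

/-- Completeness of the certificates: by compactness finitely many neighbourhoods with justified
claims suffice, and a fine grid is subordinate to them. -/
theorem IsName.excluded_of_forall (h : L.IsName p) {u N : ℕ}
    (hu : ∀ w ∈ closure (L.iter N),
      (ratOfCode u.unpair.2 : ℝ) < |w 0 - ratPointOfCode u.unpair.1 0| ∨
      (ratOfCode u.unpair.2 : ℝ) < |w 1 - ratPointOfCode u.unpair.1 1|) : Excluded p u := by
  have hex : ∀ z : Plane, ∃ (l : List (ℕ × Box)) (b : Box),
      (∀ f ∈ l, AvoidJustified p u l f) ∧ (N, b) ∈ l ∧ InBoxInterior b z := by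
    intro z
    by_cases hz : z ∈ L.V
    · exact h.exists_avoidJustified hu (Nat.zero_add N) (L.closure_iter_zero.ge hz)
    · obtain ⟨b, hb, hbz⟩ := h.exists_outsideV hz
      refine ⟨[(N, b)], b, fun f hf => ?_, by simp, hbz⟩
      obtain rfl : f = (N, b) := by simpa using hf
      exact Or.inl hb
  choose l b hl hb hbz using hex
  obtain ⟨R, hR⟩ := exists_nat_gt (max L.r 28)
  obtain ⟨hRr, hR28⟩ := max_lt_iff.1 hR
  obtain ⟨δ, hδ, hδS⟩ := lebesgue_number_lemma_of_metric
    (isCompact_planeRect (-R) R (-R) R) (fun z => isOpen_inBoxInterior (b z))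
    fun z _ => mem_iUnion.2 ⟨z, hbz z⟩
  obtain ⟨M, hM⟩ := exists_nat_one_div_lt (half_pos hδ)
  have hM0 : (0 : ℝ) < M + 1 := by positivity
  have hgrid : ∀ i < 2 * R * (M + 1), (ratOfCode (gridCode R M i) : ℝ) ∈ Icc (-(R : ℝ)) R := by
    intro i hi
    have hi' : (i : ℝ) ≤ 2 * R * (M + 1) := by exact_mod_cast hi.le
    rw [ratOfCode_gridCode]
    have : (i : ℝ) / (M + 1) ≤ 2 * R := (div_le_iff₀ hM0).2 hi'
    have : 0 ≤ (i : ℝ) / (M + 1) := by positivity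
    constructor <;> linarith
  have hcell : ∀ i j : ℕ, ∃ z : Plane, i < 2 * R * (M + 1) → j < 2 * R * (M + 1) →
      CellSubset R M i j (b z) := by
    intro i j
    by_cases hij : i < 2 * R * (M + 1) ∧ j < 2 * R * (M + 1)
    · obtain ⟨z, hz⟩ := hδS !₂[(ratOfCode (gridCode R M i) : ℝ), (ratOfCode (gridCode R M j) : ℝ)]
        ⟨hgrid i hij.1, hgrid j hij.2⟩
      refine ⟨z, fun _ _ => ?_⟩
      have h1 := hz (Metric.mem_ball_self hδ)
      have h2 : (!₂[(ratOfCode (gridCode R M (i + 1)) : ℝ),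
          (ratOfCode (gridCode R M (j + 1)) : ℝ)] : Plane) ∈ {w | InBoxInterior (b z) w} := by
        refine hz (Metric.mem_ball.2 ((dist_le_abs_add_abs _ _).trans_lt ?_))
        have hstep : ∀ k : ℕ, (ratOfCode (gridCode R M (k + 1)) : ℝ) -
            ratOfCode (gridCode R M k) = 1 / (M + 1) := by
          intro k
          rw [ratOfCode_gridCode, ratOfCode_gridCode]
          push_cast
          ring
        have hpos : (0 : ℝ) < 1 / (M + 1) := by positivity
        simp only [Matrix.cons_val_zero, Matrix.cons_val_one]
        rw [hstep, hstep, abs_of_pos hpos]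
        linarith
      exact ⟨⟨(Rat.cast_lt.1 h1.1.1).le, (Rat.cast_lt.1 h2.1.2).le⟩,
        (Rat.cast_lt.1 h1.2.1).le, (Rat.cast_lt.1 h2.2.2).le⟩
    · exact ⟨0, fun h1 h2 => absurd ⟨h1, h2⟩ hij⟩
  choose c hc using hcell
  have hsub : ∀ i ∈ List.range (2 * R * (M + 1)), ∀ j ∈ List.range (2 * R * (M + 1)),
      l (c i j) ⊆ (List.range (2 * R * (M + 1))).flatMap fun i =>
        (List.range (2 * R * (M + 1))).flatMap fun j => l (c i j) :=
    fun i hi j hj _ hf => List.mem_flatMap.2 ⟨i, hi, List.mem_flatMap.2 ⟨j, hj, hf⟩⟩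
  refine ⟨(List.range (2 * R * (M + 1))).flatMap fun i =>
    (List.range (2 * R * (M + 1))).flatMap fun j => l (c i j), N, R, M,
    ⟨(h.aboveR_iff _).2 ?_, by exact_mod_cast hR28.le⟩, fun f hf => ?_, fun i hi j hj => ?_⟩
  · rw [ratOfCode_pair]
    simpa using hRr
  · obtain ⟨i, hi, hf⟩ := List.mem_flatMap.1 hf
    obtain ⟨j, hj, hf⟩ := List.mem_flatMap.1 hf
    exact (hl _ f hf).mono (hsub i hi j hj)
  · exact ⟨(N, b (c i j)), ⟨hsub i hi j hj (hb _), rfl⟩,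
      hc i j (List.mem_range.1 hi) (List.mem_range.1 hj)⟩

theorem IsName.exists_excluded (h : L.IsName p) {z : Plane} (hz : z ∉ L.attractor) :
    ∃ u, Excluded p u ∧ z ∈ Metric.ball (ratPointOfCode u.unpair.1) (ratOfCode u.unpair.2 : ℝ) := by
  have hz' : ∃ N, z ∉ closure (L.iter N) := by
    by_contra! H
    exact hz (mem_iInter.2 H)
  obtain ⟨N, hN⟩ := hz'
  obtain ⟨ε, hε, hball⟩ := Metric.isOpen_iff.1 isClosed_closure.isOpen_compl z hN
  obtain ⟨ρ, hρ, hρ'⟩ := exists_ratOfCode_between (show 0 < ε / 4 by positivity)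
  obtain ⟨x, hx, hx'⟩ := exists_ratOfCode_between (lt_add_of_pos_right (z 0) (half_pos hρ))
  obtain ⟨y, hy, hy'⟩ := exists_ratOfCode_between (lt_add_of_pos_right (z 1) (half_pos hρ))
  have e0 : ratPointOfCode (Nat.pair x y) 0 = ratOfCode x := by simp [ratPointOfCode]
  have e1 : ratPointOfCode (Nat.pair x y) 1 = ratOfCode y := by simp [ratPointOfCode]
  have hx0 : |z 0 - ratOfCode x| < ratOfCode ρ / 2 := abs_lt.2 ⟨by linarith, by linarith⟩
  have hy0 : |z 1 - ratOfCode y| < ratOfCode ρ / 2 := abs_lt.2 ⟨by linarith, by linarith⟩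
  refine ⟨Nat.pair (Nat.pair x y) ρ, h.excluded_of_forall (N := N) fun w hw => ?_, ?_⟩
  · rw [Nat.unpair_pair, e0, e1]
    by_contra! H
    have h0 := abs_le.1 H.1
    have h1 := abs_le.1 H.2
    refine hball (Metric.mem_ball.2 ((dist_le_abs_add_abs w z).trans_lt ?_)) hw
    have h2 : |w 0 - z 0| < ε / 2 := abs_lt.2 ⟨by linarith [h0.1], by linarith [h0.2]⟩
    have h3 : |w 1 - z 1| < ε / 2 := abs_lt.2 ⟨by linarith [h1.1], by linarith [h1.2]⟩
    linarith
  · rw [Nat.unpair_pair]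
    refine Metric.mem_ball.2 ((dist_le_abs_add_abs _ _).trans_lt ?_)
    rw [e0, e1]
    linarith

end LorenzReturnMap

/-! ### The oracle machine -/

/-- The rational points with codes `z` and `z'` differ by less than `2⁻ᵏ` in both coordinates. -/
def CloseCodes (z z' k : ℕ) : Prop :=
  (ratOfCode z.unpair.1 < ratOfCode z'.unpair.1 + (1 / 2) ^ k ∧
    ratOfCode z'.unpair.1 < ratOfCode z.unpair.1 + (1 / 2) ^ k) ∧
  (ratOfCode z.unpair.2 < ratOfCode z'.unpair.2 + (1 / 2) ^ k ∧
    ratOfCode z'.unpair.2 < ratOfCode z.unpair.2 + (1 / 2) ^ k)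

theorem closeCodes_iff {z z' k : ℕ} : CloseCodes z z' k ↔
    |ratPointOfCode z 0 - ratPointOfCode z' 0| < (1 / 2) ^ k ∧
      |ratPointOfCode z 1 - ratPointOfCode z' 1| < (1 / 2) ^ k := by
  have e0 : ∀ z, ratPointOfCode z 0 = ratOfCode z.unpair.1 := fun _ => rfl
  have e1 : ∀ z, ratPointOfCode z 1 = ratOfCode z.unpair.2 := fun _ => rfl
  rw [CloseCodes, e0, e0, e1, e1]
  simp only [← Rat.cast_lt (K := ℝ)]
  push_cast
  rw [abs_lt, abs_lt]
  constructor <;> rintro ⟨⟨h1, h2⟩, h3, h4⟩ <;> refine ⟨⟨?_, ?_⟩, ?_, ?_⟩ <;> linarith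

theorem exists_ratPoint_close (a : Plane) {ε : ℝ} (hε : 0 < ε) :
    ∃ z, |a 0 - ratPointOfCode z 0| < ε ∧ |a 1 - ratPointOfCode z 1| < ε := by
  obtain ⟨x, hx, hx'⟩ := exists_ratOfCode_between (lt_add_of_pos_right (a 0) hε)
  obtain ⟨y, hy, hy'⟩ := exists_ratOfCode_between (lt_add_of_pos_right (a 1) hε)
  refine ⟨Nat.pair x y, ?_, ?_⟩
  · rw [show ratPointOfCode (Nat.pair x y) 0 = ratOfCode x by simp [ratPointOfCode], abs_lt]
    constructor <;> linarith
  · rw [show ratPointOfCode (Nat.pair x y) 1 = ratOfCode y by simp [ratPointOfCode], abs_lt]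
    constructor <;> linarith

namespace LorenzReturnMap

variable {L : LorenzReturnMap} {p : ℕ → ℕ}

theorem IsName.exists_near_of_mem (h : L.IsName p) {a : Plane} (ha : a ∈ L.attractor) (k : ℕ)
    {ε : ℝ} (hε : 0 < ε) : ∃ z, Near p z k ∧ |a 0 - ratPointOfCode z 0| < ε ∧
      |a 1 - ratPointOfCode z 1| < ε := by
  obtain ⟨z, h0, h1⟩ := exists_ratPoint_close a (lt_min hε (by positivity : (0 : ℝ) < (1 / 2) ^ k))
  rw [lt_min_iff] at h0 h1
  exact ⟨z, (h.near_iff z k).2 ⟨a, ha, h0.2, h1.2⟩, h0.1, h1.1⟩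

theorem IsName.exists_near_succ (h : L.IsName p) {z k : ℕ} (hz : Near p z k) :
    ∃ z', Near p z' (k + 1) ∧ CloseCodes z z' k := by
  obtain ⟨a, ha, h0, h1⟩ := (h.near_iff z k).1 hz
  obtain ⟨z', hz', h2, h3⟩ := h.exists_near_of_mem ha (k + 1) (lt_min (sub_pos.2 h0) (sub_pos.2 h1))
  rw [lt_min_iff] at h2 h3
  refine ⟨z', hz', closeCodes_iff.2 ⟨?_, ?_⟩⟩
  · have := abs_sub_le (ratPointOfCode z 0) (a 0) (ratPointOfCode z' 0)
    rw [abs_sub_comm (ratPointOfCode z 0) (a 0)] at this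
    linarith [h2.1]
  · have := abs_sub_le (ratPointOfCode z 1) (a 1) (ratPointOfCode z' 1)
    rw [abs_sub_comm (ratPointOfCode z 1) (a 1)] at this
    linarith [h3.2]

theorem attractor_nonempty (L : LorenzReturnMap) : ∃ a, a ∈ L.attractor := by
  have hr := L.zero_lt_r
  obtain ⟨z, hz, -⟩ := L.exists_mem_innerIter (2 * 0) (x := L.r / 2) (by positivity)
    (by rw [abs_of_pos (by positivity)]; linarith)
  obtain ⟨a, ha, -⟩ := L.exists_mem_attractor_near hz
  exact ⟨a, ha⟩

theorem exists_notMem_attractor (L : LorenzReturnMap) : ∃ a, a ∉ L.attractor := by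
  refine ⟨!₂[L.r + 1, 0], fun h => ?_⟩
  have := ((L.mem_V).1 (L.closure_iter_subset_V 0 (mem_iInter.1 h 0))).1.2
  simp only [Matrix.cons_val_zero] at this
  linarith

/-- A single oracle program refines an approximation of a point of the attractor, given with its
precision by `e`, to a rapidly converging sequence of such approximations. -/
theorem exists_refine : ∃ c : OracleCode, ∀ (p : ℕ → ℕ) (L : LorenzReturnMap), L.IsName p →
    ∀ e : ℕ, Near p e.unpair.1 e.unpair.2 → ∃ h : ℕ → ℕ, h 0 = e.unpair.1 ∧
      (∀ i, Near p (h i) (e.unpair.2 + i)) ∧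
      (∀ i, CloseCodes (h i) (h (i + 1)) (e.unpair.2 + i)) ∧
      ∀ i, c.eval p (Nat.pair e i) = Part.some (h i) := by
  have hS : Semi fun p (x : ℕ × ℕ) =>
      Near p x.2 (x.1.unpair.2 + 1) ∧ CloseCodes x.1.unpair.1 x.2 x.1.unpair.2 :=
    (semi_near.comp (f := fun x : ℕ × ℕ => (x.2, x.1.unpair.2 + 1)) (by fun_prop)).and
      (((PrimrecRat.lt (by fun_prop) (by fun_prop)).and
        (PrimrecRat.lt (by fun_prop) (by fun_prop))).and
      ((PrimrecRat.lt (by fun_prop) (by fun_prop)).and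
        (PrimrecRat.lt (by fun_prop) (by fun_prop)))).semi
  obtain ⟨s, hs⟩ := hS.exists_select
  obtain ⟨f, hf⟩ := OracleCode.exists_eval_of_primrec (f := fun n => n.unpair.1) (by fun_prop)
  obtain ⟨g, hg⟩ := OracleCode.exists_eval_of_primrec (f := fun n =>
    Nat.pair n.unpair.2.unpair.2 (n.unpair.1.unpair.2 + n.unpair.2.unpair.1)) (by fun_prop)
  refine ⟨.prec f (.comp s g), fun p L h e he => ?_⟩
  have hstep : ∀ z k, Near p z k → ∃ z', s.eval p (Nat.pair z k) = Part.some z' ∧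
      Near p z' (k + 1) ∧ CloseCodes z z' k := by
    intro z k hz
    simpa using hs p (Nat.pair z k) (by simpa using h.exists_near_succ hz)
  choose! σ hσ using hstep
  let z : ℕ → ℕ := fun i => Nat.rec e.unpair.1 (fun i z => σ z (e.unpair.2 + i)) i
  have hz : ∀ i, Near p (z i) (e.unpair.2 + i) := by
    intro i
    induction i with
    | zero => exact he
    | succ i ih => exact (hσ _ _ ih).2.1
  refine ⟨z, rfl, hz, fun i => (hσ _ _ (hz i)).2.2, OracleCode.eval_prec_eq_some (hf p e) fun i => ?_⟩
  refine OracleCode.eval_comp (hg p _) ?_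
  simp only [Nat.unpair_pair]
  exact (hσ _ _ (hz i)).1

theorem IsName.exists_limit (h : L.IsName p) {z : ℕ → ℕ} {m : ℕ} (hz : ∀ i, Near p (z i) (m + i))
    (hc : ∀ i, CloseCodes (z i) (z (i + 1)) (m + i)) :
    ∃ x ∈ L.attractor, ∀ i, dist (ratPointOfCode (z i)) x ≤ 4 * (1 / 2) ^ (m + i) := by
  have hd : ∀ i, dist (ratPointOfCode (z i)) (ratPointOfCode (z (i + 1))) ≤
      (2 * (1 / 2) ^ m) * (1 / 2) ^ i := by
    intro i
    obtain ⟨h0, h1⟩ := closeCodes_iff.1 (hc i)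
    refine (dist_le_abs_add_abs _ _).trans ?_
    rw [mul_assoc, ← pow_add]
    linarith
  obtain ⟨x, hx⟩ := cauchySeq_tendsto_of_complete
    (cauchySeq_of_le_geometric _ _ (by norm_num : (1 / 2 : ℝ) < 1) hd)
  have hdist : ∀ i, dist (ratPointOfCode (z i)) x ≤ 4 * (1 / 2) ^ (m + i) := by
    intro i
    refine (dist_le_of_le_geometric_of_tendsto _ _ (by norm_num) hd hx i).trans (le_of_eq ?_)
    rw [pow_add]
    ring
  refine ⟨x, ?_, hdist⟩
  choose a ha ha0 ha1 using fun i => (h.near_iff _ _).1 (hz i)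
  have hax : Tendsto a atTop (𝓝 x) := by
    rw [tendsto_iff_dist_tendsto_zero]
    have hlim : Tendsto (fun i => (6 * (1 / 2) ^ m) * (1 / 2 : ℝ) ^ i) atTop (𝓝 0) := by
      simpa using (tendsto_pow_atTop_nhds_zero_of_lt_one (by norm_num : (0 : ℝ) ≤ 1 / 2)
        (by norm_num)).const_mul (6 * (1 / 2 : ℝ) ^ m)
    refine squeeze_zero (fun _ => dist_nonneg) (fun i => ?_) hlim
    refine (dist_triangle _ (ratPointOfCode (z i)) _).trans ?_
    have h1 := dist_le_abs_add_abs (a i) (ratPointOfCode (z i))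
    rw [mul_assoc, ← pow_add]
    linarith [hdist i, ha0 i, ha1 i]
  exact L.attractor.isClosed.mem_of_tendsto hax (Eventually.of_forall ha)

/-- A single oracle program computes inner names of the attractor. -/
theorem exists_innerName : ∃ c : OracleCode, ∀ (p : ℕ → ℕ) (L : LorenzReturnMap), L.IsName p →
    ∃ q : ℕ → ℕ, (∀ n, c.eval p n = Part.some (q n)) ∧ IsInnerName q (L.attractor : Set Plane) := by
  have hS : Semi fun p (v : ℕ) => Near p v.unpair.1 v.unpair.2 :=
    semi_near.comp (f := fun v : ℕ => (v.unpair.1, v.unpair.2)) (by fun_prop)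
  obtain ⟨s, hs⟩ := hS.exists_enum
  obtain ⟨c, hc⟩ := exists_refine
  obtain ⟨f, hf⟩ := OracleCode.exists_eval_of_primrec (f := fun n => n.unpair.1) (by fun_prop)
  obtain ⟨g, hg⟩ := OracleCode.exists_eval_of_primrec (f := fun n => n.unpair.2 + 3) (by fun_prop)
  refine ⟨.comp c (.pair (.comp s f) g), fun p L h => ?_⟩
  have hne : ∃ v : ℕ, Near p v.unpair.1 v.unpair.2 := by
    obtain ⟨a, ha⟩ := L.attractor_nonempty
    obtain ⟨z, hz, -⟩ := h.exists_near_of_mem ha 0 one_pos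
    exact ⟨Nat.pair z 0, by simpa using hz⟩
  obtain ⟨e, he, hrange⟩ := hs p hne
  choose z hz0 hz hzc hzeval using fun j => hc p L h (e j) ((hrange _).2 (mem_range_self j))
  choose x hx hxd using fun j => h.exists_limit (hz j) (hzc j)
  refine ⟨fun n => z n.unpair.1 (n.unpair.2 + 3), fun n => OracleCode.eval_comp
    (OracleCode.eval_pair (OracleCode.eval_comp (hf p n) (he _)) (hg p n)) (hzeval _ _),
    x, hx, fun a ha => ?_, fun j k => ?_⟩
  · refine Metric.mem_closure_iff.2 fun ε hε => ?_
    obtain ⟨k, hk⟩ := exists_half_pow_lt (show 0 < ε / 6 by positivity)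
    obtain ⟨u, hu, h0, h1⟩ := h.exists_near_of_mem ha k (by positivity : (0 : ℝ) < (1 / 2) ^ k)
    obtain ⟨j, hj⟩ := (hrange (Nat.pair u k)).1 (by simpa using hu)
    refine ⟨x j, mem_range_self j, ?_⟩
    have h2 := hxd j 0
    rw [hz0, hj, Nat.unpair_pair, add_zero] at h2
    have h3 := dist_le_abs_add_abs a (ratPointOfCode u)
    have := dist_triangle a (ratPointOfCode u) (x j)
    dsimp only at h2
    linarith
  · have h1 := hxd j (k + 3)
    rw [dist_comm] at h1
    simp only [slice, Nat.unpair_pair]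
    refine h1.trans_lt ?_
    rw [pow_add, pow_add]
    have h2 : (1 / 2 : ℝ) ^ (e j).unpair.2 ≤ 1 := pow_le_one₀ (by norm_num) (by norm_num)
    have h3 : (0 : ℝ) < (1 / 2) ^ k := by positivity
    nlinarith

/-- A single oracle program computes outer names of the attractor. -/
theorem exists_outerName : ∃ c : OracleCode, ∀ (p : ℕ → ℕ) (L : LorenzReturnMap), L.IsName p →
    ∃ q : ℕ → ℕ, (∀ n, c.eval p n = Part.some (q n)) ∧ IsOuterName q (L.attractor : Set Plane) := by
  obtain ⟨c, hc⟩ := semi_excluded.exists_enum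
  refine ⟨c, fun p L h => ?_⟩
  obtain ⟨a, ha⟩ := L.exists_notMem_attractor
  obtain ⟨u, hu, -⟩ := h.exists_excluded ha
  obtain ⟨q, hq, hrange⟩ := hc p ⟨u, hu⟩
  refine ⟨q, hq, Subset.antisymm (fun z hz => ?_) (iUnion_subset fun n => ?_)⟩
  · obtain ⟨u, hu, hzu⟩ := h.exists_excluded hz
    obtain ⟨n, rfl⟩ := (hrange u).1 hu
    exact mem_iUnion.2 ⟨n, hzu⟩
  · exact (h.disjoint_of_excluded ((hrange _).2 (mem_range_self n))).subset_compl_right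

end LorenzReturnMap

/-! ### Computability of the attractor -/

theorem theorem1 :
    ComputableMap LorenzReturnMap.IsName IsClosedSetName LorenzReturnMap.attractor := by
  obtain ⟨ci, hi⟩ := LorenzReturnMap.exists_innerName
  obtain ⟨co, ho⟩ := LorenzReturnMap.exists_outerName
  obtain ⟨f, hf⟩ := OracleCode.exists_eval_of_primrec (f := fun n => n.unpair.1) (by fun_prop)
  obtain ⟨g, hg⟩ := OracleCode.exists_eval_of_primrec (f := fun n => n.unpair.2) (by fun_prop)
  obtain ⟨e, he⟩ := OracleCode.exists_eval_of_primrec (f := fun m =>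
      if m.unpair.1 = 0 then m.unpair.2.unpair.1 else m.unpair.2.unpair.2)
    (Primrec.ite (Primrec.eq.comp (by fun_prop) (by fun_prop)) (by fun_prop) (by fun_prop))
  refine ⟨.comp e (.pair f (.pair (.comp ci g) (.comp co g))), fun p L h => ?_⟩
  obtain ⟨qi, hqi, hi⟩ := hi p L h
  obtain ⟨qo, hqo, ho⟩ := ho p L h
  refine ⟨_, fun n => OracleCode.eval_comp (OracleCode.eval_pair (hf p n)
    (OracleCode.eval_pair (OracleCode.eval_comp (hg p n) (hqi _))
      (OracleCode.eval_comp (hg p n) (hqo _)))) (he p _), ?_, ?_⟩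
  · convert hi using 1
    ext n
    simp [slice]
  · convert ho using 1
    ext n
    simp [slice]
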